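/- Let $\mathbb F$ be an algebraically closed field with $\operatorname{char}\mathbb F\neq 2$ and let $G$ be an abelian group. A *$G$-grading* on an associative superalgebra with superinvolution $(R,\varphi)$ is a decomposition $R=\bigoplus_{g\in G}R_g$ with $R_gR_h\subseteq R_{gh}$, $R_g=(R_g\cap R^{\bar 0})\oplus(R_g\cap R^{\bar 1})$ and $\varphi(R_g)\subseteq R_g$; an *isomorphism* of graded superalgebras with superinvolution is an algebra isomorphism that preserves parity and degree and commutes with the superinvolutions. **The superalgebra $M^*(m,n,p_0)$.** Let $m,n\ge 0$ be not both zero and $p_0\in\mathbb Z_2$. $M^*(m,n,p_0)$ is $M(m,n)=\operatorname{End}(\mathbb F^{m|n})$ with the superadjunction with respect to a nondegenerate supersymmetric bilinear form of parity $p_0$ on $\mathbb F^{m|n}$ (if one exists), i.e. $\langle Xu,v\rangle=(-1)^{|X||u|}\langle u,\varphi(X)v\rangle$. **The models.** Let $T\subseteq G$ be a finite elementary $2$-subgroup and $\beta:T\times T\to\mathbb F^\times$ a nondegenerate alternating bicharacter. For each such pair $(T,\beta)$ fix once and for all a decomposition $T=A\times B$ with $\beta$ trivial on $A$ and on $B$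 (one always exists), a section $\xi:G/T\to G$ of the quotient map and a linear order on $G/T$. Let $D=\operatorname{End}(N)$, where $N$ has basis $(e_b)_{b\in B}$, and for $a\in A$, $b\in B$ let $X_{ab}=X_aX_b$, where $X_ae_{b'}=\beta(a,b')e_{b'}$ and $X_be_{b'}=e_{bb'}$. Then $D$, regarded as even, is a $G$-graded algebra with $D_t=\mathbb FX_t$ for $t\in T$ and $D_g=0$ for $g\notin T$. Let $\varphi_0$ be the transposition on $D$; then $\varphi_0(X_t)=\eta(t)X_t$, where $\eta(ab)=\beta(a,b)$. Let $g_0=(h_0,p_0)\in G\times\mathbb Z_2$, and write $|g_0|=p_0$. Let $\kappa_{\bar 0},\kappa_{\bar 1}:G/T\to\mathbb Z_{\ge 0}$ have finite support and be not both zero. The pair $(\kappa_{\bar 0},\kappa_{\bar 1})$ is *$g_0$-admissible* if: * in the case $p_0=\bar 0$: for all $i\in\mathbb Z_2$ and $g\in G$, $\kappa_i(gT)=\kappa_i(h_0^{-1}g^{-1}T)$, and $\kappa_i(gT)$ is even whenever $h_0g^2\in T$ and $\eta(h_0g^2)=-(-1)^i$; * in the case $p_0=\bar 1$: for all $g\in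 G$, $\kappa_{\bar 1}(gT)=\kappa_{\bar 0}(h_0^{-1}g^{-1}T)$. In that case $M^*(T,\beta,\kappa_{\bar 0},\kappa_{\bar 1},g_0)$ is the $G$-graded superalgebra $\operatorname{End}_D(U)$ with the superadjunction with respect to $B$, where $U$ is a graded right $D$-supermodule and $B(u,v)=\sum_{k,l}\varphi_0(u_k)\Phi_{kl}v_l$ is the nondegenerate sesquilinear form of $G$-degree $h_0$ and parity $p_0$, with $B(u,v)=(-1)^{|u||v|}\varphi_0(B(v,u))$, represented by $\Phi$ in a homogeneous $D$-basis of $U$. These are as follows. * If $p_0=\bar 0$, the basis has, for each $i\in\mathbb Z_2$ and $x\in G/T$, exactly $\kappa_i(x)$ elements of parity $i$ and degree $\xi(x)$. The block of $\Phi$ at the basis elements of $(i,x)$ and $(j,y)$ is zero unless $i=j$ and $t:=h_0\xi(x)\xi(y)\in T$. In the latter case put $\varepsilon=(-1)^i\eta(t)\in\{\pm1\}$. If $x=y$, the block is $I\otimes X_t$ when $\varepsilon=1$ and $\begin{pmatrix}0&I\\-I&0\end{pmatrix}\otimes X_t$ when $\varepsilon=-1$. If $x\ne y$, it is $I\otimes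 X_t$ when $x<y$ and $\varepsilon I\otimes X_t$ when $y<x$. * If $p_0=\bar 1$, the basis consists of $\kappa_{\bar 0}(x)$ even elements of degree $\xi(x)$ for each $x\in G/T$ and, corresponding to each of them, one odd element of degree $h_0^{-1}\xi(x)^{-1}$; and $\Phi=\begin{pmatrix}0&I\\I&0\end{pmatrix}$. **Theorem.** 1. Suppose the superalgebra with superinvolution $M^*(m,n,p_0)$ is endowed with a $G$-grading. Then it is isomorphic, as a graded superalgebra with superinvolution, to some $M^*(T,\beta,\kappa_{\bar 0},\kappa_{\bar 1},g_0)$ as above with $|g_0|=p_0$. 2. $M^*(T,\beta,\kappa_{\bar 0},\kappa_{\bar 1},g_0)\cong M^*(T',\beta',\kappa'_{\bar 0},\kappa'_{\bar 1},g_0')$ as graded superalgebras with superinvolution if and only if $T=T'$, $\beta=\beta'$ and there is $g\in G$ such that $\kappa'_{\bar 0}=g\cdot\kappa_{\bar 0}$, $\kappa'_{\bar 1}=g\cdot\kappa_{\bar 1}$ and $g_0'=g^{-2}g_0$, where $(g\cdot\kappa)(x)=\kappa(g^{-1}x)$ and $g^{-2}(h_0,p_0)=(g^{-2}h_0,p_0)$.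 -/

import Mathlib

universe u v v' w

/-! ### Superalgebras with superinvolution and their gradings -/

/-- The sign `(-1)^p` in `F`. -/
def zsign (F : Type u) [Field F] (p : ZMod 2) : F := if p = 0 then 1 else -1

/-- An associative superalgebra `R = R⁰ ⊕ R¹` over `F` (unital, as all algebras below are)
with a superinvolution. -/
structure SuperinvAlgebra (F : Type u) [Field F] where
  carrier : Type v
  [ring : Ring carrier]
  [algebra : Algebra F carrier]
  part : ZMod 2 → Submodule F carrier
  isCompl_part : IsCompl (part 0) (part 1)
  mul_mem_part : ∀ {p q : ZMod 2} {a b : carrier}, a ∈ part p → b ∈ part q → a * b ∈ part (p + q)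
  inv : carrier →ₗ[F] carrier
  inv_mem_part : ∀ {p : ZMod 2} {a : carrier}, a ∈ part p → inv a ∈ part p
  inv_mul : ∀ {p q : ZMod 2} {a b : carrier}, a ∈ part p → b ∈ part q →
    inv (a * b) = zsign F (p * q) • (inv b * inv a)
  inv_inv : ∀ a : carrier, inv (inv a) = a

attribute [instance] SuperinvAlgebra.ring SuperinvAlgebra.algebra

/-- A `G`-grading on a superalgebra with superinvolution. -/
structure SuperinvAlgebra.Grading {F : Type u} [Field F] (R : SuperinvAlgebra.{u, v} F)
    (G : Type w) [CommGroup G] where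
  comp : G → Submodule F R.carrier
  indep : iSupIndep comp
  iSup_eq_top : ⨆ g, comp g = ⊤
  mul_mem : ∀ {g h : G} {a b : R.carrier}, a ∈ comp g → b ∈ comp h → a * b ∈ comp (g * h)
  part_compat : ∀ (g : G) (a : R.carrier), a ∈ comp g →
    ∃ a₀ ∈ comp g ⊓ R.part 0, ∃ a₁ ∈ comp g ⊓ R.part 1, a = a₀ + a₁
  inv_mem : ∀ {g : G} {a : R.carrier}, a ∈ comp g → R.inv a ∈ comp g

/-- A `G`-graded superalgebra with superinvolution. -/
structure GradedSuperinvAlgebra (F : Type u) [Field F] (G : Type w) [CommGroup G] where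
  alg : SuperinvAlgebra.{u, v} F
  grading : alg.Grading G

/-- Isomorphism of `G`-graded superalgebras with superinvolution. -/
def GradedSuperinvAlgebra.Iso {F : Type u} [Field F] {G : Type w} [CommGroup G]
    (R : GradedSuperinvAlgebra.{u, v} F G)
    (S : GradedSuperinvAlgebra.{u, v'} F G) : Prop :=
  ∃ e : R.alg.carrier ≃ₐ[F] S.alg.carrier,
    (∀ p, ∀ a ∈ R.alg.part p, e a ∈ S.alg.part p) ∧
    (∀ g, ∀ a ∈ R.grading.comp g, e a ∈ S.grading.comp g) ∧
    ∀ a, e (R.alg.inv a) = S.alg.inv (e a)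

set_option linter.unusedSectionVars false

section zsign

variable {F : Type u} [Field F]

theorem zsign_add (p q : ZMod 2) : zsign F (p + q) = zsign F p * zsign F q := by
  revert p q
  have h : ∀ p q : ZMod 2, (p = 0 ∧ q = 0 ∧ p + q = 0) ∨ (p = 0 ∧ q ≠ 0 ∧ p + q ≠ 0) ∨
      (p ≠ 0 ∧ q = 0 ∧ p + q ≠ 0) ∨ (p ≠ 0 ∧ q ≠ 0 ∧ p + q = 0) := by decide
  intro p q
  rcases h p q with ⟨h1, h2, h3⟩ | ⟨h1, h2, h3⟩ | ⟨h1, h2, h3⟩ | ⟨h1, h2, h3⟩ <;>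
    simp [zsign, h1, h2, h3]

theorem zsign_mul_self (p : ZMod 2) : zsign F p * zsign F p = 1 := by
  unfold zsign; split_ifs <;> simp

theorem zsign_ne_zero (p : ZMod 2) : zsign F p ≠ 0 := by
  unfold zsign; split_ifs <;> simp

theorem zsign_eq_or (p : ZMod 2) : zsign F p = 1 ∨ zsign F p = -1 := by
  unfold zsign; split_ifs <;> simp

theorem zsign_injective [NeZero (2 : F)] {p q : ZMod 2} (h : zsign F p = zsign F q) : p = q := by
  have h2 : (1 : F) ≠ -1 := by
    intro h; apply NeZero.ne (2 : F); linear_combination h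
  have key : ∀ p q : ZMod 2, (p = 0 ↔ q = 0) → p = q := by decide
  apply key
  unfold zsign at h
  split_ifs at h with h3 h4 h4
  · simp [h3, h4]
  · exact absurd h h2
  · exact absurd h.symm h2
  · simp [h3, h4]

end zsign

/-! ### Matrix superalgebras with entries in an even algebra with involution -/

/-- An involution (of the first kind) on an `F`-algebra. -/
structure AlgInvolution (F : Type u) [Field F] (D : Type v) [Ring D] [Algebra F D] where
  map : D →ₗ[F] D
  map_mul : ∀ a b, map (a * b) = map b * map a
  map_map : ∀ a, map (map a) = a

theorem AlgInvolution.map_one {F : Type u} [Field F] {D : Type v} [Ring D] [Algebra F D]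
    (φ₀ : AlgInvolution F D) : φ₀.map 1 = 1 := by
  have h := φ₀.map_mul (φ₀.map 1) 1
  rw [mul_one, φ₀.map_map, mul_one] at h
  exact h.symm

/-- The identity, as an involution of the base field. -/
def AlgInvolution.id (F : Type u) [Field F] : AlgInvolution F F where
  map := LinearMap.id
  map_mul a b := mul_comm a b
  map_map _ := rfl

section MatrixModels

variable {F : Type u} [Field F] {D : Type v} [Ring D] [Algebra F D]
  {ι : Type w} [Fintype ι] [DecidableEq ι]

/-- The component of parity `p` of the matrix superalgebra `M_ι(D)`, where `D` is even and the
basis vector of index `i` has parity `par i`. -/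
def matrixPart (F : Type u) [Field F] {D : Type v} [Ring D] [Algebra F D] {ι : Type w}
    (par : ι → ZMod 2) (p : ZMod 2) : Submodule F (Matrix ι ι D) where
  carrier := {X | ∀ i j, par i + par j ≠ p → X i j = 0}
  add_mem' hX hY i j h := by simp [hX i j h, hY i j h]
  zero_mem' _ _ _ := rfl
  smul_mem' c X hX i j h := by simp [hX i j h]

/-- The supertranspose over `(D, φ₀)`: apply `φ₀` to the entries of `X` and let the `(i, j)` entry
be `(-1)^((|i| + |j|)|i|) φ₀ (x_{j i})`. -/
def superTranspose (φ₀ : AlgInvolution F D) (par : ι → ZMod 2) :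
    Matrix ι ι D →ₗ[F] Matrix ι ι D where
  toFun X := Matrix.of fun i j => zsign F ((par i + par j) * par i) • φ₀.map (X j i)
  map_add' X Y := by ext i j; simp
  map_smul' c X := by ext i j; simp [smul_comm c]

/-- The matrix `Φ` represents, on the free right `D`-module with a basis of parities `par`, a
nondegenerate sesquilinear form `B(u, v) = ∑ φ₀ (u i) Φ i j v j` which is homogeneous of parity `p₀`
and super-Hermitian, `B(u, v) = (-1)^(|u||v|) φ₀ (B(v, u))`. For `D = F` and `φ₀ = id`, it is a
nondegenerate homogeneous supersymmetric bilinear form of parity `p₀`. -/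
structure IsSuperHermitian (φ₀ : AlgInvolution F D) (par : ι → ZMod 2) (p₀ : ZMod 2)
    (Φ : Matrix ι ι D) : Prop where
  parity : ∀ i j, Φ i j ≠ 0 → par i + par j = p₀
  herm : ∀ i j, Φ i j = zsign F (par i * par j) • φ₀.map (Φ j i)
  nondeg : IsUnit Φ

/-- The superadjunction `X ↦ Φ⁻¹ φ₀(Xˢᵀ) Φ` with respect to the form represented by `Φ`; see
`form_superAdj`. -/
noncomputable def superAdj (φ₀ : AlgInvolution F D) (par : ι → ZMod 2) (Φ : Matrix ι ι D) :
    Matrix ι ι D →ₗ[F] Matrix ι ι D where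
  toFun X := Ring.inverse Φ * superTranspose φ₀ par X * Φ
  map_add' X Y := by simp [mul_add, add_mul]
  map_smul' c X := by simp

theorem mul_superAdj (φ₀ : AlgInvolution F D) (par : ι → ZMod 2) {Φ : Matrix ι ι D}
    (hΦ : IsUnit Φ) (X : Matrix ι ι D) :
    Φ * superAdj φ₀ par Φ X = superTranspose φ₀ par X * Φ := by
  simp only [superAdj, LinearMap.coe_mk, AddHom.coe_mk]
  rw [← mul_assoc, ← mul_assoc, Ring.mul_inverse_cancel _ hΦ, one_mul]

/-- `superAdj` is the superadjunction: `B(X u, v) = (-1)^(|X||u|) B(u, φ(X) v)`, where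
`B(u, v) = ∑ φ₀ (u i) Φ i j v j`. -/
theorem form_superAdj (φ₀ : AlgInvolution F D) (par : ι → ZMod 2) {Φ : Matrix ι ι D}
    (hΦ : IsUnit Φ) {p q : ZMod 2} {X : Matrix ι ι D} (hX : X ∈ matrixPart F par p)
    {u v : ι → D} (hu : ∀ i, par i ≠ q → u i = 0) :
    (∑ i, ∑ j, φ₀.map ((X.mulVec u) i) * Φ i j * v j) =
      zsign F (p * q) • ∑ i, ∑ j, φ₀.map (u i) * Φ i j * ((superAdj φ₀ par Φ X).mulVec v) j := by
  have hR : ∀ i, ∑ j, φ₀.map (u i) * Φ i j * ((superAdj φ₀ par Φ X).mulVec v) j =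
      φ₀.map (u i) * ((superTranspose φ₀ par X * Φ).mulVec v) i := by
    intro i
    rw [← mul_superAdj φ₀ par hΦ, ← Matrix.mulVec_mulVec]
    conv_rhs => rw [Matrix.mulVec, dotProduct, Finset.mul_sum]
    simp [mul_assoc]
  simp_rw [hR]
  have hL : ∀ i, ∑ j, φ₀.map ((X.mulVec u) i) * Φ i j * v j =
      ∑ k, φ₀.map (u k) * φ₀.map (X i k) * (Φ.mulVec v) i := by
    intro i
    simp only [Matrix.mulVec, dotProduct, map_sum, φ₀.map_mul, Finset.sum_mul, Finset.mul_sum,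
      mul_assoc]
    rw [Finset.sum_comm]
  simp_rw [hL]
  rw [Finset.sum_comm, Finset.smul_sum]
  refine Finset.sum_congr rfl fun k _ => ?_
  rw [← Matrix.mulVec_mulVec]
  conv_rhs => rw [Matrix.mulVec, dotProduct, Finset.mul_sum, Finset.smul_sum]
  refine Finset.sum_congr rfl fun i _ => ?_
  simp only [superTranspose, LinearMap.coe_mk, AddHom.coe_mk, Matrix.of_apply]
  by_cases hk : par k = q
  · by_cases hi : par i + par k = p
    · subst hk hi
      rw [smul_mul_assoc, mul_smul_comm, smul_smul, add_comm (par i), zsign_mul_self, one_smul,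
        mul_assoc]
    · simp [hX i k hi]
  · simp [hu k hk]

theorem superTranspose_mul (φ₀ : AlgInvolution F D) {par : ι → ZMod 2} {p q : ZMod 2}
    {X Y : Matrix ι ι D} (hX : X ∈ matrixPart F par p) (hY : Y ∈ matrixPart F par q) :
    superTranspose φ₀ par (X * Y) =
      zsign F (p * q) • (superTranspose φ₀ par Y * superTranspose φ₀ par X) := by
  ext i j
  simp only [superTranspose, LinearMap.coe_mk, AddHom.coe_mk, Matrix.of_apply, Matrix.mul_apply,
    Matrix.smul_apply, map_sum, φ₀.map_mul, Finset.smul_sum]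
  refine Finset.sum_congr rfl fun k _ => ?_
  by_cases hi : par k + par i = q
  · by_cases hj : par j + par k = p
    · subst hi hj
      rw [smul_mul_assoc, mul_smul_comm, smul_smul, smul_smul]
      congr 1
      rw [← zsign_add, ← zsign_add]
      congr 1
      generalize par i = a
      generalize par j = b
      generalize par k = c
      revert a b c
      decide
    · simp [hX j k hj]
  · simp [hY k i hi]

theorem matrixPart_mul {par : ι → ZMod 2} {p q : ZMod 2}
    {X Y : Matrix ι ι D} (hX : X ∈ matrixPart F par p) (hY : Y ∈ matrixPart F par q) :
    X * Y ∈ matrixPart F par (p + q) := by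
  intro i j h
  rw [Matrix.mul_apply]
  refine Finset.sum_eq_zero fun k _ => ?_
  by_cases h1 : par i + par k = p
  · by_cases h2 : par k + par j = q
    · refine absurd ?_ h
      subst h1 h2
      generalize par i = a
      generalize par j = b
      generalize par k = c
      revert a b c
      decide
    · rw [hY k j h2, mul_zero]
  · rw [hX i k h1, zero_mul]

theorem superTranspose_mem {φ₀ : AlgInvolution F D} {par : ι → ZMod 2} {p : ZMod 2}
    {X : Matrix ι ι D} (hX : X ∈ matrixPart F par p) :
    superTranspose φ₀ par X ∈ matrixPart F par p := by
  intro i j h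
  simp [superTranspose, hX j i (by rwa [add_comm])]

theorem signDiag_mul (par : ι → ZMod 2) {p : ZMod 2} {X : Matrix ι ι D}
    (hX : X ∈ matrixPart F par p) :
    Matrix.diagonal (fun i => algebraMap F D (zsign F (par i))) * X =
      zsign F p • (X * Matrix.diagonal (fun i => algebraMap F D (zsign F (par i)))) := by
  ext i j
  rw [Matrix.diagonal_mul, Matrix.smul_apply, Matrix.mul_diagonal, ← Algebra.commutes,
    ← Algebra.smul_def, ← Algebra.smul_def, smul_smul]
  by_cases h : par i + par j = p
  · rw [← h, zsign_add, mul_assoc, zsign_mul_self, mul_one]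
  · simp [hX i j h]

theorem mem_of_signDiag_mul [NeZero (2 : F)] (par : ι → ZMod 2) {p : ZMod 2} {X : Matrix ι ι D}
    (hX : Matrix.diagonal (fun i => algebraMap F D (zsign F (par i))) * X =
      zsign F p • (X * Matrix.diagonal (fun i => algebraMap F D (zsign F (par i))))) :
    X ∈ matrixPart F par p := by
  intro i j h
  have h1 := congrFun (congrFun hX i) j
  rw [Matrix.diagonal_mul, Matrix.smul_apply, Matrix.mul_diagonal, ← Algebra.commutes,
    ← Algebra.smul_def, ← Algebra.smul_def, smul_smul, ← sub_eq_zero, ← sub_smul] at h1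
  rcases smul_eq_zero.1 h1 with h2 | h2
  · exfalso
    apply h
    rw [sub_eq_zero, ← zsign_add] at h2
    have h3 := zsign_injective h2
    rw [h3]
    have key : ∀ p a : ZMod 2, p + a + a = p := by decide
    exact key _ _
  · exact h2

theorem signDiag_mul_self (par : ι → ZMod 2) :
    Matrix.diagonal (fun i => algebraMap F D (zsign F (par i))) *
      Matrix.diagonal (fun i => algebraMap F D (zsign F (par i))) = 1 := by
  rw [Matrix.diagonal_mul_diagonal]
  simp only [← map_mul, zsign_mul_self, map_one]
  exact Matrix.diagonal_one

theorem superTranspose_superTranspose (φ₀ : AlgInvolution F D) {par : ι → ZMod 2} {p : ZMod 2}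
    {X : Matrix ι ι D} (hX : X ∈ matrixPart F par p) :
    superTranspose φ₀ par (superTranspose φ₀ par X) = zsign F p • X := by
  ext i j
  simp only [superTranspose, LinearMap.coe_mk, AddHom.coe_mk, Matrix.of_apply, Matrix.smul_apply,
    map_smul, φ₀.map_map, smul_smul]
  by_cases h : par i + par j = p
  · rw [← zsign_add, ← h]
    congr 2
    generalize par i = a
    generalize par j = b
    revert a b
    decide
  · simp [hX i j h]

theorem IsSuperHermitian.mem {φ₀ : AlgInvolution F D} {par : ι → ZMod 2} {p₀ : ZMod 2}
    {Φ : Matrix ι ι D} (h : IsSuperHermitian φ₀ par p₀ Φ) : Φ ∈ matrixPart F par p₀ := by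
  intro i j hij
  by_contra h0
  exact hij (h.parity i j h0)

theorem IsSuperHermitian.superTranspose_eq {φ₀ : AlgInvolution F D} {par : ι → ZMod 2}
    {p₀ : ZMod 2} {Φ : Matrix ι ι D} (h : IsSuperHermitian φ₀ par p₀ Φ) :
    superTranspose φ₀ par Φ =
      Matrix.diagonal (fun i => algebraMap F D (zsign F (par i))) * Φ := by
  ext i j
  rw [Matrix.diagonal_mul, ← Algebra.smul_def]
  conv_rhs => rw [h.herm i j, smul_smul]
  simp only [superTranspose, LinearMap.coe_mk, AddHom.coe_mk, Matrix.of_apply]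
  rw [← zsign_add]
  congr 2
  generalize par i = a
  generalize par j = b
  revert a b
  decide

theorem superAdj_mem [NeZero (2 : F)] {φ₀ : AlgInvolution F D} {par : ι → ZMod 2} {p₀ : ZMod 2}
    {Φ : Matrix ι ι D} (h : IsSuperHermitian φ₀ par p₀ Φ) {p : ZMod 2} {X : Matrix ι ι D}
    (hX : X ∈ matrixPart F par p) : superAdj φ₀ par Φ X ∈ matrixPart F par p := by
  set P : Matrix ι ι D := Matrix.diagonal (fun i => algebraMap F D (zsign F (par i))) with hP
  set Y := superAdj φ₀ par Φ X with hY
  have h1 : Φ * Y = superTranspose φ₀ par X * Φ := mul_superAdj φ₀ par h.nondeg X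
  apply mem_of_signDiag_mul
  rw [← hP]
  have h2 := signDiag_mul par h.mem
  have h3 := signDiag_mul par (superTranspose_mem (φ₀ := φ₀) hX)
  rw [← hP] at h2 h3
  have h4 : Φ * (P * Y) = Φ * (zsign F p • (Y * P)) := by
    have h5 : zsign F p₀ • (Φ * (P * Y)) = zsign F p₀ • (Φ * (zsign F p • (Y * P))) := by
      calc zsign F p₀ • (Φ * (P * Y)) = (zsign F p₀ • (Φ * P)) * Y := by
            rw [smul_mul_assoc, mul_assoc]
        _ = P * (Φ * Y) := by rw [← h2, mul_assoc]
        _ = P * superTranspose φ₀ par X * Φ := by rw [h1, mul_assoc]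
        _ = zsign F p • (superTranspose φ₀ par X * (P * Φ)) := by
            rw [h3, smul_mul_assoc, mul_assoc]
        _ = zsign F p₀ • (Φ * (zsign F p • (Y * P))) := by
            rw [h2, mul_smul_comm, ← mul_assoc, ← h1, mul_smul_comm, smul_comm, mul_assoc]
    have := congrArg (fun Z => zsign F p₀ • Z) h5
    simpa only [smul_smul, zsign_mul_self, one_smul] using this
  exact h.nondeg.mul_left_cancel h4

theorem isCompl_matrixPart (par : ι → ZMod 2) :
    IsCompl (matrixPart F (D := D) par 0) (matrixPart F par 1) := by
  have key : ∀ a : ZMod 2, a ≠ 0 ∨ a ≠ 1 := by decide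
  have key2 : ∀ a : ZMod 2, a ≠ 1 → a = 0 := by decide
  constructor
  · rw [Submodule.disjoint_def]
    intro X h0 h1
    ext i j
    rcases key (par i + par j) with h | h
    · exact h0 i j h
    · exact h1 i j h
  · rw [codisjoint_iff, Submodule.eq_top_iff']
    intro X
    rw [Submodule.mem_sup]
    refine ⟨Matrix.of fun i j => if par i + par j = 0 then X i j else 0, ?_,
      Matrix.of fun i j => if par i + par j = 0 then 0 else X i j, ?_, ?_⟩
    · intro i j h; simp [h]
    · intro i j h; simp [key2 _ h]
    · ext i j; simp only [Matrix.add_apply, Matrix.of_apply]; split_ifs <;> simp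

theorem superAdj_mul [NeZero (2 : F)] {φ₀ : AlgInvolution F D} {par : ι → ZMod 2} {p₀ : ZMod 2}
    {Φ : Matrix ι ι D} (h : IsSuperHermitian φ₀ par p₀ Φ) {p q : ZMod 2} {X Y : Matrix ι ι D}
    (hX : X ∈ matrixPart F par p) (hY : Y ∈ matrixPart F par q) :
    superAdj φ₀ par Φ (X * Y) =
      zsign F (p * q) • (superAdj φ₀ par Φ Y * superAdj φ₀ par Φ X) := by
  apply h.nondeg.mul_left_cancel
  rw [mul_superAdj φ₀ par h.nondeg, superTranspose_mul φ₀ hX hY, mul_smul_comm, ← mul_assoc,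
    mul_superAdj φ₀ par h.nondeg, mul_assoc, mul_superAdj φ₀ par h.nondeg, smul_mul_assoc,
    mul_assoc]

theorem superAdj_superAdj [NeZero (2 : F)] {φ₀ : AlgInvolution F D} {par : ι → ZMod 2}
    {p₀ : ZMod 2} {Φ : Matrix ι ι D} (h : IsSuperHermitian φ₀ par p₀ Φ) (X : Matrix ι ι D) :
    superAdj φ₀ par Φ (superAdj φ₀ par Φ X) = X := by
  have main : ∀ (p : ZMod 2) (X : Matrix ι ι D), X ∈ matrixPart F par p →
      superAdj φ₀ par Φ (superAdj φ₀ par Φ X) = X := by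
    intro p X hX
    apply h.nondeg.mul_left_cancel
    rw [mul_superAdj φ₀ par h.nondeg]
    set P : Matrix ι ι D := Matrix.diagonal (fun i => algebraMap F D (zsign F (par i))) with hP
    set Y := superAdj φ₀ par Φ X with hY
    have hYm : Y ∈ matrixPart F par p := superAdj_mem h hX
    have h1 : Φ * Y = superTranspose φ₀ par X * Φ := mul_superAdj φ₀ par h.nondeg X
    have h2 := congrArg (superTranspose φ₀ par) h1
    rw [superTranspose_mul φ₀ h.mem hYm, superTranspose_mul φ₀ (superTranspose_mem hX) h.mem,
      superTranspose_superTranspose φ₀ hX, h.superTranspose_eq, ← hP, mul_comm p p₀] at h2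
    have h3 : superTranspose φ₀ par Y * (P * Φ) = P * Φ * (zsign F p • X) := by
      have := congrArg (fun Z => zsign F (p₀ * p) • Z) h2
      simpa only [smul_smul, zsign_mul_self, one_smul] using this
    have h4 := signDiag_mul par (superTranspose_mem (φ₀ := φ₀) hYm)
    rw [← hP] at h4
    have h5 : zsign F p • (superTranspose φ₀ par Y * P) = P * superTranspose φ₀ par Y := h4.symm
    have h6 : P * (superTranspose φ₀ par Y * Φ) = P * (Φ * X) := by
      calc P * (superTranspose φ₀ par Y * Φ) = (P * superTranspose φ₀ par Y) * Φ := by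
            rw [mul_assoc]
        _ = zsign F p • (superTranspose φ₀ par Y * (P * Φ)) := by
            rw [h4, smul_mul_assoc, mul_assoc]
        _ = P * (Φ * X) := by
            rw [h3, mul_smul_comm, smul_smul, zsign_mul_self, one_smul, mul_assoc]
    have h7 := congrArg (fun Z => P * Z) h6
    have h8 : P * P = 1 := signDiag_mul_self par
    rwa [← mul_assoc, ← mul_assoc P P, h8, one_mul, one_mul] at h7
  have hX : X ∈ matrixPart F par 0 ⊔ matrixPart F par 1 := by
    rw [(isCompl_matrixPart par).sup_eq_top]; trivial
  obtain ⟨X0, h0, X1, h1, rfl⟩ := Submodule.mem_sup.1 hX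
  rw [map_add, map_add, main 0 X0 h0, main 1 X1 h1]

/-- The superalgebra `M_ι(D)`, identified with `End_D(U)` by means of a homogeneous basis with
parities `par` of the free right `D`-module `U`, with the superadjunction with respect to the form
represented by `Φ`. -/
noncomputable def matrixSuperinv [NeZero (2 : F)] {φ₀ : AlgInvolution F D} {par : ι → ZMod 2}
    {p₀ : ZMod 2} {Φ : Matrix ι ι D} (h : IsSuperHermitian φ₀ par p₀ Φ) : SuperinvAlgebra F where
  carrier := Matrix ι ι D
  part := matrixPart F par
  isCompl_part := isCompl_matrixPart par
  mul_mem_part := matrixPart_mul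
  inv := superAdj φ₀ par Φ
  inv_mem_part := superAdj_mem h
  inv_mul := superAdj_mul h
  inv_inv := superAdj_superAdj h

/-- The superalgebra with superinvolution `M*(m, n, p₀)`: the endomorphisms of `F^{m|n}` with the
superadjunction with respect to the nondegenerate supersymmetric bilinear form of parity `p₀`
represented by `Φ`. -/
noncomputable def MStar [NeZero (2 : F)] (m n : ℕ) (p₀ : ZMod 2)
    (Φ : Matrix (Fin m ⊕ Fin n) (Fin m ⊕ Fin n) F)
    (h : IsSuperHermitian (AlgInvolution.id F) (Sum.elim (fun _ => 0) (fun _ => 1)) p₀ Φ) :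
    SuperinvAlgebra F :=
  matrixSuperinv h

end MatrixModels

section MatrixGrading

variable {F : Type u} [Field F] {D : Type v} [Ring D] [Algebra F D]
  {ι : Type w} [Fintype ι] [DecidableEq ι] {G : Type v'} [CommGroup G]

/-- The component of degree `g` of `M_ι(D)`, where the basis vector of index `i` has degree `γ i`:
the matrix with `d` of degree `t` at `(i, j)` and zeros elsewhere has degree `γ i * t * (γ j)⁻¹`. -/
def matrixComp (𝒟 : G → Submodule F D) (γ : ι → G) (g : G) : Submodule F (Matrix ι ι D) where
  carrier := {X | ∀ i j, X i j ∈ 𝒟 ((γ i)⁻¹ * g * γ j)}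
  add_mem' hX hY i j := add_mem (hX i j) (hY i j)
  zero_mem' _ _ := zero_mem _
  smul_mem' c _ hX i j := Submodule.smul_mem _ c (hX i j)

theorem matrixComp_indep {𝒟 : G → Submodule F D} (h𝒟 : iSupIndep 𝒟) (γ : ι → G) :
    iSupIndep (matrixComp 𝒟 γ) := by
  intro g
  rw [Submodule.disjoint_def]
  intro X hX hX'
  ext i j
  have h1 := h𝒟 ((γ i)⁻¹ * g * γ j)
  rw [Submodule.disjoint_def] at h1
  refine h1 _ (hX i j) ?_
  let L : Matrix ι ι D →ₗ[F] D := Matrix.entryLinearMap F D i j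
  change L X ∈ _
  have h2 : (⨆ g', ⨆ (_ : g' ≠ g), matrixComp 𝒟 γ g') ≤
      (⨆ k, ⨆ (_ : k ≠ (γ i)⁻¹ * g * γ j), 𝒟 k).comap L := by
    refine iSup₂_le fun g' hg' Y hY => ?_
    refine Submodule.mem_iSup_of_mem ((γ i)⁻¹ * g' * γ j) (Submodule.mem_iSup_of_mem ?_ (hY i j))
    simpa using hg'
  exact h2 hX'

theorem matrixComp_iSup {𝒟 : G → Submodule F D} (h𝒟 : ⨆ g, 𝒟 g = ⊤) (γ : ι → G) :
    ⨆ g, matrixComp 𝒟 γ g = ⊤ := by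
  rw [Submodule.eq_top_iff']
  intro X
  rw [Matrix.matrix_eq_sum_single X]
  refine sum_mem fun i _ => sum_mem fun j _ => ?_
  have h1 : ∀ d : D, d ∈ (⨆ g, 𝒟 g) → Matrix.single i j d ∈ ⨆ g, matrixComp 𝒟 γ g := by
    intro d hd
    have h2 : (⨆ g, 𝒟 g) ≤
        (⨆ g, matrixComp 𝒟 γ g).comap (Matrix.singleLinearMap F i j) := by
      refine iSup_le fun g d hd => ?_
      refine Submodule.mem_iSup_of_mem (γ i * g * (γ j)⁻¹) ?_
      intro i' j'
      change Matrix.single i j d i' j' ∈ _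
      rw [Matrix.single_apply]
      split_ifs with h
      · obtain ⟨rfl, rfl⟩ := h
        convert hd using 2
        group
      · exact zero_mem _
    exact h2 hd
  exact h1 _ (by rw [h𝒟]; trivial)

theorem matrixComp_mul {𝒟 : G → Submodule F D}
    (h𝒟 : ∀ {g h : G} {a b : D}, a ∈ 𝒟 g → b ∈ 𝒟 h → a * b ∈ 𝒟 (g * h)) (γ : ι → G) {g h : G}
    {X Y : Matrix ι ι D} (hX : X ∈ matrixComp 𝒟 γ g) (hY : Y ∈ matrixComp 𝒟 γ h) :
    X * Y ∈ matrixComp 𝒟 γ (g * h) := by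
  intro i j
  rw [Matrix.mul_apply]
  refine sum_mem fun k _ => ?_
  convert h𝒟 (hX i k) (hY k j) using 2
  group

theorem matrixComp_compat (𝒟 : G → Submodule F D) (γ : ι → G) (par : ι → ZMod 2) (g : G)
    (X : Matrix ι ι D) (hX : X ∈ matrixComp 𝒟 γ g) :
    ∃ X₀ ∈ matrixComp 𝒟 γ g ⊓ matrixPart F par 0, ∃ X₁ ∈ matrixComp 𝒟 γ g ⊓ matrixPart F par 1,
      X = X₀ + X₁ := by
  have key2 : ∀ a : ZMod 2, a ≠ 1 → a = 0 := by decide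
  refine ⟨Matrix.of fun i j => if par i + par j = 0 then X i j else 0, ⟨?_, ?_⟩,
    Matrix.of fun i j => if par i + par j = 0 then 0 else X i j, ⟨?_, ?_⟩, ?_⟩
  · intro i j
    simp only [Matrix.of_apply]
    split_ifs
    · exact hX i j
    · exact zero_mem _
  · intro i j h; simp [h]
  · intro i j
    simp only [Matrix.of_apply]
    split_ifs
    · exact zero_mem _
    · exact hX i j
  · intro i j h; simp [key2 _ h]
  · ext i j; simp only [Matrix.add_apply, Matrix.of_apply]; split_ifs <;> simp

/-- Data that make `D` with the components `𝒟` a graded algebra with a degree-preserving involution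
`φ₀`. -/
structure IsInvolutionGrading (φ₀ : AlgInvolution F D) (𝒟 : G → Submodule F D) : Prop where
  indep : iSupIndep 𝒟
  iSup_eq_top : ⨆ g, 𝒟 g = ⊤
  mul_mem : ∀ {g h : G} {a b : D}, a ∈ 𝒟 g → b ∈ 𝒟 h → a * b ∈ 𝒟 (g * h)
  map_mem : ∀ {g : G} {a : D}, a ∈ 𝒟 g → φ₀.map a ∈ 𝒟 g

/-- The form represented by `Φ` has degree `h₀`, and in every column of `Φ` there is an invertible
entry, alone in its row, with a homogeneous inverse. -/
structure IsHomogeneousForm (𝒟 : G → Submodule F D) (γ : ι → G) (h₀ : G) (Φ : Matrix ι ι D) :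
    Prop where
  mem : ∀ i j, Φ i j ∈ 𝒟 (h₀ * γ i * γ j)
  exists_partner : ∀ k, ∃ i, (∀ j, j ≠ k → Φ i j = 0) ∧
    ∃ a ∈ 𝒟 (h₀ * γ i * γ k)⁻¹, a * Φ i k = 1

theorem IsHomogeneousForm.isUnit [FiniteDimensional F D] {𝒟 : G → Submodule F D} {γ : ι → G}
    {h₀ : G} {Φ : Matrix ι ι D} (h : IsHomogeneousForm 𝒟 γ h₀ Φ) : IsUnit Φ := by
  have hinj : ∀ M : Matrix ι ι D, Φ * M = 0 → M = 0 := by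
    intro M hM
    ext k j
    obtain ⟨i, hi, a, -, ha⟩ := h.exists_partner k
    have h1 := congrFun (congrFun hM i) j
    rw [Matrix.mul_apply, Finset.sum_eq_single k] at h1
    · have h2 := congrArg (fun z => a * z) h1
      simpa [← mul_assoc, ha] using h2
    · intro b _ hb; rw [hi b hb, zero_mul]
    · simp
  have hi : Function.Injective (LinearMap.mulLeft F Φ) := by
    rw [injective_iff_map_eq_zero]
    exact hinj
  obtain ⟨N, hN⟩ := (LinearMap.injective_iff_surjective.1 hi) 1
  have hN' : Φ * N = 1 := hN
  refine ⟨⟨Φ, N, hN', ?_⟩, rfl⟩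
  have : Φ * (N * Φ - 1) = 0 := by rw [mul_sub, ← mul_assoc, hN']; simp
  exact sub_eq_zero.1 (hinj _ this)

theorem superAdj_mem_matrixComp {φ₀ : AlgInvolution F D} {𝒟 : G → Submodule F D}
    (h𝒟 : IsInvolutionGrading φ₀ 𝒟) {par : ι → ZMod 2} {p₀ : ZMod 2} {Φ : Matrix ι ι D}
    (h : IsSuperHermitian φ₀ par p₀ Φ) {γ : ι → G} {h₀ : G} (hγ : IsHomogeneousForm 𝒟 γ h₀ Φ)
    {g : G} {X : Matrix ι ι D} (hX : X ∈ matrixComp 𝒟 γ g) :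
    superAdj φ₀ par Φ X ∈ matrixComp 𝒟 γ g := by
  intro k j
  obtain ⟨i, hi, a, ha, hak⟩ := hγ.exists_partner k
  have h1 := congrFun (congrFun (mul_superAdj φ₀ par h.nondeg X) i) j
  rw [Matrix.mul_apply, Finset.sum_eq_single k] at h1
  · have h2 := congrArg (fun z => a * z) h1
    rw [← mul_assoc, hak, one_mul] at h2
    rw [h2, Matrix.mul_apply, Finset.mul_sum]
    refine sum_mem fun l _ => ?_
    have h3 : superTranspose φ₀ par X i l ∈ 𝒟 ((γ l)⁻¹ * g * γ i) :=
      Submodule.smul_mem _ _ (h𝒟.map_mem (hX l i))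
    have h4 := h𝒟.mul_mem ha (h𝒟.mul_mem h3 (hγ.mem l j))
    convert h4 using 2
    calc (γ k)⁻¹ * g * γ j
        = (γ k)⁻¹ * g * γ j * (h₀ * h₀⁻¹) * (γ l * (γ l)⁻¹) * (γ i * (γ i)⁻¹) := by simp
      _ = _ := by simp only [mul_inv]; ac_rfl
  · intro b _ hb; rw [hi b hb, zero_mul]
  · simp

/-- The graded superalgebra with superinvolution `E(D, U, B)`, written in matrices with respect to
a homogeneous basis of `U` with parities `par` and degrees `γ` in which `B` is represented
by `Φ`. -/
noncomputable def matrixGraded [NeZero (2 : F)] {φ₀ : AlgInvolution F D} {𝒟 : G → Submodule F D}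
    (h𝒟 : IsInvolutionGrading φ₀ 𝒟) {par : ι → ZMod 2} {p₀ : ZMod 2} {Φ : Matrix ι ι D}
    (h : IsSuperHermitian φ₀ par p₀ Φ) {γ : ι → G} {h₀ : G} (hγ : IsHomogeneousForm 𝒟 γ h₀ Φ) :
    GradedSuperinvAlgebra F G where
  alg := matrixSuperinv h
  grading :=
    { comp := matrixComp 𝒟 γ
      indep := matrixComp_indep h𝒟.indep γ
      iSup_eq_top := matrixComp_iSup h𝒟.iSup_eq_top γ
      mul_mem := matrixComp_mul h𝒟.mul_mem γ
      part_compat := matrixComp_compat 𝒟 γ par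
      inv_mem := superAdj_mem_matrixComp h𝒟 h hγ }

end MatrixGrading

/-! ### Standard realizations of graded-division algebras -/

/-- A pair `(T, β)`: a finite elementary 2-subgroup `T` of `G` and a nondegenerate alternating
bicharacter `β : T × T → Fˣ`. -/
structure BicharPair (F : Type u) [Field F] (G : Type v) [CommGroup G] where
  T : Subgroup G
  finite : Finite T
  mul_self : ∀ t : T, t * t = 1
  β : T →* T →* Fˣ
  alternating : ∀ t, β t t = 1
  nondegenerate : ∀ t, (∀ s, β t s = 1) → t = 1

/-- The choices which the explicit models attached to `(T, β)` depend on: a decomposition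
`T = A × B` such that `β` is trivial on `A` and on `B`, a section `ξ` of `G → G/T`,
and a linear order on `G/T` (by which the two cosets in a pair are ordered). -/
structure BicharPair.Choice {F : Type u} [Field F] {G : Type v} [CommGroup G]
    (E : BicharPair F G) where
  A : Subgroup E.T
  B : Subgroup E.T
  isComplement : A.IsComplement' B
  β_A : ∀ a ∈ A, ∀ a' ∈ A, E.β a a' = 1
  β_B : ∀ b ∈ B, ∀ b' ∈ B, E.β b b' = 1
  ξ : G ⧸ E.T → G
  mk_ξ : ∀ x, (ξ x : G ⧸ E.T) = x
  ord : LinearOrder (G ⧸ E.T)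

section Standard

variable {F : Type u} [Field F] {G : Type v} [CommGroup G] {E : BicharPair F G}

instance : Finite E.T := E.finite

theorem BicharPair.inv_eq (t : E.T) : t⁻¹ = t := inv_eq_of_mul_eq_one_right (E.mul_self t)

theorem BicharPair.β_mul_self (s t : E.T) : E.β s t * E.β s t = 1 := by
  rw [← map_mul, E.mul_self, map_one]

theorem BicharPair.β_comm (s t : E.T) : E.β s t = E.β t s := by
  have h := E.alternating (s * t)
  simp only [map_mul, MonoidHom.mul_apply, E.alternating, one_mul, mul_one] at h
  have h2 := E.β_mul_self t s
  exact mul_right_cancel ((mul_comm _ _).trans (h.trans h2.symm))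

/-- With enough roots of unity (here, `-1 ≠ 1`), orthogonal complements with respect to `β` are
involutive. -/
theorem BicharPair.mem_of_perp [NeZero (2 : F)] (H : Subgroup E.T) (x : E.T)
    (hx : ∀ s, (∀ y ∈ H, E.β s y = 1) → E.β s x = 1) : x ∈ H := by
  have h2 : HasEnoughRootsOfUnity F 2 :=
    { prim := ⟨-1, IsPrimitiveRoot.neg_one (ringChar F) (by
        intro h
        have : CharP F 2 := h ▸ ringChar.charP F
        exact NeZero.ne (2 : F) (CharTwo.two_eq_zero))⟩
      cyc := inferInstance }
  have hexp : Monoid.exponent E.T ∣ 2 := by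
    rw [Monoid.exponent_dvd_iff_forall_pow_eq_one]
    intro t
    rw [pow_two, E.mul_self]
  have : HasEnoughRootsOfUnity F (Monoid.exponent E.T) := HasEnoughRootsOfUnity.of_dvd F hexp
  have hinj : Function.Injective E.β := by
    rw [injective_iff_map_eq_one]
    intro t ht
    exact E.nondegenerate t fun s => by rw [ht]; rfl
  have hcard : Nat.card E.T = Nat.card (E.T →* Fˣ) :=
    (CommGroup.card_monoidHom_of_hasEnoughRootsOfUnity E.T F).symm
  have : Finite (E.T →* Fˣ) := Nat.finite_of_card_ne_zero (hcard ▸ Nat.card_pos.ne')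
  have hsurj := ((Nat.bijective_iff_injective_and_card E.β).2 ⟨hinj, hcard⟩).2
  rw [← CommGroup.forall_monoidHom_apply_eq_one_iff F H x]
  intro φ hφ
  obtain ⟨s, rfl⟩ := hsurj φ
  exact hx s hφ

theorem BicharPair.isotropic_sup {H : Subgroup E.T} (hH : ∀ a ∈ H, ∀ b ∈ H, E.β a b = 1)
    {t : E.T} (ht : ∀ a ∈ H, E.β t a = 1) :
    ∀ a ∈ H ⊔ Subgroup.zpowers t, ∀ b ∈ H ⊔ Subgroup.zpowers t, E.β a b = 1 := by
  intro a ha b hb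
  obtain ⟨a, ha', _, ⟨m, rfl⟩, rfl⟩ := Subgroup.mem_sup.1 ha
  obtain ⟨b, hb', _, ⟨n, rfl⟩, rfl⟩ := Subgroup.mem_sup.1 hb
  simp [map_mul, map_zpow, hH a ha' b hb', ht b hb', E.β_comm a t, ht a ha', E.alternating]

/-- Decompositions `T = A × B` as in `BicharPair.Choice` exist. -/
theorem BicharPair.nonempty_choice [NeZero (2 : F)] (E : BicharPair F G) : Nonempty E.Choice := by
  classical
  have hbot : ∀ a ∈ (⊥ : Subgroup E.T), ∀ b ∈ (⊥ : Subgroup E.T), E.β a b = 1 := by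
    intro a ha b _
    rw [Subgroup.mem_bot.1 ha, map_one, MonoidHom.one_apply]
  obtain ⟨A, hA⟩ := (Set.toFinite {H : Subgroup E.T | ∀ a ∈ H, ∀ b ∈ H, E.β a b = 1}).exists_maximal
    ⟨⊥, hbot⟩
  have hA1 := hA.1
  have hAself : ∀ t, (∀ a ∈ A, E.β t a = 1) → t ∈ A := by
    intro t ht
    have h1 := hA.2 (E.isotropic_sup hA1 ht) le_sup_left
    exact h1 (Subgroup.mem_sup_right (Subgroup.mem_zpowers t))
  obtain ⟨B, hB⟩ := (Set.toFinite {H : Subgroup E.T | (∀ a ∈ H, ∀ b ∈ H, E.β a b = 1) ∧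
    H ⊓ A = ⊥}).exists_maximal ⟨⊥, hbot, bot_inf_eq A⟩
  obtain ⟨⟨hB1, hBA⟩, hBmax⟩ := hB
  have htop : A ⊔ B = ⊤ := by
    by_contra hne
    -- a nontrivial element orthogonal to `A` and `B`
    obtain ⟨x, hx⟩ : ∃ x, x ∉ A ⊔ B := by
      by_contra hcon
      push Not at hcon
      exact hne (eq_top_iff.2 fun x _ => hcon x)
    have hx' : ¬ ∀ s, (∀ y ∈ A ⊔ B, E.β s y = 1) → E.β s x = 1 := fun h => hx (E.mem_of_perp _ x h)
    push Not at hx'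
    obtain ⟨s, hs, hsx⟩ := hx'
    have hsA : s ∈ A := hAself s fun a ha => hs a (Subgroup.mem_sup_left ha)
    have hsB : s ∉ B := by
      intro h
      have : s ∈ B ⊓ A := ⟨h, hsA⟩
      rw [hBA, Subgroup.mem_bot] at this
      subst this
      simp at hsx
    -- an element orthogonal to `B` outside `A ⊔ B`
    have hs' : ¬ ∀ r, (∀ y ∈ B, E.β r y = 1) → E.β r s = 1 := fun h => hsB (E.mem_of_perp _ s h)
    push Not at hs'
    obtain ⟨r, hr, hrs⟩ := hs'
    have hrAB : r ∉ A ⊔ B := by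
      intro h
      rw [E.β_comm] at hrs
      exact hrs (hs r h)
    have h1 : B ⊔ Subgroup.zpowers r ≤ B := by
      refine hBmax ⟨E.isotropic_sup hB1 hr, ?_⟩ le_sup_left
      rw [eq_bot_iff]
      rintro y ⟨hy, hyA⟩
      obtain ⟨b, hb, _, ⟨m, rfl⟩, rfl⟩ := Subgroup.mem_sup.1 hy
      rcases Int.even_or_odd m with ⟨k, rfl⟩ | ⟨k, rfl⟩
      · have : r ^ (k + k) = 1 := by rw [zpow_add, ← mul_zpow, E.mul_self, one_zpow]
        simp only [this, mul_one] at hyA ⊢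
        rw [← hBA]
        exact ⟨hb, hyA⟩
      · exfalso
        have : r ^ (2 * k + 1) = r := by
          rw [zpow_add, two_mul, zpow_add, ← mul_zpow, E.mul_self, one_zpow, one_mul, zpow_one]
        simp only [this] at hyA
        apply hrAB
        have h2 : r = (b * r) * b⁻¹ := by rw [mul_comm b r, mul_inv_cancel_right]
        rw [h2]
        exact mul_mem (Subgroup.mem_sup_left hyA) (Subgroup.mem_sup_right (inv_mem hb))
    exact hrAB (Subgroup.mem_sup_right (h1 (Subgroup.mem_sup_right (Subgroup.mem_zpowers r))))
  refine ⟨⟨A, B, ?_, hA1, hB1, Quotient.out, fun x => Quotient.out_eq x,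
    linearOrderOfSTO WellOrderingRel⟩⟩
  refine Subgroup.isComplement'_of_disjoint_and_mul_eq_univ ?_ ?_
  · rw [disjoint_iff, inf_comm, hBA]
  · rw [← Subgroup.mul_normal, htop]; rfl

end Standard

namespace BicharPair.Choice

variable {F : Type u} [Field F] {G : Type v} [CommGroup G] {E : BicharPair F G}

noncomputable instance (c : E.Choice) : Fintype c.B := Fintype.ofFinite _

noncomputable instance : DecidableEq E.T := Classical.decEq _

/-- The component in `A` of `t ∈ T = A × B`. -/
noncomputable def fstA (c : E.Choice) (t : E.T) : E.T := (Subgroup.IsComplement.equiv c.isComplement t).1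

/-- The component in `B` of `t ∈ T = A × B`. -/
noncomputable def sndB (c : E.Choice) (t : E.T) : E.T := (Subgroup.IsComplement.equiv c.isComplement t).2

/-- The algebra `D = End(N)`, where `N` has the basis `(e_b)_{b ∈ B}`. -/
abbrev D (c : E.Choice) : Type (max u v) := Matrix c.B c.B F

/-- `X_{ab} = X_a X_b`, where `X_a e_{b'} = β(a, b') e_{b'}` and `X_b e_{b'} = e_{b b'}`. -/
noncomputable def X (c : E.Choice) (t : E.T) : c.D :=
  Matrix.diagonal (fun b' : c.B => ((E.β (c.fstA t) b' : Fˣ) : F)) *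
    Matrix.of (fun r b' : c.B => if (r : E.T) = c.sndB t * b' then 1 else 0)

/-- `η(ab) = β(a, b)`, so that the transposition of `D` sends `X_t` to `η(t) X_t`. -/
noncomputable def η (c : E.Choice) (t : E.T) : F := (E.β (c.fstA t) (c.sndB t) : Fˣ)

/-- The component of degree `g` of `D`, spanned by `X_g` if `g ∈ T` and zero otherwise. -/
def comp (c : E.Choice) (g : G) : Submodule F c.D := Submodule.span F (c.X '' {t | (t : G) = g})

/-- The transposition of `D`. -/
def transposition (c : E.Choice) : AlgInvolution F c.D where
  map := (Matrix.transposeLinearEquiv c.B c.B F F).toLinearMap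
  map_mul a b := Matrix.transpose_mul a b
  map_map a := Matrix.transpose_transpose a

theorem fstA_mem (c : E.Choice) (t : E.T) : c.fstA t ∈ c.A :=
  (Subgroup.IsComplement.equiv c.isComplement t).1.2

theorem sndB_mem (c : E.Choice) (t : E.T) : c.sndB t ∈ c.B :=
  (Subgroup.IsComplement.equiv c.isComplement t).2.2

theorem fstA_mul_sndB (c : E.Choice) (t : E.T) : c.fstA t * c.sndB t = t :=
  Subgroup.IsComplement.equiv_fst_mul_equiv_snd c.isComplement t

theorem eq_of_mul (c : E.Choice) {t a b : E.T} (ha : a ∈ c.A) (hb : b ∈ c.B) (h : a * b = t) :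
    c.fstA t = a ∧ c.sndB t = b := by
  have h1 : Subgroup.IsComplement.equiv c.isComplement t = (⟨a, ha⟩, ⟨b, hb⟩) := by
    rw [← Equiv.eq_symm_apply]
    exact h.symm
  simp [fstA, sndB, h1]

theorem fstA_mul (c : E.Choice) (s t : E.T) : c.fstA (s * t) = c.fstA s * c.fstA t ∧
    c.sndB (s * t) = c.sndB s * c.sndB t := by
  apply c.eq_of_mul (mul_mem (c.fstA_mem s) (c.fstA_mem t)) (mul_mem (c.sndB_mem s) (c.sndB_mem t))
  rw [mul_mul_mul_comm, c.fstA_mul_sndB, c.fstA_mul_sndB]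

theorem X_apply (c : E.Choice) (t : E.T) (r s : c.B) :
    c.X t r s = if (r : E.T) = c.sndB t * s then ((E.β (c.fstA t) r : Fˣ) : F) else 0 := by
  rw [X, Matrix.diagonal_mul, Matrix.of_apply]
  split_ifs <;> simp

theorem X_mul_X (c : E.Choice) (s t : E.T) :
    c.X s * c.X t = ((E.β (c.fstA t) (c.sndB s) : Fˣ) : F) • c.X (s * t) := by
  ext r q
  rw [Matrix.mul_apply, Matrix.smul_apply, X_apply]
  let p : c.B := ⟨c.sndB s * r, mul_mem (c.sndB_mem s) r.2⟩
  have hp : (r : E.T) = c.sndB s * p := by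
    change (r : E.T) = c.sndB s * (c.sndB s * r)
    rw [← mul_assoc, E.mul_self, one_mul]
  rw [Finset.sum_eq_single p]
  · rw [X_apply, X_apply, if_pos hp, (c.fstA_mul s t).1, (c.fstA_mul s t).2]
    have h1 : ((p : E.T) = c.sndB t * q) ↔ ((r : E.T) = c.sndB s * c.sndB t * q) := by
      rw [hp, mul_assoc]; exact (mul_right_inj _).symm
    by_cases h : (p : E.T) = c.sndB t * q
    · rw [if_pos h, if_pos (h1.1 h)]
      change _ * ((E.β (c.fstA t) (c.sndB s * r) : Fˣ) : F) = _
      simp only [map_mul, MonoidHom.mul_apply, Units.val_mul, smul_eq_mul]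
      ring
    · rw [if_neg h, if_neg (fun h' => h (h1.2 h'))]; simp
  · intro b _ hb
    rw [X_apply, if_neg, zero_mul]
    intro h
    apply hb
    apply Subtype.ext
    rw [hp] at h
    exact ((mul_right_inj _).1 h).symm
  · simp

theorem X_one (c : E.Choice) : c.X 1 = 1 := by
  have h := c.eq_of_mul (one_mem c.A) (one_mem c.B) (mul_one (1 : E.T))
  ext r s
  rw [X_apply, h.1, h.2, Matrix.one_apply, one_mul, map_one, MonoidHom.one_apply, Units.val_one]
  by_cases hrs : r = s
  · rw [if_pos hrs, if_pos (congrArg _ hrs)]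
  · rw [if_neg hrs, if_neg (fun h => hrs (Subtype.ext h))]

theorem X_mul_self (c : E.Choice) (t : E.T) : c.X t * c.X t = c.η t • (1 : c.D) := by
  rw [X_mul_X, E.mul_self, X_one]; rfl

theorem η_mul_self (c : E.Choice) (t : E.T) : c.η t * c.η t = 1 := by
  rw [η, ← Units.val_mul, E.β_mul_self, Units.val_one]

theorem transposition_X (c : E.Choice) (t : E.T) :
    c.transposition.map (c.X t) = c.η t • c.X t := by
  ext r s
  change c.X t s r = _
  rw [Matrix.smul_apply, X_apply, X_apply]
  have h1 : ((s : E.T) = c.sndB t * r) ↔ ((r : E.T) = c.sndB t * s) := by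
    constructor
    · intro h; rw [h, ← mul_assoc, E.mul_self, one_mul]
    · intro h; rw [h, ← mul_assoc, E.mul_self, one_mul]
  by_cases h : (s : E.T) = c.sndB t * r
  · rw [if_pos h, if_pos (h1.1 h), h, map_mul, Units.val_mul]; rfl
  · rw [if_neg h, if_neg (fun h' => h (h1.2 h'))]; simp

theorem X_mem (c : E.Choice) (t : E.T) {g : G} (h : (t : G) = g) : c.X t ∈ c.comp g :=
  Submodule.subset_span ⟨t, h, rfl⟩

theorem linearIndependent_X (c : E.Choice) : LinearIndependent F c.X := by
  classical
  have : Fintype E.T := Fintype.ofFinite _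
  have : Fintype c.A := Fintype.ofFinite _
  rw [Fintype.linearIndependent_iff]
  intro k hk t
  let χ : c.A → c.B →* F := fun a => (Units.coeHom F).comp ((E.β a).comp c.B.subtype)
  have hχ : Function.Injective χ := by
    intro a a' h
    have h1 : E.β ((a : E.T) * (a' : E.T)⁻¹) = 1 := by
      ext s
      rw [← c.fstA_mul_sndB s, map_mul, map_mul, map_inv, MonoidHom.mul_apply, MonoidHom.inv_apply,
        c.β_A _ a.2 _ (c.fstA_mem s), c.β_A _ a'.2 _ (c.fstA_mem s), MonoidHom.mul_apply,
        MonoidHom.inv_apply]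
      have h2 : ((E.β a (c.sndB s) : Fˣ) : F) = E.β a' (c.sndB s) :=
        DFunLike.congr_fun h (⟨c.sndB s, c.sndB_mem s⟩ : c.B)
      rw [Units.val_inj] at h2
      simp [h2]
    have h2 := E.nondegenerate _ (fun s => DFunLike.congr_fun h1 s)
    exact Subtype.ext (mul_inv_eq_one.1 h2)
  have hlin := (linearIndependent_monoidHom c.B F).comp χ hχ
  rw [Fintype.linearIndependent_iff] at hlin
  have h0 := hlin (fun a => k (a * c.sndB t)) ?_ ⟨c.fstA t, c.fstA_mem t⟩
  · simpa only [c.fstA_mul_sndB] using h0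
  · ext r
    have h1 := congrFun (congrFun hk r) ⟨c.sndB t * r, mul_mem (c.sndB_mem t) r.2⟩
    rw [Matrix.sum_apply] at h1
    simp only [Matrix.smul_apply, X_apply, Matrix.zero_apply, smul_eq_mul, mul_ite, mul_zero] at h1
    rw [Finset.sum_apply]
    simp only [Pi.smul_apply, smul_eq_mul, Pi.zero_apply, Function.comp_apply]
    rw [← h1, ← Finset.sum_filter]
    refine Finset.sum_bij (fun a _ => (a : E.T) * c.sndB t) ?_ ?_ ?_ ?_
    · intro a _
      rw [Finset.mem_filter]
      refine ⟨Finset.mem_univ _, ?_⟩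
      rw [(c.eq_of_mul a.2 (c.sndB_mem t) rfl).2, ← mul_assoc, E.mul_self, one_mul]
    · intro a _ a' _ h
      exact Subtype.ext (mul_right_cancel h)
    · intro s hs
      rw [Finset.mem_filter] at hs
      refine ⟨⟨c.fstA s, c.fstA_mem s⟩, Finset.mem_univ _, ?_⟩
      have h2 : c.sndB s * c.sndB t = 1 := by
        have h3 := hs.2
        rw [← mul_assoc] at h3
        exact mul_eq_right.1 h3.symm
      have h3 : c.sndB t = c.sndB s := by
        rw [← E.inv_eq (c.sndB s)]; exact (inv_eq_of_mul_eq_one_right h2).symm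
      rw [h3, c.fstA_mul_sndB]
    · intro a _
      rw [(c.eq_of_mul a.2 (c.sndB_mem t) rfl).1]
      rfl

theorem card_eq (c : E.Choice) : Nat.card E.T = Nat.card c.B * Nat.card c.B := by
  have : Fintype E.T := Fintype.ofFinite _
  have : Fintype c.A := Fintype.ofFinite _
  have h1 : Nat.card c.A * Nat.card c.B = Nat.card E.T := c.isComplement.card_mul_card
  have h2 : Nat.card E.T ≤ Nat.card c.B * Nat.card c.B := by
    have h := c.linearIndependent_X.fintype_card_le_finrank
    rw [Module.finrank_matrix, Module.finrank_self, mul_one] at h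
    simpa [Nat.card_eq_fintype_card] using h
  have h3 : Nat.card c.B ≤ Nat.card c.A := by
    let χ : c.B → c.A →* F := fun b => (Units.coeHom F).comp ((E.β b).comp c.A.subtype)
    have hχ : Function.Injective χ := by
      intro a a' h
      have h1 : E.β ((a : E.T) * (a' : E.T)⁻¹) = 1 := by
        ext s
        rw [← c.fstA_mul_sndB s, map_mul, map_mul, map_inv, MonoidHom.mul_apply,
          MonoidHom.inv_apply, MonoidHom.mul_apply, MonoidHom.inv_apply,
          c.β_B _ a.2 _ (c.sndB_mem s), c.β_B _ a'.2 _ (c.sndB_mem s)]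
        have h2 : ((E.β a (c.fstA s) : Fˣ) : F) = E.β a' (c.fstA s) :=
          DFunLike.congr_fun h (⟨c.fstA s, c.fstA_mem s⟩ : c.A)
        rw [Units.val_inj] at h2
        simp [h2]
      have h2 := E.nondegenerate _ (fun s => DFunLike.congr_fun h1 s)
      exact Subtype.ext (mul_inv_eq_one.1 h2)
    have h := ((linearIndependent_monoidHom c.A F).comp χ hχ).fintype_card_le_finrank
    rw [Module.finrank_fintype_fun_eq_card] at h
    simpa [Nat.card_eq_fintype_card] using h
  apply le_antisymm h2
  rw [← h1]
  exact Nat.mul_le_mul_right _ h3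

theorem isInvolutionGrading (c : E.Choice) : IsInvolutionGrading c.transposition c.comp where
  indep := by
    intro g
    have h1 : (⨆ g', ⨆ (_ : g' ≠ g), c.comp g') ≤ Submodule.span F (c.X '' {t | (t : G) ≠ g}) := by
      refine iSup₂_le fun g' hg' => Submodule.span_mono (Set.image_mono ?_)
      rintro t rfl
      exact hg'
    refine Disjoint.mono_right h1 (c.linearIndependent_X.disjoint_span_image ?_)
    rw [Set.disjoint_left]
    intro t h1 h2
    exact h2 h1
  iSup_eq_top := by
    have : Fintype E.T := Fintype.ofFinite _
    have h1 := c.linearIndependent_X.span_eq_top_of_card_eq_finrank' (by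
      rw [Module.finrank_matrix, Module.finrank_self, mul_one, ← Nat.card_eq_fintype_card, c.card_eq,
        ← Nat.card_eq_fintype_card])
    rw [eq_top_iff, ← h1, Submodule.span_le]
    rintro _ ⟨t, rfl⟩
    exact Submodule.mem_iSup_of_mem (t : G) (c.X_mem t rfl)
  mul_mem := by
    intro g h a b ha hb
    refine Submodule.span_induction (p := fun a _ => a * b ∈ c.comp (g * h)) ?_ ?_ ?_ ?_ ha
    · rintro _ ⟨s, rfl, rfl⟩
      refine Submodule.span_induction (p := fun b _ => c.X s * b ∈ c.comp (s * h)) ?_ ?_ ?_ ?_ hb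
      · rintro _ ⟨t, rfl, rfl⟩
        rw [X_mul_X]
        exact Submodule.smul_mem _ _ (c.X_mem _ rfl)
      · simp
      · intro x y _ _ hx hy; rw [mul_add]; exact add_mem hx hy
      · intro k x _ hx; rw [mul_smul_comm]; exact Submodule.smul_mem _ _ hx
    · simp
    · intro x y _ _ hx hy; rw [add_mul]; exact add_mem hx hy
    · intro k x _ hx; rw [smul_mul_assoc]; exact Submodule.smul_mem _ _ hx
  map_mem := by
    intro g a ha
    refine Submodule.span_induction (p := fun a _ => c.transposition.map a ∈ c.comp g) ?_ ?_ ?_ ?_ ha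
    · rintro _ ⟨t, rfl, rfl⟩
      rw [transposition_X]
      exact Submodule.smul_mem _ _ (c.X_mem _ rfl)
    · simp
    · intro x y _ _ hx hy; rw [map_add]; exact add_mem hx hy
    · intro k x _ hx; rw [map_smul]; exact Submodule.smul_mem _ _ hx

end BicharPair.Choice

/-! ### The models `M*(T, β, κ₀, κ₁, g₀)` -/

section Models

variable {F : Type u} [Field F] {G : Type v} [CommGroup G] {E : BicharPair F G}

/-- `(κ₀, κ₁)` is `g₀`-admissible, where `g₀ = (h₀, p₀) ∈ G × ℤ₂`. -/
def IsAdmissible (c : E.Choice) (κ : ZMod 2 → (G ⧸ E.T →₀ ℕ)) (g₀ : G × ZMod 2) : Prop :=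
  (g₀.2 = 0 →
    (∀ (i : ZMod 2) (g : G), κ i (g : G ⧸ E.T) = κ i ((g₀.1⁻¹ * g⁻¹ : G) : G ⧸ E.T)) ∧
    (∀ (i : ZMod 2) (g : G) (h : g₀.1 * g ^ 2 ∈ E.T),
      c.η ⟨g₀.1 * g ^ 2, h⟩ = -zsign F i → Even (κ i (g : G ⧸ E.T)))) ∧
  (g₀.2 = 1 →
    ∀ g : G, κ 1 (g : G ⧸ E.T) = κ 0 ((g₀.1⁻¹ * g⁻¹ : G) : G ⧸ E.T))

/-- The index set of a basis with `κ x` elements in the isotypic component of each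
`x ∈ supp κ`. -/
abbrev BasisIndex {α : Type v} (κ : α →₀ ℕ) : Type v := Σ x : κ.support, Fin (κ x)

/-- The scalar `s` such that `s X_t` is the entry of `Φ` at `(x, a), (y, b)` for paired cosets `x`
and `y`, where `ε = (-1)^i η(t)` and `n = κ_i(x)`: the blocks are `I ⊗ X_t` (`x = y`, `ε = 1`),
`J ⊗ X_t` with `J = (0, I; -I, 0)` (`x = y`, `ε = -1`), and `(0, I; ε I, 0) ⊗ X_t` (`x ≠ y`). -/
noncomputable def formCoeff (c : E.Choice) (ε : F) (x y : G ⧸ E.T) (n a b : ℕ) : F :=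
  open scoped Classical in
  if x = y then
    if ε = 1 then (if a = b then 1 else 0)
    else (if b = a + n / 2 then 1 else if a = b + n / 2 then -1 else 0)
  else if a = b then (if c.ord.lt x y then 1 else ε) else 0

/-- The matrix `Φ` of the form `B` in the case `p₀ = 0`. -/
noncomputable def evenForm (c : E.Choice) (κ : ZMod 2 → (G ⧸ E.T →₀ ℕ)) (h₀ : G) :
    Matrix (Σ i, BasisIndex (κ i)) (Σ i, BasisIndex (κ i)) c.D :=
  open scoped Classical in
  Matrix.of fun p q =>
    if h : p.1 = q.1 ∧ h₀ * c.ξ p.2.1 * c.ξ q.2.1 ∈ E.T then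
      formCoeff c (zsign F p.1 * c.η ⟨_, h.2⟩) (p.2.1 : G ⧸ E.T) q.2.1 (κ p.1 p.2.1)
        p.2.2 q.2.2 • c.X ⟨_, h.2⟩
    else 0

/-- The matrix `Φ` of the form `B` in the case `p₀ = 1`, in a basis which consists of a homogeneous
basis of `U⁰` and the dual basis of `U¹ = (U⁰)*`, shifted by `h₀⁻¹`. -/
noncomputable def oddForm (c : E.Choice) (κ : G ⧸ E.T →₀ ℕ) :
    Matrix (BasisIndex κ ⊕ BasisIndex κ) (BasisIndex κ ⊕ BasisIndex κ) c.D :=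
  open scoped Classical in
  Matrix.fromBlocks 0 1 1 0

theorem pair_iff (c : E.Choice) (h₀ : G) (x y : G ⧸ E.T) :
    h₀ * c.ξ x * c.ξ y ∈ E.T ↔ x = ((h₀⁻¹ * (c.ξ y)⁻¹ : G) : G ⧸ E.T) := by
  have h : x = (c.ξ x : G ⧸ E.T) := (c.mk_ξ x).symm
  conv_rhs => rw [h]
  rw [eq_comm, QuotientGroup.eq]
  have : (h₀⁻¹ * (c.ξ y)⁻¹)⁻¹ * c.ξ x = h₀ * c.ξ x * c.ξ y := by
    simp only [mul_inv, inv_inv]; ac_rfl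
  rw [this]

theorem pair_right_unique (c : E.Choice) (h₀ : G) {x y z : G ⧸ E.T}
    (hy : h₀ * c.ξ x * c.ξ y ∈ E.T) (hz : h₀ * c.ξ x * c.ξ z ∈ E.T) : y = z := by
  rw [mul_right_comm, pair_iff] at hy hz
  rw [hy, hz]

theorem coset_dual (h₀ g : G) {x : G ⧸ E.T} (h : (g : G ⧸ E.T) = x) :
    ((h₀⁻¹ * g⁻¹ : G) : G ⧸ E.T) = (h₀ : G ⧸ E.T)⁻¹ * x⁻¹ := by
  subst h; rfl

theorem formCoeff_symm (c : E.Choice) {ε : F} (hε : ε * ε = 1) {x y : G ⧸ E.T} {n m a b : ℕ}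
    (hnm : n = m) (ha : a < n) (hb : b < m) (hn : x = y → ε ≠ 1 → Even n) :
    formCoeff c ε x y n a b = ε * formCoeff c ε y x m b a := by
  subst hnm
  let _ := c.ord
  unfold formCoeff
  have hε' : ε = 1 ∨ ε = -1 := mul_self_eq_one_iff.1 hε
  by_cases hxy : x = y
  · subst hxy
    by_cases h1 : ε = 1
    · simp [h1, eq_comm]
    · obtain ⟨k, hk⟩ := hn rfl h1
      have hk2 : n / 2 = k := by omega
      have h2 : ε = -1 := hε'.resolve_left h1
      simp only [if_true, h1, if_false, hk2]
      rw [h2]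
      by_cases h3 : b = a + k
      · have h4 : ¬ a = b + k := by omega
        simp only [if_pos h3, if_neg h4, mul_neg, mul_one, neg_neg]
      · by_cases h4 : a = b + k
        · simp only [if_pos h4, if_neg h3, mul_one]
        · simp [h3, h4]
  · have hyx : ¬ y = x := fun h => hxy h.symm
    simp only [hxy, hyx, if_false]
    by_cases hab : a = b
    · subst hab
      simp only [if_true]
      rcases lt_trichotomy x y with h | h | h
      · have h1 : c.ord.lt x y := h
        have h2 : ¬ c.ord.lt y x := h.not_gt
        rw [if_pos h1, if_neg h2, hε]
      · exact absurd h hxy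
      · have h1 : c.ord.lt y x := h
        have h2 : ¬ c.ord.lt x y := h.not_gt
        rw [if_pos h1, if_neg h2, mul_one]
    · have hba : ¬ b = a := fun h => hab h.symm
      simp [hab, hba]

theorem formCoeff_partner (c : E.Choice) {ε : F} (hε : ε * ε = 1) {x y : G ⧸ E.T} {n m b : ℕ}
    (hnm : n = m) (hb : b < m) (hn : x = y → ε ≠ 1 → Even n) :
    ∃ a < n, formCoeff c ε x y n a b * formCoeff c ε x y n a b = 1 ∧
      ∀ b' < m, b' ≠ b → formCoeff c ε x y n a b' = 0 := by
  subst hnm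
  unfold formCoeff
  by_cases hxy : x = y
  · by_cases h1 : ε = 1
    · refine ⟨b, hb, by simp [hxy, h1], fun b' _ h => ?_⟩
      have : ¬ b = b' := fun h' => h h'.symm
      simp [hxy, h1, this]
    · obtain ⟨k, hk⟩ := hn hxy h1
      have hk2 : n / 2 = k := by omega
      simp only [hxy, if_true, h1, if_false, hk2]
      by_cases hbk : b < k
      · refine ⟨b + k, by omega, ?_, fun b' hb' h => ?_⟩
        · have h3 : ¬ b = b + k + k := by omega
          simp [h3]
        · have h3 : ¬ b' = b + k + k := by omega
          have h4 : ¬ b = b' := fun h' => h h'.symm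
          simp [h3, h4]
      · refine ⟨b - k, by omega, ?_, fun b' hb' h => ?_⟩
        · have h3 : b = b - k + k := by omega
          rw [if_pos h3, mul_one]
        · have h3 : ¬ b' = b - k + k := by omega
          have h4 : ¬ b - k = b' + k := by omega
          simp [h3, h4]
  · refine ⟨b, hb, ?_, fun b' _ h => ?_⟩
    · simp only [hxy, if_false, if_true]
      split_ifs
      · simp
      · exact hε
    · have : ¬ b = b' := fun h' => h h'.symm
      simp [hxy, this]

theorem evenForm_apply (c : E.Choice) (κ : ZMod 2 → (G ⧸ E.T →₀ ℕ)) (h₀ : G)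
    (p q : Σ i, BasisIndex (κ i)) (h : p.1 = q.1 ∧ h₀ * c.ξ p.2.1 * c.ξ q.2.1 ∈ E.T) :
    evenForm c κ h₀ p q =
      formCoeff c (zsign F p.1 * c.η ⟨_, h.2⟩) (p.2.1 : G ⧸ E.T) q.2.1 (κ p.1 p.2.1)
        p.2.2 q.2.2 • c.X ⟨_, h.2⟩ := by
  simp only [evenForm, Matrix.of_apply, dif_pos h]

theorem evenForm_mk (c : E.Choice) (κ : ZMod 2 → (G ⧸ E.T →₀ ℕ)) (h₀ : G) (i : ZMod 2)
    {x y : G ⧸ E.T} (hx : x ∈ (κ i).support) (hy : y ∈ (κ i).support) (a : Fin (κ i x))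
    (b : Fin (κ i y)) (ht : h₀ * c.ξ x * c.ξ y ∈ E.T) :
    evenForm c κ h₀ ⟨i, ⟨x, hx⟩, a⟩ ⟨i, ⟨y, hy⟩, b⟩ =
      formCoeff c (zsign F i * c.η ⟨_, ht⟩) x y (κ i x) a b • c.X ⟨_, ht⟩ :=
  evenForm_apply c κ h₀ ⟨i, ⟨x, hx⟩, a⟩ ⟨i, ⟨y, hy⟩, b⟩ ⟨rfl, ht⟩

theorem evenForm_apply_eq_zero (c : E.Choice) (κ : ZMod 2 → (G ⧸ E.T →₀ ℕ)) (h₀ : G)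
    (p q : Σ i, BasisIndex (κ i)) (h : ¬ (p.1 = q.1 ∧ h₀ * c.ξ p.2.1 * c.ξ q.2.1 ∈ E.T)) :
    evenForm c κ h₀ p q = 0 := by
  simp only [evenForm, Matrix.of_apply, dif_neg h]

theorem zsign_η_mul_self (c : E.Choice) (i : ZMod 2) (t : E.T) :
    (zsign F i * c.η t) * (zsign F i * c.η t) = 1 := by
  rw [mul_mul_mul_comm, zsign_mul_self, c.η_mul_self, one_mul]

theorem even_mult (c : E.Choice) {κ : ZMod 2 → (G ⧸ E.T →₀ ℕ)} {g₀ : G × ZMod 2}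
    (h : IsAdmissible c κ g₀) (hp : g₀.2 = 0) {i : ZMod 2} {x y : G ⧸ E.T}
    (ht : g₀.1 * c.ξ x * c.ξ y ∈ E.T) :
    κ i x = κ i y ∧ (x = y → zsign F i * c.η ⟨_, ht⟩ ≠ 1 → Even (κ i x)) := by
  obtain ⟨h1, h2⟩ := h.1 hp
  constructor
  · have h3 := h1 i (c.ξ y)
    rw [c.mk_ξ] at h3
    rw [h3, ← (pair_iff c g₀.1 x y).1 ht]
  · intro hxy hne
    subst hxy
    have e1 : g₀.1 * c.ξ x ^ 2 = g₀.1 * c.ξ x * c.ξ x := by rw [pow_two, mul_assoc]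
    have h4 := h2 i (c.ξ x) (by rwa [e1])
    rw [c.mk_ξ] at h4
    apply h4
    have h5 : (⟨g₀.1 * c.ξ x ^ 2, by rwa [e1]⟩ : E.T) = ⟨_, ht⟩ := Subtype.ext e1
    rw [h5]
    have h6 := (mul_self_eq_one_iff.1 (zsign_η_mul_self c i ⟨_, ht⟩)).resolve_left hne
    have h7 := congrArg (fun z => zsign F i * z) h6
    simpa only [← mul_assoc, zsign_mul_self, one_mul, mul_neg, mul_one] using h7

open scoped Classical in
theorem evenForm_homogeneous (c : E.Choice) {κ : ZMod 2 → (G ⧸ E.T →₀ ℕ)} {g₀ : G × ZMod 2}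
    (h : IsAdmissible c κ g₀) (hp : g₀.2 = 0) :
    IsHomogeneousForm c.comp (fun p : Σ i, BasisIndex (κ i) => c.ξ p.2.1) g₀.1
      (evenForm c κ g₀.1) where
  mem p q := by
    by_cases hpq : p.1 = q.1 ∧ g₀.1 * c.ξ p.2.1 * c.ξ q.2.1 ∈ E.T
    · rw [evenForm_apply c κ _ p q hpq]
      exact Submodule.smul_mem _ _ (c.X_mem _ rfl)
    · rw [evenForm_apply_eq_zero c κ _ p q hpq]
      exact zero_mem _
  exists_partner := by
    rintro ⟨i, ⟨y, hy⟩, b⟩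
    set x : G ⧸ E.T := ((g₀.1⁻¹ * (c.ξ y)⁻¹ : G) : G ⧸ E.T) with hx
    have ht : g₀.1 * c.ξ x * c.ξ y ∈ E.T := (pair_iff c g₀.1 x y).2 hx
    obtain ⟨h1, h2⟩ := even_mult c h hp (i := i) ht
    have hxs : x ∈ (κ i).support := by
      rw [Finsupp.mem_support_iff, h1]; exact Finsupp.mem_support_iff.1 hy
    obtain ⟨a, ha, ha1, ha2⟩ := formCoeff_partner c (zsign_η_mul_self c i ⟨_, ht⟩) h1 b.2 h2
    refine ⟨⟨i, ⟨x, hxs⟩, ⟨a, ha⟩⟩, ?_, ?_⟩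
    · rintro ⟨j, ⟨z, hz⟩, b'⟩ hne
      by_cases hpq : i = j ∧ g₀.1 * c.ξ x * c.ξ z ∈ E.T
      · obtain ⟨rfl, hz'⟩ := hpq
        obtain rfl : y = z := pair_right_unique c g₀.1 ht hz'
        refine (evenForm_mk c κ g₀.1 i hxs hz ⟨a, ha⟩ b' hz').trans ?_
        have h3 := ha2 b' b'.2 (by
          intro h4
          apply hne
          rw [Fin.ext h4])
        simp only at h3 ⊢
        rw [h3, zero_smul]
      · exact evenForm_apply_eq_zero c κ _ _ _ hpq
    · refine ⟨(formCoeff c (zsign F i * c.η ⟨_, ht⟩) x y (κ i x) a b * c.η ⟨_, ht⟩) •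
        c.X ⟨_, ht⟩, Submodule.smul_mem _ _ (c.X_mem _ ?_), ?_⟩
      · exact (congrArg Subtype.val (E.inv_eq ⟨_, ht⟩)).symm
      · refine (congrArg _ (evenForm_mk c κ g₀.1 i hxs hy ⟨a, ha⟩ b ht)).trans ?_
        simp only
        rw [smul_mul_assoc, mul_smul_comm, c.X_mul_self, smul_smul, smul_smul]
        have h3 := c.η_mul_self ⟨_, ht⟩
        have h4 : ∀ s e : F, s * s = 1 → e * e = 1 → s * e * s * e = 1 := by
          intro s e hs he
          calc s * e * s * e = (s * s) * (e * e) := by ring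
            _ = 1 := by rw [hs, he, one_mul]
        rw [h4 _ _ ha1 h3, one_smul]

open scoped Classical in
theorem evenForm_superHermitian (c : E.Choice) {κ : ZMod 2 → (G ⧸ E.T →₀ ℕ)} {g₀ : G × ZMod 2}
    (h : IsAdmissible c κ g₀) (hp : g₀.2 = 0) :
    IsSuperHermitian c.transposition (fun p : Σ i, BasisIndex (κ i) => p.1) g₀.2
      (evenForm c κ g₀.1) where
  parity p q hpq := by
    by_cases h1 : p.1 = q.1 ∧ g₀.1 * c.ξ p.2.1 * c.ξ q.2.1 ∈ E.T
    · rw [h1.1, hp]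
      have key : ∀ a : ZMod 2, a + a = 0 := by decide
      exact key _
    · exact absurd (evenForm_apply_eq_zero c κ _ p q h1) hpq
  herm := by
    rintro ⟨i, ⟨x, hx⟩, a⟩ ⟨j, ⟨y, hy⟩, b⟩
    by_cases h1 : i = j ∧ g₀.1 * c.ξ x * c.ξ y ∈ E.T
    · obtain ⟨rfl, ht⟩ := h1
      have ht' : g₀.1 * c.ξ y * c.ξ x ∈ E.T := by rwa [mul_right_comm]
      refine (evenForm_mk c κ g₀.1 i hx hy a b ht).trans (Eq.trans ?_ (congrArg (fun z =>
        zsign F (i * i) • c.transposition.map z) (evenForm_mk c κ g₀.1 i hy hx b a ht').symm))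
      have e1 : (⟨_, ht'⟩ : E.T) = ⟨_, ht⟩ := Subtype.ext (mul_right_comm _ _ _)
      rw [e1, map_smul, c.transposition_X, smul_smul, smul_smul]
      congr 1
      obtain ⟨h2, h3⟩ := even_mult c h hp (i := i) ht
      rw [formCoeff_symm c (zsign_η_mul_self c i ⟨_, ht⟩) h2 a.2 b.2 h3]
      have key : ∀ a : ZMod 2, a * a = a := by decide
      rw [key]
      ring
    · have h2 : ¬ (j = i ∧ g₀.1 * c.ξ y * c.ξ x ∈ E.T) := by
        rintro ⟨h3, h4⟩
        exact h1 ⟨h3.symm, by rwa [mul_right_comm]⟩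
      rw [evenForm_apply_eq_zero c κ _ _ _ h1, evenForm_apply_eq_zero c κ _ _ _ h2]
      simp
  nondeg := (evenForm_homogeneous c h hp).isUnit

theorem odd_degree_left (h a : G) : h * a * (h⁻¹ * a⁻¹) = 1 := by
  rw [← mul_inv, mul_inv_cancel]

theorem odd_degree_right (h a : G) : h * (h⁻¹ * a⁻¹) * a = 1 := by
  rw [mul_inv_cancel_left, inv_mul_cancel]

open scoped Classical in
theorem oddForm_homogeneous (c : E.Choice) (κ : G ⧸ E.T →₀ ℕ) (h₀ : G) :
    IsHomogeneousForm c.comp (Sum.elim (fun p : BasisIndex κ => c.ξ p.1)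
      (fun p : BasisIndex κ => h₀⁻¹ * (c.ξ p.1)⁻¹)) h₀ (oddForm c κ) where
  mem := by
    have h1 : (1 : c.D) ∈ c.comp 1 := by
      rw [← c.X_one]; exact c.X_mem 1 rfl
    rintro (p | p) (q | q)
    · simp [oddForm]
    · simp only [oddForm, Matrix.fromBlocks_apply₁₂, Matrix.one_apply, Sum.elim_inl, Sum.elim_inr]
      split_ifs with h
      · subst h; rw [odd_degree_left]; exact h1
      · exact zero_mem _
    · simp only [oddForm, Matrix.fromBlocks_apply₂₁, Matrix.one_apply, Sum.elim_inl, Sum.elim_inr]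
      split_ifs with h
      · subst h; rw [odd_degree_right]; exact h1
      · exact zero_mem _
    · simp [oddForm]
  exists_partner := by
    have h1 : (1 : c.D) ∈ c.comp 1 := by
      rw [← c.X_one]; exact c.X_mem 1 rfl
    rintro (p | p)
    · refine ⟨Sum.inr p, ?_, 1, ?_, ?_⟩
      · rintro (q | q) hq
        · simp only [oddForm, Matrix.fromBlocks_apply₂₁, Matrix.one_apply]
          rw [if_neg]
          rintro rfl; exact hq rfl
        · simp [oddForm]
      · simp only [Sum.elim_inl, Sum.elim_inr]; rw [odd_degree_right, inv_one]; exact h1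
      · simp [oddForm]
    · refine ⟨Sum.inl p, ?_, 1, ?_, ?_⟩
      · rintro (q | q) hq
        · simp [oddForm]
        · simp only [oddForm, Matrix.fromBlocks_apply₁₂, Matrix.one_apply]
          rw [if_neg]
          rintro rfl; exact hq rfl
      · simp only [Sum.elim_inl, Sum.elim_inr]; rw [odd_degree_left, inv_one]; exact h1
      · simp [oddForm]

open scoped Classical in
theorem oddForm_superHermitian (c : E.Choice) (κ : G ⧸ E.T →₀ ℕ) :
    IsSuperHermitian c.transposition
      (Sum.elim (fun _ : BasisIndex κ => 0) (fun _ : BasisIndex κ => 1)) 1 (oddForm c κ) where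
  parity := by
    rintro (p | p) (q | q) h
    · simp [oddForm] at h
    · simp
    · simp
    · simp [oddForm] at h
  herm := by
    rintro (p | p) (q | q)
    · simp [oddForm]
    · simp only [oddForm, Matrix.fromBlocks_apply₁₂, Matrix.fromBlocks_apply₂₁, Sum.elim_inl,
        Sum.elim_inr, zero_mul, Matrix.one_apply, eq_comm (a := p)]
      split_ifs <;> simp [zsign, AlgInvolution.map_one]
    · simp only [oddForm, Matrix.fromBlocks_apply₁₂, Matrix.fromBlocks_apply₂₁, Sum.elim_inl,
        Sum.elim_inr, mul_zero, Matrix.one_apply, eq_comm (a := p)]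
      split_ifs <;> simp [zsign, AlgInvolution.map_one]
    · simp [oddForm]
  nondeg := (oddForm_homogeneous c κ 1).isUnit

/-- Parameters `(T, β, κ₀, κ₁, g₀)` of a model, with `κ₀`, `κ₁` not both zero (so that the
`D`-module `U` is nonzero). -/
structure ModelParams (F : Type u) [Field F] (G : Type v) [CommGroup G]
    (c : ∀ E : BicharPair F G, E.Choice) where
  base : BicharPair F G
  κ : ZMod 2 → (G ⧸ base.T →₀ ℕ)
  g₀ : G × ZMod 2
  κ_ne_zero : κ ≠ 0
  admissible : IsAdmissible (c base) κ g₀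

/-- The `G`-graded superalgebra with superinvolution `M*(T, β, κ₀, κ₁, g₀)`. If `p₀ = 0`, the
homogeneous basis of `U` has `κ_i(x)` elements of parity `i` and degree `ξ(x)`; if `p₀ = 1`, it has
`κ₀(x)` elements of parity `0` and degree `ξ(x)`, and their duals, of parity `1` and degree
`h₀⁻¹ ξ(x)⁻¹`. -/
noncomputable def ModelParams.model [NeZero (2 : F)] {c : ∀ E : BicharPair F G, E.Choice}
    (P : ModelParams F G c) : GradedSuperinvAlgebra F G :=
  open scoped Classical in
  if h : P.g₀.2 = 0 then
    matrixGraded (c P.base).isInvolutionGrading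
      (evenForm_superHermitian (c P.base) P.admissible h)
      (evenForm_homogeneous (c P.base) P.admissible h)
  else
    matrixGraded (c P.base).isInvolutionGrading
      (oddForm_superHermitian (c P.base) (P.κ 0))
      (oddForm_homogeneous (c P.base) (P.κ 0) P.g₀.1)

end Models

/-! ### Projections onto the components of a decomposition -/

section Projection

variable {F : Type*} [Field F] {M N : Type*} [AddCommGroup M] [Module F M] [AddCommGroup N]
  [Module F N] {H : Type*}

/-! Everything is reduced to presentations `R ≃ M_ι(D)` with `D` a standard graded-division algebra,
a homogeneous basis with parities `par` and degrees `γ`, and a form matrix `Φ` (`IsPresentation`,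
`IsHermitianForm`). It then remains to show that presentations exist, that the multiplicities of the
basis and the degree of the form determine the algebra, and that these data are unique up to
translation.

Existence is a graded Wedderburn argument. A homogeneous left ideal `R a` of least dimension yields
an idempotent `e` whose corner `e R e` is graded-division (`IsAlgGrading.exists_isGradedDivIdem`),
and over an algebraically closed field the components of the corner are at most one-dimensional.
Primeness links `e` with `φ(e)` by homogeneous `a`, `b` with `b a = e`, `a b = φ(e)`, so that `x ↦ b
φ(x) a` is a degree-preserving super-anti-automorphism of the corner. It acts by a scalar on each
component, which forces homogeneous elements to commute up to sign, their squares to be central,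
hence scalar, and the corner to be even (`IsLink.exists_sign`, `IsLink.mul_self_eq`). So the support
is an elementary 2-group `T`, and the commutation signs are a nondegenerate `β`. Normalizing the
frame on `A` and on `B` identifies the corner with `D` (`IsCornerFrame.exists_coord`), and changing
`a` by some `X_q` makes the induced involution the transposition (`IsCornerCoord.exists_link`). On
`U = R e` the form `B(u, v) = b φ(u) v` has `φ` as its superadjunction. It is Hermitian up to a sign
`d = ±1`, and exchanging the parities of `U` turns `d = -1` into `d = 1`.

For sufficiency, two forms `Φ`, `Φ'` in the same homogeneous basis differ by `C = Φ⁻¹ Φ'`, which is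
even, of trivial degree and self-adjoint. A square root of `C` which is a polynomial in `C` inherits
these properties and is an isometry (`exists_aeval_sq_eq`, `IsHermitianForm.exists_changeBasis`).
The multiplicities are admissible because `Φ` pairs isotypic components, and on a self-paired
component with the wrong sign it gives a nonsingular skew-symmetric matrix over `F`
(`IsHermitianForm.even_card`).

For uniqueness, linked corners have the same `T` and `β`. A graded Skolem-Noether theorem
(`IsPresentation.exists_intertwiner`) relates two presentations by a homogeneous matrix, whose
degree is the translation `g`. It cannot be odd, since an odd change would replace `d = 1` by `d =
-1`. The form is unique up to a scalar, so its degree changes exactly by `g⁻²`. -/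

theorem exists_projections {𝒜 : H → Submodule F M} (hi : iSupIndep 𝒜) (hs : ⨆ h, 𝒜 h = ⊤) :
    ∃ π : H → M →ₗ[F] M, (∀ h x, π h x ∈ 𝒜 h) ∧ (∀ h x, x ∈ 𝒜 h → π h x = x) ∧
      ∀ h k x, x ∈ 𝒜 k → k ≠ h → π h x = 0 := by
  classical
  have hint : DirectSum.IsInternal 𝒜 :=
    DirectSum.isInternal_submodule_of_iSupIndep_of_iSup_eq_top hi hs
  let E := LinearEquiv.ofBijective (DirectSum.coeLinearMap 𝒜) hint
  have hE : ∀ k (x : 𝒜 k), E.symm (x : M) = DirectSum.lof F H (fun h => 𝒜 h) k x := by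
    intro k x
    rw [LinearEquiv.symm_apply_eq]
    exact (DirectSum.coeLinearMap_lof 𝒜 k x).symm
  refine ⟨fun h => (𝒜 h).subtype ∘ₗ DirectSum.component F H (fun h => 𝒜 h) h ∘ₗ
    E.symm.toLinearMap, fun h x => Subtype.prop _, fun h x hx => ?_, fun h k x hx hkh => ?_⟩
  · have := hE h ⟨x, hx⟩
    simp only at this
    simp [this, DirectSum.component.lof_self]
  · have := hE k ⟨x, hx⟩
    simp only at this
    simp [this, DirectSum.component.of, hkh]

theorem mem_iSup_induction {𝒜 : H → Submodule F M} (hs : ⨆ h, 𝒜 h = ⊤) {P : M → Prop}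
    (hP : ∀ h x, x ∈ 𝒜 h → P x) (h0 : P 0) (hadd : ∀ x y, P x → P y → P (x + y)) (x : M) : P x :=
  Submodule.iSup_induction 𝒜 (motive := P) (hs ▸ Submodule.mem_top) hP h0 hadd

/-- An injective map between graded spaces which preserves degrees reflects them. -/
theorem mem_of_map_mem {𝒜 : H → Submodule F M} (hi : iSupIndep 𝒜) (hs : ⨆ h, 𝒜 h = ⊤)
    {ℬ : H → Submodule F N} (hi' : iSupIndep ℬ) (hs' : ⨆ h, ℬ h = ⊤) (e : M →ₗ[F] N)
    (he : Function.Injective e) (hmap : ∀ h x, x ∈ 𝒜 h → e x ∈ ℬ h) {h : H} {x : M}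
    (hx : e x ∈ ℬ h) : x ∈ 𝒜 h := by
  obtain ⟨π, π1, π2, π3⟩ := exists_projections hi hs
  obtain ⟨ρ, ρ1, ρ2, ρ3⟩ := exists_projections hi' hs'
  -- A degree-preserving map commutes with the projections, so injectivity gives `x = π h x`.
  have key : ∀ y, ρ h (e y) = e (π h y) := by
    refine mem_iSup_induction hs ?_ (by simp) fun y z hy hz => by simp [hy, hz]
    intro k y hy
    by_cases hk : k = h
    · subst hk
      rw [π2 _ _ hy, ρ2 _ _ (hmap _ _ hy)]
    · rw [π3 _ _ _ hy hk, ρ3 _ _ _ (hmap _ _ hy) hk, map_zero]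
  have h1 := key x
  rw [ρ2 _ _ hx] at h1
  rw [he h1]
  exact π1 _ _

theorem iSupIndep_of_isCompl {Q : ZMod 2 → Submodule F M} (h : IsCompl (Q 0) (Q 1)) :
    iSupIndep Q :=
  (iSupIndep_pair (by decide : (0 : ZMod 2) ≠ 1) (by decide)).2 h.disjoint

theorem iSup_eq_top_of_isCompl {Q : ZMod 2 → Submodule F M} (h : IsCompl (Q 0) (Q 1)) :
    ⨆ p, Q p = ⊤ := by
  rw [eq_top_iff, ← h.sup_eq_top]
  exact sup_le (le_iSup Q 0) (le_iSup Q 1)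

end Projection

/-! ### Homogeneous rectangular matrices -/

section HomogMatrix

variable {F : Type u} [Field F] {D : Type v} [Ring D] [Algebra F D] {G : Type v'} [CommGroup G]

/-- A rectangular matrix over a graded algebra `D`, homogeneous of degree `s` and parity `r`
with respect to bases of degrees `γ`, `δ` and parities `p`, `q`. -/
def IsHomogMatrix {ι κ : Type*} (𝒟 : G → Submodule F D) (δ : κ → G) (q : κ → ZMod 2) (γ : ι → G)
    (p : ι → ZMod 2) (s : G) (r : ZMod 2) (M : Matrix κ ι D) : Prop :=
  ∀ j i, M j i ∈ 𝒟 ((δ j)⁻¹ * s * γ i) ∧ (q j + p i ≠ r → M j i = 0)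

variable {φ₀ : AlgInvolution F D} {𝒟 : G → Submodule F D} {ι κ μ : Type*}
  {γ : ι → G} {p : ι → ZMod 2} {δ : κ → G} {q : κ → ZMod 2} {ε : μ → G} {o : μ → ZMod 2}
  {s t : G} {r r' : ZMod 2}

theorem IsHomogMatrix.mul [Fintype κ] (h𝒟 : IsInvolutionGrading φ₀ 𝒟) {M : Matrix μ κ D}
    {N : Matrix κ ι D} (hM : IsHomogMatrix 𝒟 ε o δ q s r M) (hN : IsHomogMatrix 𝒟 δ q γ p t r' N) :
    IsHomogMatrix 𝒟 ε o γ p (s * t) (r + r') (M * N) := by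
  refine fun j i => ⟨?_, fun h => ?_⟩
  · rw [Matrix.mul_apply]
    refine sum_mem fun k _ => ?_
    convert h𝒟.mul_mem (hM j k).1 (hN k i).1 using 2
    group
  · rw [Matrix.mul_apply]
    refine Finset.sum_eq_zero fun k _ => ?_
    by_cases h1 : o j + q k = r
    · by_cases h2 : q k + p i = r'
      · refine absurd ?_ h
        subst h1 h2
        generalize o j = a
        generalize q k = b
        generalize p i = c
        revert a b c
        decide
      · rw [(hN k i).2 h2, mul_zero]
    · rw [(hM j k).2 h1, zero_mul]

theorem IsHomogMatrix.add {M N : Matrix κ ι D} (hM : IsHomogMatrix 𝒟 δ q γ p s r M)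
    (hN : IsHomogMatrix 𝒟 δ q γ p s r N) : IsHomogMatrix 𝒟 δ q γ p s r (M + N) := fun j i =>
  ⟨add_mem (hM j i).1 (hN j i).1, fun h => by simp [(hM j i).2 h, (hN j i).2 h]⟩

theorem IsHomogMatrix.smul {M : Matrix κ ι D} (a : F) (hM : IsHomogMatrix 𝒟 δ q γ p s r M) :
    IsHomogMatrix 𝒟 δ q γ p s r (a • M) := fun j i =>
  ⟨Submodule.smul_mem _ _ (hM j i).1, fun h => by simp [(hM j i).2 h]⟩

/-- The unit of a graded algebra has trivial degree. -/
theorem one_mem_of_grading {R : Type*} [Ring R] [Algebra F R] {𝒜 : G → Submodule F R}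
    (hi : iSupIndep 𝒜) (hs : ⨆ g, 𝒜 g = ⊤)
    (hm : ∀ {g h : G} {a b : R}, a ∈ 𝒜 g → b ∈ 𝒜 h → a * b ∈ 𝒜 (g * h)) : (1 : R) ∈ 𝒜 1 := by
  obtain ⟨π, π1, π2, π3⟩ := exists_projections hi hs
  -- Only the trivial-degree part of `z` contributes to the degree-`h` part of `z * x`. For `z = 1`
  -- this makes `π 1 1` a left identity, hence equal to `1`.
  have key : ∀ h x, x ∈ 𝒜 h → ∀ z, π h (z * x) = π 1 z * x := by
    intro h x hx
    refine mem_iSup_induction hs ?_ (by simp) fun y z hy hz => by simp [hy, hz, add_mul]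
    intro g z hz
    by_cases hg : g = 1
    · subst hg
      rw [π2 _ _ hz, π2]
      simpa using hm hz hx
    · rw [π3 1 _ _ hz hg, π3 h _ _ (hm hz hx) (by simpa using hg), zero_mul]
  have h2 : ∀ x, π 1 1 * x = x := by
    refine mem_iSup_induction hs ?_ (by simp) fun y z hy hz => by simp [hy, hz, mul_add]
    intro g x hx
    rw [← key g x hx, one_mul, π2 _ _ hx]
  have h3 := h2 1
  rw [mul_one] at h3
  rw [← h3]
  exact π1 1 1

/-- Projections of products by a homogeneous element. -/
theorem projection_mul {R : Type*} [Ring R] [Algebra F R] {𝒜 : G → Submodule F R}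
    (hs : ⨆ g, 𝒜 g = ⊤)
    (hm : ∀ {g h : G} {a b : R}, a ∈ 𝒜 g → b ∈ 𝒜 h → a * b ∈ 𝒜 (g * h)) {π : G → R →ₗ[F] R}
    (π2 : ∀ h x, x ∈ 𝒜 h → π h x = x) (π3 : ∀ h k x, x ∈ 𝒜 k → k ≠ h → π h x = 0)
    {g h : G} {x : R} (hx : x ∈ 𝒜 h) (z : R) : π (g * h) (z * x) = π g z * x := by
  revert z
  refine mem_iSup_induction hs ?_ (by simp) fun y z hy hz => by simp [hy, hz, add_mul]
  intro k z hz
  by_cases hk : k = g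
  · subst hk
    rw [π2 _ _ hz, π2 _ _ (hm hz hx)]
  · rw [π3 _ _ _ hz hk, π3 _ _ _ (hm hz hx) (by simpa using hk), zero_mul]

theorem IsInvolutionGrading.one_mem (h𝒟 : IsInvolutionGrading φ₀ 𝒟) : (1 : D) ∈ 𝒟 1 :=
  one_mem_of_grading h𝒟.indep h𝒟.iSup_eq_top h𝒟.mul_mem

theorem IsHomogMatrix.one [DecidableEq ι] (h𝒟 : IsInvolutionGrading φ₀ 𝒟) :
    IsHomogMatrix 𝒟 γ p γ p 1 0 (1 : Matrix ι ι D) := by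
  refine fun i j => ?_
  by_cases h : i = j
  · subst h
    have : p i + p i = 0 := CharTwo.add_self_eq_zero _
    simp [h𝒟.one_mem, this]
  · simp [Matrix.one_apply_ne h]

/-- The inverse of a homogeneous matrix is homogeneous. -/
theorem IsHomogMatrix.inverse [Fintype ι] [DecidableEq ι] [Fintype κ] [DecidableEq κ]
    (h𝒟 : IsInvolutionGrading φ₀ 𝒟)
    {M : Matrix κ ι D} (hM : IsHomogMatrix 𝒟 δ q γ p s r M) {N : Matrix ι κ D} (hNM : N * M = 1)
    (hMN : M * N = 1) : IsHomogMatrix 𝒟 γ p δ q s⁻¹ r N := by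
  obtain ⟨π, π1, π2, π3⟩ := exists_projections h𝒟.indep h𝒟.iSup_eq_top
  -- `N'` is the part of `N` of the expected degree and parity. As `M` is homogeneous, comparing
  -- components in `N * M = 1` shows that `N'` is still a left inverse, so it equals `N`.
  let N' : Matrix ι κ D := Matrix.of fun i j =>
    if p i + q j = r then π ((γ i)⁻¹ * s⁻¹ * δ j) (N i j) else 0
  have hN' : N' * M = 1 := by
    ext i k
    have h1 : ∀ j, π ((γ i)⁻¹ * s⁻¹ * δ j) (N i j) * M j k = π ((γ i)⁻¹ * γ k) (N i j * M j k) := by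
      intro j
      rw [← projection_mul h𝒟.iSup_eq_top h𝒟.mul_mem π2 π3 (hM j k).1]
      congr 2
      group
    have h2 : ∑ j, π ((γ i)⁻¹ * s⁻¹ * δ j) (N i j) * M j k = (1 : Matrix ι ι D) i k := by
      simp_rw [h1]
      rw [← map_sum, ← Matrix.mul_apply, hNM]
      by_cases hik : i = k
      · subst hik
        rw [Matrix.one_apply_eq, inv_mul_cancel, π2 _ _ h𝒟.one_mem]
      · rw [Matrix.one_apply_ne hik, map_zero]
    by_cases hp : p i = p k
    · rw [← h2, Matrix.mul_apply]
      refine Finset.sum_congr rfl fun j _ => ?_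
      by_cases hj : q j + p k = r
      · simp [N', hp, add_comm (p k), hj]
      · rw [(hM j k).2 hj, mul_zero, mul_zero]
    · rw [Matrix.one_apply_ne (fun h => hp (congrArg p h)), Matrix.mul_apply]
      refine Finset.sum_eq_zero fun j _ => ?_
      by_cases hj : q j + p k = r
      · have : ¬ p i + q j = r := by
          rw [← hj, add_comm]; intro h; exact hp (add_left_cancel h)
        simp [N', this]
      · rw [(hM j k).2 hj, mul_zero]
  have h3 : N' = N := by
    calc N' = N' * (M * N) := by rw [hMN, Matrix.mul_one]
      _ = N := by rw [← Matrix.mul_assoc, hN', Matrix.one_mul]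
  rw [← h3]
  refine fun i j => ⟨?_, fun h => ?_⟩
  · simp only [N', Matrix.of_apply]
    split_ifs
    · exact π1 _ _
    · exact zero_mem _
  · simp [N', h]

/-- The conjugate transpose of a matrix with respect to an involution of the entries. -/
def AlgInvolution.conjTranspose (φ₀ : AlgInvolution F D) (M : Matrix κ ι D) : Matrix ι κ D :=
  Matrix.of fun i j => φ₀.map (M j i)

theorem AlgInvolution.conjTranspose_apply (φ₀ : AlgInvolution F D) (M : Matrix κ ι D) (i : ι)
    (j : κ) : φ₀.conjTranspose M i j = φ₀.map (M j i) := rfl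

theorem AlgInvolution.conjTranspose_mul [Fintype κ] (φ₀ : AlgInvolution F D) (M : Matrix μ κ D)
    (N : Matrix κ ι D) :
    φ₀.conjTranspose (M * N) = φ₀.conjTranspose N * φ₀.conjTranspose M := by
  ext i j
  simp [conjTranspose_apply, Matrix.mul_apply, φ₀.map_mul]

theorem AlgInvolution.conjTranspose_one [DecidableEq ι] (φ₀ : AlgInvolution F D) :
    φ₀.conjTranspose (1 : Matrix ι ι D) = 1 := by
  ext i j
  by_cases h : i = j
  · subst h; simp [conjTranspose_apply, φ₀.map_one]
  · rw [conjTranspose_apply, Matrix.one_apply_ne h, Matrix.one_apply_ne (Ne.symm h), map_zero]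

theorem IsHomogMatrix.conjTranspose (h𝒟 : IsInvolutionGrading φ₀ 𝒟) {M : Matrix κ ι D}
    (hM : IsHomogMatrix 𝒟 δ q γ p s r M) :
    IsHomogMatrix 𝒟 (fun i => (γ i)⁻¹) p (fun j => (δ j)⁻¹) q s r (φ₀.conjTranspose M) := by
  refine fun i j => ⟨?_, fun h => ?_⟩
  · rw [AlgInvolution.conjTranspose_apply]
    convert h𝒟.map_mem (hM j i).1 using 2
    rw [inv_inv]; ac_rfl
  · rw [AlgInvolution.conjTranspose_apply, (hM j i).2 (by rwa [add_comm]), map_zero]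

end HomogMatrix

/-! ### Square roots of units -/

section SquareRoot

open Polynomial

/-- Units of finite-dimensional algebras have square roots which are polynomials in them. -/
theorem exists_aeval_sq_eq {F : Type*} [Field F] [IsAlgClosed F] [NeZero (2 : F)] {R : Type*}
    [Ring R] [Algebra F R] [FiniteDimensional F R] {C : R} (hC : IsUnit C) :
    ∃ q : F[X], aeval C q * aeval C q = C := by
  classical
  set m := minpoly F C with hm
  have hint : IsIntegral F C := Algebra.IsIntegral.isIntegral C
  have hmonic : m.Monic := minpoly.monic hint
  -- If `X` divided the minimal polynomial, cancelling the unit `C` would leave a polynomial of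
  -- smaller degree annihilating `C`.
  have hm0 : m.coeff 0 ≠ 0 := by
    intro h0
    have h1 : m = X * m.divX := by
      conv_lhs => rw [← X_mul_divX_add m, h0, C_0, add_zero]
    have h2 : aeval C m.divX = 0 := by
      have h3 : aeval C m = 0 := minpoly.aeval F C
      rw [h1, map_mul, aeval_X] at h3
      exact hC.mul_right_eq_zero.1 h3
    have h4 : X * m.divX ∣ m.divX := by
      rw [← h1]; exact minpoly.dvd F C h2
    have h5 : m.divX ≠ 0 := by
      rintro h; rw [h, mul_zero] at h1; exact hmonic.ne_zero h1
    have h6 := natDegree_le_of_dvd h4 h5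
    rw [natDegree_X_mul h5] at h6
    omega
  choose rt hrt using fun a : F => IsAlgClosed.exists_pow_nat_eq a (n := 2) (by norm_num)
  -- A first approximation: `q₀` takes a square root of each eigenvalue as its value there. Then `q₀
  -- ^ 2 - X` vanishes at all roots of `m`, so it is nilpotent modulo `m`.
  let q₀ : F[X] := Lagrange.interpolate m.roots.toFinset id rt
  have hq₀ : ∀ a ∈ m.roots, q₀.eval a = rt a := fun a ha =>
    Lagrange.eval_interpolate_at_node (v := id) rt (Set.injOn_id _) (Multiset.mem_toFinset.2 ha)
  have hprod : (m.roots.map fun a => X - Polynomial.C a).prod = m :=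
    ((IsAlgClosed.splits m).eq_prod_roots_of_monic hmonic).symm
  have hdvd : ∀ f : F[X], (∀ a ∈ m.roots, f.eval a = 0) → m ∣ f ^ Multiset.card m.roots := by
    intro f hf
    have h1 : (m.roots.map fun a => X - Polynomial.C a).prod ∣ (m.roots.map fun _ => f).prod :=
      Multiset.prod_dvd_prod_of_dvd _ _ fun a ha => dvd_iff_isRoot.2 (hf a ha)
    rwa [hprod, Multiset.map_const', Multiset.prod_replicate] at h1
  have hnil : IsNilpotent (AdjoinRoot.mk m (q₀ ^ 2 - X)) := by
    refine ⟨Multiset.card m.roots, ?_⟩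
    rw [← map_pow, AdjoinRoot.mk_eq_zero]
    refine hdvd _ fun a ha => ?_
    rw [eval_sub, eval_pow, eval_X, hq₀ a ha, hrt, sub_self]
  have hxu : IsUnit (AdjoinRoot.mk m X) := by
    refine .of_mul_eq_one (AdjoinRoot.mk m (-Polynomial.C (m.coeff 0)⁻¹ * m.divX)) ?_
    rw [← map_mul, ← sub_eq_zero, ← map_one (AdjoinRoot.mk m), ← map_sub, AdjoinRoot.mk_eq_zero]
    refine ⟨-Polynomial.C (m.coeff 0)⁻¹, ?_⟩
    have h1 : Polynomial.C (m.coeff 0) * Polynomial.C (m.coeff 0)⁻¹ = 1 := by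
      rw [← C_mul, mul_inv_cancel₀ hm0, C_1]
    linear_combination h1 - Polynomial.C (m.coeff 0)⁻¹ * X_mul_divX_add m
  have hqu : IsUnit (AdjoinRoot.mk m q₀) := by
    have h1 : IsUnit (AdjoinRoot.mk m q₀ ^ 2) := by
      have h2 : AdjoinRoot.mk m q₀ ^ 2 = AdjoinRoot.mk m X + AdjoinRoot.mk m (q₀ ^ 2 - X) := by
        rw [← map_add, ← map_pow]; congr 1; ring
      rw [h2]
      exact hnil.isUnit_add_left_of_commute hxu (Commute.all _ _)
    exact (isUnit_pow_iff two_ne_zero).1 h1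
  let P : (AdjoinRoot m)[X] := X ^ 2 - Polynomial.C (AdjoinRoot.mk m X)
  -- Newton iteration corrects `q₀` to an exact root of `P = Y² - X` in `F[X]/(m)`. It applies
  -- because the derivative `2 q₀` is a unit: the characteristic is not 2, and `q₀ ^ 2` is the unit
  -- `X` plus a nilpotent.
  obtain ⟨r, ⟨-, hr⟩, -⟩ := existsUnique_nilpotent_sub_and_aeval_eq_zero (P := P)
    (x := AdjoinRoot.mk m q₀) (by simpa [P] using hnil) (by
      have h2 : IsUnit (algebraMap F (AdjoinRoot m) 2) :=
        (IsUnit.mk0 _ (NeZero.ne (2 : F))).map _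
      rw [map_ofNat] at h2
      simp only [P, derivative_sub, derivative_X_pow, derivative_C, sub_zero]
      simpa using h2.mul hqu)
  obtain ⟨q, rfl⟩ := AdjoinRoot.mk_surjective r
  refine ⟨q, ?_⟩
  have h1 : AdjoinRoot.mk m (q ^ 2 - X) = 0 := by
    rw [map_sub, map_pow]
    simpa [P] using hr
  obtain ⟨g, hg⟩ := AdjoinRoot.mk_eq_zero.1 h1
  have h2 := congrArg (aeval C) hg
  rw [map_sub, map_pow, aeval_X, map_mul, hm, minpoly.aeval, zero_mul, sub_eq_zero, pow_two] at h2
  exact h2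

end SquareRoot

/-! ### Multiplicities of homogeneous bases -/

section Multiplicity

namespace BicharPair.Choice

variable {F : Type u} [Field F] {G : Type v} [CommGroup G] {E : BicharPair F G}

theorem mem_comp_iff (c : E.Choice) {t : E.T} {x : c.D} :
    x ∈ c.comp (t : G) ↔ ∃ a : F, x = a • c.X t := by
  have h : {s : E.T | (s : G) = t} = {t} := by
    ext s; simp
  rw [comp, h, Set.image_singleton, Submodule.mem_span_singleton]
  simp [eq_comm]

theorem mem_comp_iff' (c : E.Choice) {g : G} (hg : g ∈ E.T) {x : c.D} :
    x ∈ c.comp g ↔ ∃ a : F, x = a • c.X ⟨g, hg⟩ :=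
  c.mem_comp_iff (t := ⟨g, hg⟩)

theorem eq_zero_of_mem_comp (c : E.Choice) {g : G} (hg : g ∉ E.T) {x : c.D} (hx : x ∈ c.comp g) :
    x = 0 := by
  have h : {s : E.T | (s : G) = g} = ∅ := by
    ext s
    simp only [Set.mem_ofPred_eq, Set.mem_empty_iff_false, iff_false]
    rintro rfl
    exact hg s.2
  rwa [comp, h, Set.image_empty, Submodule.span_empty, Submodule.mem_bot] at hx

theorem X_ne_zero (c : E.Choice) (t : E.T) : c.X t ≠ 0 := c.linearIndependent_X.ne_zero t

theorem η_ne_zero (c : E.Choice) (t : E.T) : c.η t ≠ 0 := by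
  intro h
  have := c.η_mul_self t
  simp [h] at this

theorem isUnit_X (c : E.Choice) (t : E.T) : IsUnit (c.X t) := by
  refine .of_mul_eq_one (c.η t • c.X t) ?_
  rw [mul_smul_comm, X_mul_self, smul_smul, η_mul_self, one_smul]

/-- The degrees in `gT`, as a matrix: its columns are the vectors `e_i X_t` of degree `g`. -/
noncomputable def cosetMatrix (c : E.Choice) {ι : Type*} [DecidableEq ι] (γ : ι → G) (g : G)
    (S : Set ι) (hS : ∀ i ∈ S, (γ i)⁻¹ * g ∈ E.T) : Matrix ι S c.D :=
  Matrix.of fun i k => if i = k then c.X ⟨_, hS k k.2⟩ else 0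

section

variable (c : E.Choice) {ι κ : Type*} [DecidableEq ι] {γ : ι → G} {g : G} {S : Set ι}
  (hS : ∀ i ∈ S, (γ i)⁻¹ * g ∈ E.T)

theorem mul_cosetMatrix [Fintype ι] (M : Matrix κ ι c.D) (j : κ) (k : S) :
    (M * c.cosetMatrix γ g S hS) j k = M j k * c.X ⟨_, hS k k.2⟩ := by
  rw [Matrix.mul_apply, Finset.sum_eq_single (k : ι)]
  · simp [cosetMatrix]
  · intro b _ hb; simp [cosetMatrix, hb]
  · simp

/-- The columns of the coset matrix have disjoint supports with nonzero entries, so they are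
linearly independent over `F`. Hence the size of `S` bounds below the dimension of the degree-`g`
part of the module, which turns counting basis elements into linear algebra over `F`. -/
theorem eq_zero_of_cosetMatrix_mulVec [Fintype S] {w : S → F}
    (h : (c.cosetMatrix γ g S hS).mulVec (fun k => algebraMap F c.D (w k)) = 0) : w = 0 := by
  ext k
  have h1 := congrFun h k
  rw [Matrix.mulVec, dotProduct, Finset.sum_eq_single k] at h1
  · rw [cosetMatrix, Matrix.of_apply, if_pos rfl, ← Algebra.commutes, ← Algebra.smul_def] at h1
    exact (smul_eq_zero.1 h1).resolve_right (c.X_ne_zero _)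
  · intro b _ hb
    have : ¬ (k : ι) = b := fun h => hb (Subtype.ext h.symm)
    simp [cosetMatrix, this]
  · simp

end

/-- A homogeneous matrix with a left inverse does not decrease multiplicities. -/
theorem card_le_of_mul_eq_one (c : E.Choice) {ι κ : Type*} [Fintype ι] [DecidableEq ι] [Fintype κ]
    {γ : ι → G} {p : ι → ZMod 2} {δ : κ → G} {q : κ → ZMod 2} {s : G} {r : ZMod 2}
    {M : Matrix κ ι c.D} {N : Matrix ι κ c.D} (hNM : N * M = 1)
    (hM : IsHomogMatrix c.comp δ q γ p s r M) (a : ZMod 2) (x : G ⧸ E.T) :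
    Nat.card {i // p i = a ∧ (γ i : G ⧸ E.T) = x} ≤
      Nat.card {j // q j = a + r ∧ (δ j : G ⧸ E.T) = (s : G ⧸ E.T) * x} := by
  classical
  obtain ⟨g, rfl⟩ := QuotientGroup.mk_surjective x
  let S : Set ι := {i | p i = a ∧ (γ i : G ⧸ E.T) = (g : G ⧸ E.T)}
  let S' : Set κ := {j | q j = a + r ∧ (δ j : G ⧸ E.T) = (s : G ⧸ E.T) * (g : G ⧸ E.T)}
  have hS : ∀ i ∈ S, (γ i)⁻¹ * g ∈ E.T := fun i hi => QuotientGroup.eq.1 hi.2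
  have hS' : ∀ j ∈ S', (δ j)⁻¹ * (s * g) ∈ E.T := fun j hj => QuotientGroup.eq.1 hj.2
  have hmem : ∀ j (k : S), M j k * c.X ⟨_, hS k k.2⟩ ∈ c.comp ((δ j)⁻¹ * (s * g)) := by
    intro j k
    convert c.isInvolutionGrading.mul_mem (hM j k).1 (c.X_mem ⟨_, hS k k.2⟩ rfl) using 2
    group
  have hz : ∀ j, j ∉ S' → ∀ k : S, M j k * c.X ⟨_, hS k k.2⟩ = 0 := by
    intro j hj k
    by_cases hq : q j = a + r
    · apply c.eq_zero_of_mem_comp _ (hmem j k)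
      intro h
      exact hj ⟨hq, QuotientGroup.eq.2 h⟩
    · rw [(hM j k).2, zero_mul]
      rw [k.2.1]
      intro h
      apply hq
      rw [← h, add_comm, add_assoc, CharTwo.add_self_eq_zero, add_zero]
  -- On vectors of degree `g` and parity `a`, `M` has all its coordinates in one-dimensional
  -- components indexed by `S'`. It is therefore described by a scalar matrix `b`, which is
  -- injective because `N` inverts `M` on the left.
  choose b hb using fun (j : S') (k : S) => (c.mem_comp_iff' (hS' j j.2)).1 (hmem j k)
  have hinj : Function.Injective (Matrix.toLin' (Matrix.of b)) := by
    rw [injective_iff_map_eq_zero]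
    intro w hw
    rw [Matrix.toLin'_apply] at hw
    apply c.eq_zero_of_cosetMatrix_mulVec hS
    have h1 : (M * c.cosetMatrix γ g S hS).mulVec (fun k => algebraMap F c.D (w k)) = 0 := by
      ext1 j
      rw [Matrix.mulVec, dotProduct]
      simp_rw [mul_cosetMatrix, ← Algebra.commutes, ← Algebra.smul_def]
      by_cases hj : j ∈ S'
      · have h2 := congrFun hw ⟨j, hj⟩
        rw [Matrix.mulVec, dotProduct] at h2
        simp_rw [hb ⟨j, hj⟩, smul_smul]
        rw [← Finset.sum_smul]
        simp only [Matrix.of_apply, Pi.zero_apply] at h2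
        simp_rw [mul_comm (w _), h2, zero_smul, Pi.zero_apply]
      · simp [hz j hj]
    have h2 := congrArg N.mulVec h1
    rwa [Matrix.mulVec_mulVec, ← Matrix.mul_assoc, hNM, Matrix.one_mul, Matrix.mulVec_zero] at h2
  have h3 := LinearMap.finrank_le_finrank_of_injective hinj
  rw [Module.finrank_fintype_fun_eq_card, Module.finrank_fintype_fun_eq_card] at h3
  rw [← Nat.card_eq_fintype_card, ← Nat.card_eq_fintype_card] at h3
  exact h3

end BicharPair.Choice

/-- A homogeneous sesquilinear form of degree `h₀` and parity `p₀`, which satisfies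
`B(u, v) = d (-1)^(|u||v|) φ₀ (B(v, u))`. -/
structure IsHermitianForm {F : Type u} [Field F] {G : Type v} [CommGroup G] {E : BicharPair F G}
    (c : E.Choice) {ι : Type*} [Fintype ι] [DecidableEq ι] (par : ι → ZMod 2) (γ : ι → G)
    (g₀ : G × ZMod 2) (d : F) (Φ : Matrix ι ι c.D) : Prop where
  homog : IsHomogMatrix c.comp (fun i => (γ i)⁻¹) par γ par g₀.1 g₀.2 Φ
  herm : ∀ i j, Φ i j = (d * zsign F (par i * par j)) • c.transposition.map (Φ j i)
  isUnit : IsUnit Φ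

variable {F : Type u} [Field F] {G : Type v} [CommGroup G] {E : BicharPair F G} {c : E.Choice}
  {ι : Type*} [Fintype ι] [DecidableEq ι] {par : ι → ZMod 2} {γ : ι → G} {g₀ : G × ZMod 2} {d : F}
  {Φ : Matrix ι ι c.D}

theorem IsSuperHermitian.hermitianForm {p₀ : ZMod 2} {h₀ : G}
    (h : IsSuperHermitian c.transposition par p₀ Φ)
    (h' : ∀ i j, Φ i j ∈ c.comp (h₀ * γ i * γ j)) : IsHermitianForm c par γ (h₀, p₀) 1 Φ where
  homog i j := by
    refine ⟨?_, fun hij => ?_⟩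
    · convert h' i j using 2
      rw [inv_inv, mul_comm (γ i)]
    · by_contra h1
      exact hij (h.parity i j h1)
  herm i j := by rw [one_mul, ← h.herm]
  isUnit := h.nondeg

theorem IsHermitianForm.mem (h : IsHermitianForm c par γ g₀ d Φ) (i j : ι) :
    Φ i j ∈ c.comp (g₀.1 * γ i * γ j) := by
  convert (h.homog i j).1 using 2
  rw [inv_inv, mul_comm (γ i)]

/-- `Φ` is an invertible homogeneous matrix from the module to its dual, whose basis has the
inverted degrees, so multiplicities can only grow along the pairing. The pairing of (parity, coset)
types is an involution, which gives the reverse inequality. -/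
theorem IsHermitianForm.card_eq (h : IsHermitianForm c par γ g₀ d Φ) (a : ZMod 2) (g : G) :
    Nat.card {i // par i = a ∧ (γ i : G ⧸ E.T) = (g : G ⧸ E.T)} =
      Nat.card {i // par i = a + g₀.2 ∧ (γ i : G ⧸ E.T) = ((g₀.1⁻¹ * g⁻¹ : G) : G ⧸ E.T)} := by
  obtain ⟨⟨Φ, Ψ, h1, h2⟩, rfl⟩ := h.isUnit
  have key : ∀ (a : ZMod 2) (g : G),
      Nat.card {i // par i = a ∧ (γ i : G ⧸ E.T) = (g : G ⧸ E.T)} ≤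
        Nat.card {i // par i = a + g₀.2 ∧
          (γ i : G ⧸ E.T) = ((g₀.1⁻¹ * g⁻¹ : G) : G ⧸ E.T)} := by
    intro a g
    have h3 := c.card_le_of_mul_eq_one h2 h.homog a g
    have h4 : ∀ i, (((γ i)⁻¹ : G) : G ⧸ E.T) = (g₀.1 : G ⧸ E.T) * (g : G ⧸ E.T) ↔
        (γ i : G ⧸ E.T) = ((g₀.1⁻¹ * g⁻¹ : G) : G ⧸ E.T) := by
      intro i
      rw [QuotientGroup.mk_inv, QuotientGroup.mk_mul, QuotientGroup.mk_inv, QuotientGroup.mk_inv,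
        inv_eq_iff_eq_inv, mul_inv]
    simpa only [h4] using h3
  refine le_antisymm (key a g) ?_
  have h5 := key (a + g₀.2) (g₀.1⁻¹ * g⁻¹)
  have h6 : a + g₀.2 + g₀.2 = a := by rw [add_assoc, CharTwo.add_self_eq_zero, add_zero]
  have h7 : g₀.1⁻¹ * (g₀.1⁻¹ * g⁻¹)⁻¹ = g := by simp
  rwa [h6, h7] at h5

/-- On vectors of degree `g` and parity `a` the form takes values in `F X_t` with `t = h₀ g²`. Its
super-symmetry contributes the sign `(-1)^a` and the transposition of `X_t` contributes `η(t)`.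
Their product is `-1`, so the coordinates form a skew-symmetric matrix over `F`. It is nonsingular
since `Φ` is, and such matrices have even size in characteristic different from 2. -/
theorem IsHermitianForm.even_card [NeZero (2 : F)] (h : IsHermitianForm c par γ g₀ 1 Φ)
    (hp : g₀.2 = 0) (a : ZMod 2) (g : G) (hg : g₀.1 * g ^ 2 ∈ E.T)
    (hη : c.η ⟨g₀.1 * g ^ 2, hg⟩ = -zsign F a) :
    Even (Nat.card {i // par i = a ∧ (γ i : G ⧸ E.T) = (g : G ⧸ E.T)}) := by
  classical
  let S : Set ι := {i | par i = a ∧ (γ i : G ⧸ E.T) = (g : G ⧸ E.T)}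
  have hS : ∀ i ∈ S, (γ i)⁻¹ * g ∈ E.T := fun i hi => QuotientGroup.eq.1 hi.2
  set t : E.T := ⟨g₀.1 * g ^ 2, hg⟩ with ht
  let X : S → c.D := fun k => c.X ⟨_, hS k k.2⟩
  let Y : S → c.D := fun k => c.transposition.map (X k)
  have hmem : ∀ i (k : S), Φ i k * X k ∈ c.comp (g₀.1 * γ i * g) := by
    intro i k
    convert c.isInvolutionGrading.mul_mem (h.mem i k) (c.X_mem ⟨_, hS k k.2⟩ rfl) using 2
    group
  have hmem' : ∀ i k : S, Y i * (Φ i k * X k) ∈ c.comp (t : G) := by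
    intro i k
    convert c.isInvolutionGrading.mul_mem
      (c.isInvolutionGrading.map_mem (c.X_mem ⟨_, hS i i.2⟩ rfl)) (hmem i k) using 2
    simp only [ht]
    calc g₀.1 * g ^ 2 = g₀.1 * g * g * ((γ i)⁻¹ * γ i) := by
          rw [inv_mul_cancel, mul_one, pow_two, mul_assoc]
      _ = _ := by ac_rfl
  -- As the form is even and `h₀ g² ∈ T`, the component of parity `a` and coset `gT` is paired only
  -- with itself. So a vector in the kernel of `b` is orthogonal to the whole module.
  have hz : ∀ i, i ∉ S → ∀ k : S, Φ i k * X k = 0 := by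
    intro i hi k
    by_cases hq : par i = a
    · apply c.eq_zero_of_mem_comp _ (hmem i k)
      intro h1
      refine hi ⟨hq, QuotientGroup.eq.2 ?_⟩
      have h2 := mul_mem (inv_mem h1) hg
      have h3 : (g₀.1 * γ i * g)⁻¹ * (g₀.1 * g ^ 2) = (γ i)⁻¹ * g := by
        rw [pow_two, mul_inv, mul_inv]
        calc g₀.1⁻¹ * (γ i)⁻¹ * g⁻¹ * (g₀.1 * (g * g))
            = (g₀.1⁻¹ * g₀.1) * (g⁻¹ * g) * ((γ i)⁻¹ * g) := by ac_rfl
          _ = _ := by simp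
      rwa [h3] at h2
    · rw [(h.homog i k).2, zero_mul]
      rw [k.2.1, hp]
      intro h1
      apply hq
      rw [← add_zero a, ← h1, add_comm, add_assoc, CharTwo.add_self_eq_zero, add_zero]
  choose b hb using fun i k : S => c.mem_comp_iff.1 (hmem' i k)
  have hskew : (Matrix.of b).transpose = -Matrix.of b := by
    ext i k
    rw [Matrix.transpose_apply, Matrix.neg_apply, Matrix.of_apply, Matrix.of_apply]
    have h1 : c.transposition.map (Y i * (Φ i k * X k)) =
        zsign F a • (Y k * (Φ k i * X i)) := by
      rw [h.herm k i, k.2.1, i.2.1, c.transposition.map_mul, c.transposition.map_mul,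
        c.transposition.map_map]
      have : a * a = a := (by decide : ∀ a : ZMod 2, a * a = a) a
      rw [one_mul, this, smul_mul_assoc, mul_smul_comm, smul_smul, zsign_mul_self, one_smul,
        mul_assoc]
    rw [hb, hb, map_smul, c.transposition_X, hη, smul_smul, smul_smul] at h1
    have h2 := smul_left_injective F (c.X_ne_zero t) h1
    have h3 : zsign F a * zsign F a = 1 := zsign_mul_self a
    linear_combination (-zsign F a) * h2 - (b i k + b k i) * h3
  have hdet : (Matrix.of b).det ≠ 0 := by
    rw [Ne, ← Matrix.exists_mulVec_eq_zero_iff]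
    rintro ⟨w, hw, h0⟩
    apply hw
    apply c.eq_zero_of_cosetMatrix_mulVec hS
    have h1 : (Φ * c.cosetMatrix γ g S hS).mulVec (fun k => algebraMap F c.D (w k)) = 0 := by
      ext1 i
      rw [Matrix.mulVec, dotProduct]
      simp_rw [c.mul_cosetMatrix, ← Algebra.commutes, ← Algebra.smul_def]
      by_cases hi : i ∈ S
      · have h2 := congrFun h0 ⟨i, hi⟩
        rw [Matrix.mulVec, dotProduct] at h2
        have h3 : Y ⟨i, hi⟩ * ∑ k : S, w k • (Φ i k * X k) = 0 := by
          rw [Finset.mul_sum]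
          simp_rw [mul_smul_comm, hb ⟨i, hi⟩, smul_smul]
          rw [← Finset.sum_smul]
          simp only [Matrix.of_apply, Pi.zero_apply] at h2
          simp_rw [mul_comm (w _), h2, zero_smul]
        have h4 : IsUnit (Y ⟨i, hi⟩) := by
          simp only [Y, X, c.transposition_X]
          exact (c.isUnit_X _).smul (Units.mk0 _ (c.η_ne_zero _))
        exact h4.mul_right_eq_zero.1 h3
      · exact Finset.sum_eq_zero fun k _ => by
          have := hz i hi k
          simp only [X] at this
          rw [this, smul_zero]
    obtain ⟨⟨Φ, Ψ, h5, h6⟩, rfl⟩ := h.isUnit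
    have h2 := congrArg Ψ.mulVec h1
    simp only at h2
    rwa [Matrix.mulVec_mulVec, ← Matrix.mul_assoc, h6, Matrix.one_mul, Matrix.mulVec_zero] at h2
  have h1 := congrArg Matrix.det hskew
  rw [Matrix.det_transpose, Matrix.det_neg] at h1
  have h2 : (-1 : F) ^ Fintype.card S = 1 := by
    have := mul_right_cancel₀ hdet ((one_mul _).trans h1)
    exact this.symm
  rw [← Nat.card_eq_fintype_card] at h2
  by_contra hodd
  change ¬ Even (Nat.card S) at hodd
  rw [(Nat.not_even_iff_odd.1 hodd).neg_one_pow] at h2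
  apply NeZero.ne (2 : F)
  linear_combination -h2

end Multiplicity

/-! ### Presentations of graded superalgebras with superinvolution by matrices -/

section Presentation

variable {F : Type u} [Field F] {G : Type v} [CommGroup G] {E : BicharPair F G}

/-- An isomorphism of a graded superalgebra with superinvolution with the matrix superalgebra
`M_ι(D)`, graded by means of `par` and `γ`, with the superadjunction defined by `Φ`. -/
structure IsPresentation (c : E.Choice) {ι : Type*} [Fintype ι] [DecidableEq ι]
    (par : ι → ZMod 2) (γ : ι → G) (Φ : Matrix ι ι c.D) {R : GradedSuperinvAlgebra.{u, w} F G}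
    (e : R.alg.carrier ≃ₐ[F] Matrix ι ι c.D) : Prop where
  part : ∀ p x, x ∈ R.alg.part p → e x ∈ matrixPart F par p
  comp : ∀ g x, x ∈ R.grading.comp g → e x ∈ matrixComp c.comp γ g
  inv : ∀ x, Φ * e (R.alg.inv x) = superTranspose c.transposition par (e x) * Φ

variable {c : E.Choice} {ι : Type*} [Fintype ι] [DecidableEq ι] {κ : Type*} [Fintype κ]
  [DecidableEq κ] {par : ι → ZMod 2} {γ : ι → G} {Φ : Matrix ι ι c.D}
  {R : GradedSuperinvAlgebra.{u, w} F G} {e : R.alg.carrier ≃ₐ[F] Matrix ι ι c.D}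

theorem IsPresentation.part_iff (h : IsPresentation c par γ Φ e) {p : ZMod 2}
    {x : R.alg.carrier} : x ∈ R.alg.part p ↔ e x ∈ matrixPart F par p :=
  ⟨h.part p x, mem_of_map_mem (iSupIndep_of_isCompl R.alg.isCompl_part)
    (iSup_eq_top_of_isCompl R.alg.isCompl_part) (iSupIndep_of_isCompl (isCompl_matrixPart par))
    (iSup_eq_top_of_isCompl (isCompl_matrixPart par)) e.toLinearMap e.injective h.part⟩

theorem IsPresentation.comp_iff (h : IsPresentation c par γ Φ e) {g : G}
    {x : R.alg.carrier} : x ∈ R.grading.comp g ↔ e x ∈ matrixComp c.comp γ g :=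
  ⟨h.comp g x, mem_of_map_mem R.grading.indep R.grading.iSup_eq_top
    (matrixComp_indep c.isInvolutionGrading.indep γ)
    (matrixComp_iSup c.isInvolutionGrading.iSup_eq_top γ) e.toLinearMap e.injective h.comp⟩

/-- Two graded superalgebras with superinvolution with the same presentation are isomorphic. -/
theorem IsPresentation.iso {R' : GradedSuperinvAlgebra F G}
    {e' : R'.alg.carrier ≃ₐ[F] Matrix ι ι c.D} (h : IsPresentation c par γ Φ e)
    (h' : IsPresentation c par γ Φ e') (hΦ : IsUnit Φ) : R.Iso R' := by
  refine ⟨e.trans e'.symm, fun p a ha => ?_, fun g a ha => ?_, fun a => ?_⟩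
  · rw [h'.part_iff]
    simpa using h.part p a ha
  · rw [h'.comp_iff]
    simpa using h.comp g a ha
  · apply e'.injective
    apply hΦ.mul_left_cancel
    rw [h'.inv]
    simpa using h.inv a

theorem matrixGraded_isPresentation [NeZero (2 : F)] {p₀ : ZMod 2} {h₀ : G}
    (h : IsSuperHermitian c.transposition par p₀ Φ) (hγ : IsHomogeneousForm c.comp γ h₀ Φ) :
    IsPresentation (R := matrixGraded c.isInvolutionGrading h hγ) c par γ Φ AlgEquiv.refl where
  part _ _ hx := hx
  comp _ _ hx := hx
  inv := mul_superAdj c.transposition par h.nondeg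

/-- Shifting all degrees by `g` does not change a presentation. -/
theorem IsPresentation.shift (h : IsPresentation c par γ Φ e) (g : G) :
    IsPresentation c par (fun i => g * γ i) Φ e where
  part := h.part
  comp g' x hx i j := by
    convert h.comp g' x hx i j using 2
    rw [mul_inv]
    calc g⁻¹ * (γ i)⁻¹ * g' * (g * γ j) = (g⁻¹ * g) * ((γ i)⁻¹ * g' * γ j) := by ac_rfl
      _ = _ := by rw [inv_mul_cancel, one_mul]
  inv := h.inv

/-- Both arguments of the form move by `g`, which costs its degree a factor `g⁻²`. This is the
source of `g⁻² g₀` in the classification. -/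
theorem IsHermitianForm.shift {g₀ : G × ZMod 2} {d : F} (h : IsHermitianForm c par γ g₀ d Φ)
    (g : G) : IsHermitianForm c par (fun i => g * γ i) ((g ^ 2)⁻¹ * g₀.1, g₀.2) d Φ where
  homog i j := by
    refine ⟨?_, (h.homog i j).2⟩
    convert (h.homog i j).1 using 2
    rw [inv_inv, inv_inv, pow_two]
    calc g * γ i * ((g * g)⁻¹ * g₀.1) * (g * γ j) = ((g * g) * (g * g)⁻¹) * (γ i * g₀.1 * γ j) := by
          ac_rfl
      _ = _ := by rw [mul_inv_cancel, one_mul]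
  herm := h.herm
  isUnit := h.isUnit

/-- The diagonal matrix of signs. -/
def signDiag (F : Type*) [Field F] (D : Type*) [Ring D] [Algebra F D] {ι : Type*} [DecidableEq ι]
    (par : ι → ZMod 2) : Matrix ι ι D := Matrix.diagonal fun i => algebraMap F D (zsign F (par i))

/-- Changing all parities changes the form by the sign `(-1)^|u|`. -/
theorem IsPresentation.parityShift (h : IsPresentation c par γ Φ e) :
    IsPresentation c (fun i => par i + 1) γ (signDiag F c.D par * Φ) e where
  part p x hx i j hij := by
    refine h.part p x hx i j fun h1 => hij ?_
    have key : ∀ a b : ZMod 2, a + 1 + (b + 1) = a + b := by decide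
    rw [key, h1]
  comp := h.comp
  inv x := by
    rw [mul_assoc, h.inv, ← mul_assoc, ← mul_assoc]
    congr 1
    refine Matrix.ext fun i j => ?_
    rw [signDiag, Matrix.mul_diagonal, Matrix.diagonal_mul, ← Algebra.commutes _
      (superTranspose _ _ _ _ _), ← Algebra.smul_def, ← Algebra.smul_def]
    simp only [superTranspose, LinearMap.coe_mk, AddHom.coe_mk, Matrix.of_apply, smul_smul,
      ← zsign_add]
    congr 2
    generalize par i = a
    generalize par j = b
    revert a b
    decide

theorem isUnit_signDiag (par : ι → ZMod 2) : IsUnit (signDiag F c.D par) :=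
  .of_mul_eq_one _ (signDiag_mul_self par)

/-- In `(a + 1)(b + 1) = ab + a + b + 1` the summands `a` and `b` are absorbed by the diagonal of
signs, and the final `1` reverses `d`. Hence skew forms can be made Hermitian by exchanging
parities, while among presentations with `d = 1` a parity exchange is detectable. -/
theorem IsHermitianForm.parityShift {g₀ : G × ZMod 2} {d : F}
    (h : IsHermitianForm c par γ g₀ d Φ) :
    IsHermitianForm c (fun i => par i + 1) γ g₀ (-d) (signDiag F c.D par * Φ) where
  homog i j := by
    rw [signDiag, Matrix.diagonal_mul, ← Algebra.smul_def]
    refine ⟨Submodule.smul_mem _ _ (h.homog i j).1, fun hij => ?_⟩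
    rw [(h.homog i j).2, smul_zero]
    have key : ∀ a b : ZMod 2, a + 1 + (b + 1) = a + b := by decide
    rwa [key] at hij
  herm i j := by
    rw [signDiag, Matrix.diagonal_mul, Matrix.diagonal_mul, ← Algebra.smul_def, ← Algebra.smul_def,
      h.herm i j, map_smul, smul_smul, smul_smul]
    congr 1
    have key : ∀ a b : ZMod 2, (a + 1) * (b + 1) = a * b + a + b + 1 := by decide
    have h1 : zsign F (1 : ZMod 2) = -1 := by simp [zsign]
    have h2 := zsign_mul_self (F := F) (par j)
    rw [key, zsign_add, zsign_add, zsign_add, h1]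
    linear_combination (-d * zsign F (par i * par j) * zsign F (par i)) * h2
  isUnit := (isUnit_signDiag par).mul h.isUnit

/-- Conjugation by an invertible rectangular matrix. -/
def rectConj {D : Type*} [Ring D] [Algebra F D] (W : Matrix ι κ D) (V : Matrix κ ι D)
    (hWV : W * V = 1) (hVW : V * W = 1) : Matrix ι ι D ≃ₐ[F] Matrix κ κ D :=
  AlgEquiv.ofLinearEquiv
    { toFun := fun X => V * X * W
      map_add' := fun X Y => by rw [Matrix.mul_add, Matrix.add_mul]
      map_smul' := fun a X => by
        rw [Matrix.mul_smul, Matrix.smul_mul, RingHom.id_apply]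
      invFun := fun Y => W * Y * V
      left_inv := fun X => by
        calc W * (V * X * W) * V = (W * V) * X * (W * V) := by simp only [Matrix.mul_assoc]
          _ = X := by rw [hWV, Matrix.one_mul, Matrix.mul_one]
      right_inv := fun X => by
        calc V * (W * X * V) * W = (V * W) * X * (V * W) := by simp only [Matrix.mul_assoc]
          _ = X := by rw [hVW, Matrix.one_mul, Matrix.mul_one] }
    (by change V * (1 : Matrix ι ι D) * W = 1; rw [Matrix.mul_one, hVW])
    (fun X Y => by
      change V * (X * Y) * W = V * X * W * (V * Y * W)
      calc V * (X * Y) * W = V * X * (1 : Matrix ι ι D) * Y * W := by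
            rw [Matrix.mul_one]; simp only [Matrix.mul_assoc]
        _ = V * X * W * (V * Y * W) := by rw [← hWV]; simp only [Matrix.mul_assoc])

theorem rectConj_apply {D : Type*} [Ring D] [Algebra F D] {W : Matrix ι κ D} {V : Matrix κ ι D}
    (hWV : W * V = 1) (hVW : V * W = 1) (X : Matrix ι ι D) :
    rectConj (F := F) W V hWV hVW X = V * X * W := rfl

variable {par' : κ → ZMod 2} {γ' : κ → G}

/-- As `W` and `V` are even, their nonzero entries join indices of equal parity. The sign of the
supertranspose is thus the same on both sides in every nonzero term. -/
theorem superTranspose_conj {D : Type*} [Ring D] [Algebra F D] (φ₀ : AlgInvolution F D)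
    {W : Matrix ι κ D} {V : Matrix κ ι D} (hW : ∀ i j, par i + par' j ≠ 0 → W i j = 0)
    (hV : ∀ j i, par' j + par i ≠ 0 → V j i = 0) (X : Matrix ι ι D) :
    superTranspose φ₀ par' (V * X * W) =
      φ₀.conjTranspose W * superTranspose φ₀ par X * φ₀.conjTranspose V := by
  ext j k
  simp only [superTranspose, LinearMap.coe_mk, AddHom.coe_mk, Matrix.of_apply, Matrix.mul_apply,
    Finset.sum_mul, map_sum, φ₀.map_mul, φ₀.conjTranspose_apply, Finset.smul_sum]
  rw [Finset.sum_comm]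
  refine Finset.sum_congr rfl fun a _ => Finset.sum_congr rfl fun b _ => ?_
  by_cases h1 : par b + par' j = 0
  · by_cases h2 : par' k + par a = 0
    · have e1 : par b = par' j := CharTwo.add_eq_zero.1 h1
      have e2 : par' k = par a := CharTwo.add_eq_zero.1 h2
      rw [e1, e2, mul_smul_comm, smul_mul_assoc, mul_assoc]
    · rw [hV k a h2]; simp
  · rw [hW b j h1]; simp

/-- The effect of a homogeneous change of basis on a presentation. -/
theorem IsPresentation.changeBasis (h : IsPresentation c par γ Φ e) {W : Matrix ι κ c.D}
    {V : Matrix κ ι c.D} (hWV : W * V = 1) (hVW : V * W = 1)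
    (hW : IsHomogMatrix c.comp γ par γ' par' 1 0 W) :
    IsPresentation c par' γ' (c.transposition.conjTranspose W * Φ * W)
      (e.trans (rectConj W V hWV hVW)) := by
  have hV : IsHomogMatrix c.comp γ' par' γ par 1 0 V := by
    simpa using hW.inverse c.isInvolutionGrading hVW hWV
  have hVW' : c.transposition.conjTranspose V * c.transposition.conjTranspose W = 1 := by
    rw [← AlgInvolution.conjTranspose_mul, hWV, AlgInvolution.conjTranspose_one]
  refine ⟨fun p x hx j k hjk => ?_, fun g x hx => ?_, fun x => ?_⟩
  · rw [AlgEquiv.trans_apply, rectConj_apply, Matrix.mul_apply]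
    refine Finset.sum_eq_zero fun b _ => ?_
    rw [Matrix.mul_apply]
    by_cases h1 : par b + par' k = 0
    · rw [Finset.sum_eq_zero, zero_mul]
      intro a _
      by_cases h2 : par' j + par a = 0
      · rw [h.part p x hx a b, mul_zero]
        rwa [← CharTwo.add_eq_zero.1 h2, CharTwo.add_eq_zero.1 h1]
      · rw [(hV j a).2 h2, zero_mul]
    · rw [(hW b k).2 h1, mul_zero]
  · rw [AlgEquiv.trans_apply, rectConj_apply]
    intro j k
    rw [Matrix.mul_apply]
    refine sum_mem fun b _ => ?_
    rw [Matrix.mul_apply, Finset.sum_mul]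
    refine sum_mem fun a _ => ?_
    convert c.isInvolutionGrading.mul_mem (c.isInvolutionGrading.mul_mem (hV j a).1
      (h.comp g x hx a b)) (hW b k).1 using 2
    group
  · rw [AlgEquiv.trans_apply, AlgEquiv.trans_apply, rectConj_apply, rectConj_apply,
      superTranspose_conj c.transposition (fun i j => (hW i j).2) fun i j => (hV i j).2]
    calc c.transposition.conjTranspose W * Φ * W * (V * e (R.alg.inv x) * W)
        = c.transposition.conjTranspose W * Φ * (W * V) * e (R.alg.inv x) * W := by
          simp only [Matrix.mul_assoc]
      _ = c.transposition.conjTranspose W * (Φ * e (R.alg.inv x)) * W := by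
          rw [hWV, Matrix.mul_one]; simp only [Matrix.mul_assoc]
      _ = c.transposition.conjTranspose W * superTranspose c.transposition par (e x) *
            (c.transposition.conjTranspose V * c.transposition.conjTranspose W) * Φ * W := by
          rw [h.inv, hVW', Matrix.mul_one]; simp only [Matrix.mul_assoc]
      _ = _ := by simp only [Matrix.mul_assoc]

/-- The degree `s` of `W` enters once through `W` and once through its conjugate transpose. Moving a
symmetric entry past the even factors produces no new signs, so `d` is preserved. -/
theorem IsHermitianForm.changeBasis {g₀ : G × ZMod 2} {d : F} (h : IsHermitianForm c par γ g₀ d Φ)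
    {W : Matrix ι κ c.D} {V : Matrix κ ι c.D} (hWV : W * V = 1) (hVW : V * W = 1) {s : G}
    (hW : IsHomogMatrix c.comp γ par γ' par' s 0 W) :
    IsHermitianForm c par' γ' (s ^ 2 * g₀.1, g₀.2) d
      (c.transposition.conjTranspose W * Φ * W) where
  homog := by
    have h1 := ((hW.conjTranspose c.isInvolutionGrading).mul c.isInvolutionGrading h.homog).mul
      c.isInvolutionGrading hW
    convert h1 using 1
    · rw [pow_two]; ac_rfl
    · simp
  herm j k := by
    simp only [Matrix.mul_apply, Finset.sum_mul, map_sum, AlgInvolution.map_mul,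
      AlgInvolution.conjTranspose_apply, Finset.smul_sum, AlgInvolution.map_map]
    rw [Finset.sum_comm]
    refine Finset.sum_congr rfl fun a _ => Finset.sum_congr rfl fun b _ => ?_
    by_cases h1 : par b + par' k = 0
    · by_cases h2 : par a + par' j = 0
      · rw [h.herm a b, CharTwo.add_eq_zero.1 h1, CharTwo.add_eq_zero.1 h2, mul_smul_comm,
          smul_mul_assoc, mul_assoc]
      · rw [(hW a j).2 h2]; simp
    · rw [(hW b k).2 h1]; simp
  isUnit := by
    obtain ⟨⟨Φ, Ψ, h1, h2⟩, rfl⟩ := h.isUnit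
    have e1 : c.transposition.conjTranspose W * c.transposition.conjTranspose V = 1 := by
      rw [← AlgInvolution.conjTranspose_mul, hVW, AlgInvolution.conjTranspose_one]
    have e2 : c.transposition.conjTranspose V * c.transposition.conjTranspose W = 1 := by
      rw [← AlgInvolution.conjTranspose_mul, hWV, AlgInvolution.conjTranspose_one]
    refine ⟨⟨_, V * Ψ * c.transposition.conjTranspose V, ?_, ?_⟩, rfl⟩
    · calc c.transposition.conjTranspose W * Φ * W * (V * Ψ * c.transposition.conjTranspose V)
          = c.transposition.conjTranspose W * Φ * (W * V) * Ψ * c.transposition.conjTranspose V := by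
            simp only [Matrix.mul_assoc]
        _ = c.transposition.conjTranspose W * (Φ * Ψ) * c.transposition.conjTranspose V := by
            rw [hWV, Matrix.mul_one]; simp only [Matrix.mul_assoc]
        _ = 1 := by rw [h1, Matrix.mul_one, e1]
    · calc V * Ψ * c.transposition.conjTranspose V * (c.transposition.conjTranspose W * Φ * W)
          = V * Ψ * (c.transposition.conjTranspose V * c.transposition.conjTranspose W) * Φ * W := by
            simp only [Matrix.mul_assoc]
        _ = V * (Ψ * Φ) * W := by
            rw [e2, Matrix.mul_one]; simp only [Matrix.mul_assoc]
        _ = 1 := by rw [h2, Matrix.mul_one, hVW]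

end Presentation

/-! ### Equivalence of forms with the same invariants -/

section Equivalence

variable {F : Type u} [Field F] {G : Type v} [CommGroup G] {E : BicharPair F G} {c : E.Choice}
  {ι : Type*} [Fintype ι] [DecidableEq ι] {κ : Type*} [Fintype κ]
  [DecidableEq κ] {par : ι → ZMod 2} {γ : ι → G} {Φ : Matrix ι ι c.D} {par' : κ → ZMod 2}
  {γ' : κ → G} {R : GradedSuperinvAlgebra.{u, w} F G} {e : R.alg.carrier ≃ₐ[F] Matrix ι ι c.D}

/-- Equal multiplicities allow a bijection of basis elements preserving parity and coset. Matched
degrees differ by some `t ∈ T`, which is compensated by the invertible homogeneous scalar `X_t`. -/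
theorem exists_changeBasis_of_card_eq (c : E.Choice)
    (hcard : ∀ a x, Nat.card {i // par i = a ∧ (γ i : G ⧸ E.T) = x} =
      Nat.card {j // par' j = a ∧ (γ' j : G ⧸ E.T) = x}) :
    ∃ (W : Matrix ι κ c.D) (V : Matrix κ ι c.D), W * V = 1 ∧ V * W = 1 ∧
      IsHomogMatrix c.comp γ par γ' par' 1 0 W := by
  have hfib : ∀ y : ZMod 2 × (G ⧸ E.T), Nonempty
      ({j // (par' j, (γ' j : G ⧸ E.T)) = y} ≃ {i // (par i, (γ i : G ⧸ E.T)) = y}) := by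
    rintro ⟨a, x⟩
    have h := hcard a x
    simp only [Prod.mk.injEq]
    exact Finite.card_eq.1 h.symm
  let σ : κ ≃ ι := Equiv.ofFiberEquiv fun y => (hfib y).some
  have hσ : ∀ j, (par (σ j), (γ (σ j) : G ⧸ E.T)) = (par' j, (γ' j : G ⧸ E.T)) :=
    fun j => Equiv.ofFiberEquiv_map (fun y => (hfib y).some) j
  have hT : ∀ j, (γ (σ j))⁻¹ * γ' j ∈ E.T := fun j =>
    QuotientGroup.eq.1 (congrArg Prod.snd (hσ j))
  let t : κ → E.T := fun j => ⟨_, hT j⟩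
  refine ⟨Matrix.of fun i j => if i = σ j then c.X (t j) else 0,
    Matrix.of fun j i => if i = σ j then c.η (t j) • c.X (t j) else 0, ?_, ?_, ?_⟩
  · refine Matrix.ext fun i k => ?_
    rw [Matrix.mul_apply, Finset.sum_eq_single (σ.symm i)]
    · by_cases hik : i = k
      · subst hik
        simp [c.X_mul_self, smul_smul, c.η_mul_self]
      · have : ¬ k = i := fun h => hik h.symm
        simp [this, Matrix.one_apply_ne hik]
    · intro j _ hj
      have : ¬ i = σ j := by rintro rfl; simp at hj
      simp [this]
    · simp
  · refine Matrix.ext fun j k => ?_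
    rw [Matrix.mul_apply, Finset.sum_eq_single (σ j)]
    · by_cases hjk : j = k
      · subst hjk
        simp [c.X_mul_self, smul_smul, c.η_mul_self]
      · simp [hjk, Matrix.one_apply_ne hjk]
    · intro i _ hi
      simp [hi]
    · simp
  · refine fun i j => ⟨?_, fun h => ?_⟩
    · by_cases hij : i = σ j
      · subst hij
        simp only [Matrix.of_apply, if_true, mul_one]
        exact c.X_mem (t j) rfl
      · simp [hij]
    · have hij : ¬ i = σ j := by
        rintro rfl
        apply h
        have h1 : par (σ j) = par' j := congrArg Prod.fst (hσ j)
        rw [h1, CharTwo.add_self_eq_zero]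
      simp [hij]

/-- With `C = Φ⁻¹ Φ'`, the symmetry of both forms says that `C` is self-adjoint for `Φ`. Polynomials
in `C` are again self-adjoint, even and of trivial degree. So for a square root `W` of `C` of this
kind, `W* Φ W = Φ W² = Φ C = Φ'`. -/
theorem IsHermitianForm.exists_changeBasis [IsAlgClosed F] [NeZero (2 : F)] {g₀ : G × ZMod 2}
    {Φ' : Matrix ι ι c.D} (h : IsHermitianForm c par γ g₀ 1 Φ)
    (h' : IsHermitianForm c par γ g₀ 1 Φ') :
    ∃ W V : Matrix ι ι c.D, W * V = 1 ∧ V * W = 1 ∧ IsHomogMatrix c.comp γ par γ par 1 0 W ∧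
      c.transposition.conjTranspose W * Φ * W = Φ' := by
  obtain ⟨⟨Φ, Ψ, h1, h2⟩, rfl⟩ := h.isUnit
  simp only at h ⊢
  have hg := c.isInvolutionGrading
  set C : Matrix ι ι c.D := Ψ * Φ' with hC
  have hΦC : Φ * C = Φ' := by rw [hC, ← mul_assoc, h1, one_mul]
  have hChom : IsHomogMatrix c.comp γ par γ par 1 0 C := by
    have h3 := (h.homog.inverse hg h2 h1).mul hg h'.homog
    rwa [inv_mul_cancel, CharTwo.add_self_eq_zero] at h3
  -- Self-adjointness of `C`. Since `C` is even, the signs in the symmetries of `Φ` and of `Φ'`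
  -- agree term by term.
  have hCΦ : c.transposition.conjTranspose C * Φ = Φ' := by
    refine Matrix.ext fun i j => ?_
    rw [h'.herm, ← hΦC, Matrix.mul_apply, Matrix.mul_apply, map_sum, Finset.smul_sum]
    refine Finset.sum_congr rfl fun k _ => ?_
    rw [AlgInvolution.conjTranspose_apply, AlgInvolution.map_mul]
    by_cases hk : par k + par i = 0
    · rw [h.herm k j, CharTwo.add_eq_zero.1 hk, mul_smul_comm]
    · rw [(hChom k i).2 hk]; simp
  have hCu : IsUnit C := IsUnit.mul ⟨⟨Ψ, Φ, h2, h1⟩, rfl⟩ h'.isUnit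
  obtain ⟨q, hq⟩ := exists_aeval_sq_eq (F := F) hCu
  have key : ∀ f : Polynomial F, IsHomogMatrix c.comp γ par γ par 1 0 (Polynomial.aeval C f) ∧
      c.transposition.conjTranspose (Polynomial.aeval C f) * Φ = Φ * Polynomial.aeval C f := by
    intro f
    induction f using Polynomial.induction_on with
    | C a =>
      rw [Polynomial.aeval_C, Algebra.algebraMap_eq_smul_one]
      refine ⟨(IsHomogMatrix.one hg).smul a, ?_⟩
      have : c.transposition.conjTranspose (a • (1 : Matrix ι ι c.D)) = a • 1 := by
        conv_rhs => rw [← c.transposition.conjTranspose_one]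
        refine Matrix.ext fun i j => ?_
        rw [AlgInvolution.conjTranspose_apply, Matrix.smul_apply, Matrix.smul_apply, map_smul]
        rfl
      rw [this, smul_mul_assoc, mul_smul_comm, one_mul, mul_one]
    | add f g hf hg =>
      rw [map_add]
      refine ⟨hf.1.add hg.1, ?_⟩
      have : ∀ X Y : Matrix ι ι c.D, c.transposition.conjTranspose (X + Y) =
          c.transposition.conjTranspose X + c.transposition.conjTranspose Y := by
        intro X Y
        refine Matrix.ext fun i j => ?_
        rw [AlgInvolution.conjTranspose_apply, Matrix.add_apply, Matrix.add_apply, map_add]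
        rfl
      rw [this, add_mul, mul_add, hf.2, hg.2]
    | monomial n a hf =>
      have e1 : Polynomial.aeval C (Polynomial.C a * Polynomial.X ^ (n + 1)) =
          Polynomial.aeval C (Polynomial.C a * Polynomial.X ^ n) * C := by
        rw [pow_succ, ← mul_assoc, map_mul _ _ Polynomial.X, Polynomial.aeval_X]
      have e2 : Polynomial.aeval C (Polynomial.C a * Polynomial.X ^ n) * C =
          C * Polynomial.aeval C (Polynomial.C a * Polynomial.X ^ n) := by
        have := congrArg (Polynomial.aeval C)
          (mul_comm (Polynomial.C a * Polynomial.X ^ n) Polynomial.X)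
        rwa [map_mul _ _ Polynomial.X, map_mul _ Polynomial.X, Polynomial.aeval_X] at this
      rw [e1]
      refine ⟨by simpa using hf.1.mul hg hChom, ?_⟩
      rw [AlgInvolution.conjTranspose_mul, mul_assoc, hf.2, ← mul_assoc, hCΦ, ← hΦC, mul_assoc, e2]
  have hWu : IsUnit (Polynomial.aeval C q) := by
    rw [← hq] at hCu
    exact ((Commute.refl _).isUnit_mul_iff.1 hCu).1
  obtain ⟨⟨W, V, h3, h4⟩, hW⟩ := hWu
  simp only at hW
  refine ⟨W, V, h3, h4, hW ▸ (key q).1, ?_⟩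
  rw [hW, (key q).2, mul_assoc, hq, hΦC]

/-- Two graded superalgebras with superinvolution which are presented by forms of the same degree
and parity in bases with the same multiplicities are isomorphic. -/
theorem IsPresentation.iso_of_card_eq [IsAlgClosed F] [NeZero (2 : F)] {g₀ : G × ZMod 2}
    {Φ' : Matrix κ κ c.D} {R' : GradedSuperinvAlgebra F G}
    {e' : R'.alg.carrier ≃ₐ[F] Matrix κ κ c.D} (h : IsPresentation c par γ Φ e)
    (h' : IsPresentation c par' γ' Φ' e') (hΦ : IsHermitianForm c par γ g₀ 1 Φ)
    (hΦ' : IsHermitianForm c par' γ' g₀ 1 Φ')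
    (hcard : ∀ a x, Nat.card {i // par i = a ∧ (γ i : G ⧸ E.T) = x} =
      Nat.card {j // par' j = a ∧ (γ' j : G ⧸ E.T) = x}) : R.Iso R' := by
  obtain ⟨W, V, h1, h2, h3⟩ := exists_changeBasis_of_card_eq c hcard
  have h4 := h.changeBasis h1 h2 h3
  have h5 := hΦ.changeBasis h1 h2 h3
  rw [one_pow, one_mul] at h5
  obtain ⟨W', V', h1', h2', h3', h6⟩ := h5.exists_changeBasis hΦ'
  have h7 := h4.changeBasis h1' h2' h3'
  rw [h6] at h7
  exact h7.iso h' hΦ'.isUnit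

end Equivalence

/-! ### Presentations of the models -/

section ModelPresentation

variable {F : Type u} [Field F] {G : Type v} [CommGroup G]

theorem card_basisIndex {α : Type v} (κ : α →₀ ℕ) (x : α) :
    Nat.card {b : BasisIndex κ // (b.1 : α) = x} = κ x := by
  have hx : ∀ k : Fin (κ x), x ∈ κ.support := fun k =>
    Finsupp.mem_support_iff.2 (by have := k.2; omega)
  let f : Fin (κ x) → {b : BasisIndex κ // (b.1 : α) = x} := fun k => ⟨⟨⟨x, hx k⟩, k⟩, rfl⟩
  rw [← Nat.card_eq_of_bijective f, Nat.card_fin]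
  constructor
  · intro k l h
    simpa [f] using h
  · rintro ⟨⟨⟨y, hy⟩, k⟩, rfl⟩
    exact ⟨k, rfl⟩

theorem zmod_two_eq_one {a : ZMod 2} (h : a ≠ 0) : a = 1 := by
  revert a; decide

/-- Even and odd models are put on the same footing here. Afterwards only the multiplicities and the
degree and parity of the form matter, and the explicit matrices play no role. -/
theorem ModelParams.exists_presentation [NeZero (2 : F)] {c : ∀ E : BicharPair F G, E.Choice}
    (P : ModelParams F G c) : ∃ (ι : Type v) (_ : Fintype ι) (_ : DecidableEq ι)
      (par : ι → ZMod 2) (γ : ι → G) (Φ : Matrix ι ι (c P.base).D)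
      (e : P.model.alg.carrier ≃ₐ[F] Matrix ι ι (c P.base).D),
      IsPresentation (c P.base) par γ Φ e ∧ IsHermitianForm (c P.base) par γ P.g₀ 1 Φ ∧
      ∀ a x, Nat.card {i // par i = a ∧ (γ i : G ⧸ P.base.T) = x} = P.κ a x := by
  classical
  by_cases hp : P.g₀.2 = 0
  · rw [ModelParams.model, dif_pos hp]
    refine ⟨_, _, _, _, _, _, _, matrixGraded_isPresentation
      (evenForm_superHermitian (c P.base) P.admissible hp)
      (evenForm_homogeneous (c P.base) P.admissible hp),
      (evenForm_superHermitian (c P.base) P.admissible hp).hermitianForm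
        (evenForm_homogeneous (c P.base) P.admissible hp).mem, fun a x => ?_⟩
    rw [← card_basisIndex]
    refine (Nat.card_congr ?_).symm
    exact
      { toFun := fun b => ⟨⟨a, b.1⟩, rfl, ((c P.base).mk_ξ _).trans b.2⟩
        invFun := fun b => ⟨b.2.1 ▸ b.1.2, by
          obtain ⟨⟨i, b⟩, rfl, h⟩ := b
          exact ((c P.base).mk_ξ _).symm.trans h⟩
        left_inv := fun b => rfl
        right_inv := by
          rintro ⟨⟨i, b⟩, rfl, h⟩
          rfl }
  · have hp1 := zmod_two_eq_one hp
    rw [ModelParams.model, dif_neg hp]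
    have h1 := (oddForm_superHermitian (c P.base) (P.κ 0)).hermitianForm
      (oddForm_homogeneous (c P.base) (P.κ 0) P.g₀.1).mem
    have hg : (P.g₀.1, (1 : ZMod 2)) = P.g₀ := by rw [← hp1]
    rw [hg] at h1
    refine ⟨_, _, _, _, _, _, _, matrixGraded_isPresentation
      (oddForm_superHermitian (c P.base) (P.κ 0))
      (oddForm_homogeneous (c P.base) (P.κ 0) P.g₀.1), h1, fun a x => ?_⟩
    by_cases ha : a = 0
    · subst ha
      rw [← card_basisIndex]
      refine (Nat.card_congr ?_).symm
      exact
        { toFun := fun b => ⟨Sum.inl b.1, rfl, ((c P.base).mk_ξ _).trans b.2⟩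
          invFun := fun b => match b with
            | ⟨Sum.inl b, h⟩ => ⟨b, ((c P.base).mk_ξ _).symm.trans h.2⟩
            | ⟨Sum.inr b, h⟩ => absurd h.1 (by simp)
          left_inv := fun b => rfl
          right_inv := by
            rintro ⟨b | b, h⟩
            · rfl
            · exact absurd h.1 (by simp) }
    · obtain rfl := zmod_two_eq_one ha
      obtain ⟨g, rfl⟩ := QuotientGroup.mk_surjective x
      -- The odd model is built from `κ 0` alone; admissibility identifies the multiplicities of the
      -- dual basis with `κ 1`.
      rw [P.admissible.2 hp1 g, ← card_basisIndex]
      have key : ∀ y : G ⧸ P.base.T, ((P.g₀.1⁻¹ * ((c P.base).ξ y)⁻¹ : G) : G ⧸ P.base.T) = g ↔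
          y = ((P.g₀.1⁻¹ * g⁻¹ : G) : G ⧸ P.base.T) := by
        intro y
        rw [coset_dual _ _ ((c P.base).mk_ξ y), coset_dual _ _ rfl]
        constructor
        · intro h; rw [← h]; simp
        · rintro rfl; simp
      refine (Nat.card_congr ?_).symm
      exact
        { toFun := fun b => ⟨Sum.inr b.1, rfl, (key _).2 b.2⟩
          invFun := fun b => match b with
            | ⟨Sum.inr b, h⟩ => ⟨b, (key _).1 h.2⟩
            | ⟨Sum.inl b, h⟩ => absurd h.1 (by simp)
          left_inv := fun b => rfl
          right_inv := by
            rintro ⟨b | b, h⟩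
            · exact absurd h.1 (by simp)
            · rfl }

theorem IsPresentation.iso_model [IsAlgClosed F] [NeZero (2 : F)]
    {c : ∀ E : BicharPair F G, E.Choice}
    (P : ModelParams F G c) {ι : Type*} [Fintype ι] [DecidableEq ι] {par : ι → ZMod 2} {γ : ι → G}
    {Φ : Matrix ι ι (c P.base).D} {R : GradedSuperinvAlgebra.{u, w} F G}
    {e : R.alg.carrier ≃ₐ[F] Matrix ι ι (c P.base).D} (h : IsPresentation (c P.base) par γ Φ e)
    (hΦ : IsHermitianForm (c P.base) par γ P.g₀ 1 Φ)
    (hcard : ∀ a x, Nat.card {i // par i = a ∧ (γ i : G ⧸ P.base.T) = x} = P.κ a x) :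
    R.Iso P.model := by
  obtain ⟨ι', _, _, par', γ', Φ', e', h', hΦ', hcard'⟩ := P.exists_presentation
  exact h.iso_of_card_eq h' hΦ hΦ' fun a x => (hcard a x).trans (hcard' a x).symm

/-- A form gives rise to admissible multiplicities. -/
theorem IsHermitianForm.exists_admissible [NeZero (2 : F)] {E : BicharPair F G} {c : E.Choice}
    {ι : Type*} [Fintype ι] [DecidableEq ι] [Nonempty ι] {par : ι → ZMod 2} {γ : ι → G}
    {Φ : Matrix ι ι c.D} {g₀ : G × ZMod 2} (h : IsHermitianForm c par γ g₀ 1 Φ) :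
    ∃ κ : ZMod 2 → (G ⧸ E.T →₀ ℕ), κ ≠ 0 ∧ IsAdmissible c κ g₀ ∧
      ∀ a x, Nat.card {i // par i = a ∧ (γ i : G ⧸ E.T) = x} = κ a x := by
  classical
  let κ : ZMod 2 → (G ⧸ E.T →₀ ℕ) := fun a => Finsupp.onFinset
    (Finset.univ.image fun i => (γ i : G ⧸ E.T))
    (fun x => Nat.card {i // par i = a ∧ (γ i : G ⧸ E.T) = x}) (by
      intro x hx
      have := (Nat.card_ne_zero.1 hx).1
      obtain ⟨i, -, hi⟩ := this.some
      exact Finset.mem_image.2 ⟨i, Finset.mem_univ _, hi⟩)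
  have hκ : ∀ a x, κ a x = Nat.card {i // par i = a ∧ (γ i : G ⧸ E.T) = x} := fun a x => rfl
  refine ⟨κ, ?_, ⟨fun hp => ⟨fun a g => ?_, fun a g hg hη => ?_⟩, fun hp g => ?_⟩,
    fun a x => (hκ a x).symm⟩
  · intro h0
    obtain ⟨i⟩ := ‹Nonempty ι›
    have h1 : κ (par i) (γ i : G ⧸ E.T) ≠ 0 := by
      rw [hκ, Nat.card_ne_zero]
      exact ⟨⟨⟨i, rfl, rfl⟩⟩, inferInstance⟩
    rw [h0] at h1
    exact h1 rfl
  · rw [hκ, hκ, h.card_eq, hp, add_zero]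
  · rw [hκ]
    exact h.even_card hp a g hg hη
  · rw [hκ, hκ, h.card_eq, hp]
    rfl

/-- The choices `c`, and hence `D`, depend on the whole structure `base`. Its equality is needed so
that it can be substituted before forms are compared. -/
theorem ModelParams.base_eq {c : ∀ E : BicharPair F G, E.Choice} (P P' : ModelParams F G c)
    (hT : P.base.T = P'.base.T)
    (hβ : ∀ (s t : G) (hs : s ∈ P.base.T) (ht : t ∈ P.base.T),
      P.base.β ⟨s, hs⟩ ⟨t, ht⟩ = P'.base.β ⟨s, hT ▸ hs⟩ ⟨t, hT ▸ ht⟩) : P.base = P'.base := by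
  obtain ⟨⟨T, _, _, β, _, _⟩, _, _, _, _⟩ := P
  obtain ⟨⟨T', _, _, β', _, _⟩, _, _, _, _⟩ := P'
  simp only at hT
  subst hT
  have : β = β' := by
    ext s t
    exact congrArg Units.val (hβ s t s.2 t.2)
  subst this
  rfl

/-- Translating the multiplicities and changing the degree of the form accordingly gives an
isomorphic model. -/
theorem ModelParams.iso_of_translate [IsAlgClosed F] [NeZero (2 : F)]
    {c : ∀ E : BicharPair F G, E.Choice} (P P' : ModelParams F G c)
    (hT : P.base.T = P'.base.T)
    (hβ : ∀ (s t : G) (hs : s ∈ P.base.T) (ht : t ∈ P.base.T),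
      P.base.β ⟨s, hs⟩ ⟨t, ht⟩ = P'.base.β ⟨s, hT ▸ hs⟩ ⟨t, hT ▸ ht⟩) (g : G)
    (hκ : ∀ (i : ZMod 2) (x : G),
      P'.κ i (x : G ⧸ P'.base.T) = P.κ i ((g⁻¹ * x : G) : G ⧸ P.base.T))
    (hg : P'.g₀ = ((g ^ 2)⁻¹ * P.g₀.1, P.g₀.2)) : P.model.Iso P'.model := by
  have hbase := P.base_eq P' hT hβ
  obtain ⟨ι, _, _, par, γ, Φ, e, h, hΦ, hcard⟩ := P.exists_presentation
  have h1 := h.shift g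
  have hΦ1 := hΦ.shift g
  rw [← hg] at hΦ1
  clear hβ hg h hΦ
  obtain ⟨E', κ', g₀', h0', hadm'⟩ := P'
  simp only at hbase
  subst hbase
  refine h1.iso_model ⟨P.base, κ', g₀', h0', hadm'⟩ hΦ1 fun a x => ?_
  obtain ⟨x, rfl⟩ := QuotientGroup.mk_surjective x
  rw [hκ a x, ← hcard]
  refine Nat.card_congr (Equiv.subtypeEquivRight fun i => and_congr Iff.rfl ?_)
  rw [QuotientGroup.mk_mul, QuotientGroup.mk_mul, QuotientGroup.mk_inv, eq_inv_mul_iff_mul_eq]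

end ModelPresentation

/-! ### Graded-division idempotents -/

section GradedDivision

variable {F : Type*} [Field F] {R : Type*} [Ring R] [Algebra F R] {H : Type*} [CommGroup H]

/-- A grading of an algebra. -/
structure IsAlgGrading (𝒜 : H → Submodule F R) : Prop where
  indep : iSupIndep 𝒜
  iSup_eq_top : ⨆ h, 𝒜 h = ⊤
  mul_mem : ∀ {g h : H} {a b : R}, a ∈ 𝒜 g → b ∈ 𝒜 h → a * b ∈ 𝒜 (g * h)

/-- The product of two nonzero ideals is nonzero. -/
def IsPrimeRing (R : Type*) [Ring R] : Prop := ∀ a b : R, (∀ x, a * x * b = 0) → a = 0 ∨ b = 0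

/-- An idempotent `e` of trivial degree such that the nonzero homogeneous elements of `e R e` are
invertible. -/
structure IsGradedDivIdem (𝒜 : H → Submodule F R) (e : R) : Prop where
  ne_zero : e ≠ 0
  idem : e * e = e
  mem : e ∈ 𝒜 1
  exists_inv : ∀ h x, x ∈ 𝒜 h → e * x = x → x * e = x → x ≠ 0 →
    ∃ y ∈ 𝒜 h⁻¹, e * y = y ∧ y * e = y ∧ y * x = e ∧ x * y = e

variable {𝒜 : H → Submodule F R}

theorem IsPrimeRing.exists_homogeneous (hR : IsPrimeRing R) (h𝒜 : ⨆ h, 𝒜 h = ⊤) {a b : R}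
    (ha : a ≠ 0) (hb : b ≠ 0) : ∃ h, ∃ x ∈ 𝒜 h, a * x * b ≠ 0 := by
  by_contra! hcon
  rcases hR a b (mem_iSup_induction h𝒜 hcon (by simp) fun x y hx hy => by
    rw [mul_add, add_mul, hx, hy, add_zero]) with h | h
  · exact ha h
  · exact hb h

/-- The homogeneous idempotents `e` and `f` are equivalent by means of homogeneous elements. -/
structure IsLink (𝒜 : H → Submodule F R) (e f : R) (s : H) (a b : R) : Prop where
  mem : a ∈ 𝒜 s
  mem' : b ∈ 𝒜 s⁻¹
  left : f * a = a
  right : a * e = a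
  left' : e * b = b
  right' : b * f = b
  mul : b * a = e
  mul' : a * b = f

/-- By primeness there are homogeneous `x`, `y` with `e y f x e ≠ 0`. This element is invertible in
the corner of `e`, so `a = f x e` has a left inverse `b`. Then `a b` is a nonzero homogeneous
idempotent in the graded-division corner of `f`, hence equal to `f`. -/
theorem IsGradedDivIdem.exists_link (hR : IsPrimeRing R) (h𝒜 : IsAlgGrading 𝒜) {e f : R}
    (he : IsGradedDivIdem 𝒜 e) (hf : IsGradedDivIdem 𝒜 f) : ∃ s a b, IsLink 𝒜 e f s a b := by
  obtain ⟨s, x, hx, hx0⟩ := hR.exists_homogeneous h𝒜.iSup_eq_top hf.ne_zero he.ne_zero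
  set a := f * x * e with ha
  have hfa : f * a = a := by rw [ha, ← mul_assoc, ← mul_assoc, hf.idem]
  have hae : a * e = a := by rw [ha, mul_assoc, he.idem]
  have has : a ∈ 𝒜 s := by
    simpa using h𝒜.mul_mem (h𝒜.mul_mem hf.mem hx) he.mem
  obtain ⟨k, y, hy, hy0⟩ := hR.exists_homogeneous h𝒜.iSup_eq_top he.ne_zero hx0
  have hz : e * y * a ∈ 𝒜 (k * s) := by
    simpa using h𝒜.mul_mem (h𝒜.mul_mem he.mem hy) has
  obtain ⟨w, hw, hw1, hw2, hw3, -⟩ := he.exists_inv _ _ hz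
    (by rw [mul_assoc, ← mul_assoc e e, he.idem]) (by rw [mul_assoc, hae]) hy0
  have hbs : w * (e * y * f) ∈ 𝒜 s⁻¹ := by
    have := h𝒜.mul_mem hw (h𝒜.mul_mem (h𝒜.mul_mem he.mem hy) hf.mem)
    simpa using this
  have hba : w * (e * y * f) * a = e := by
    rw [mul_assoc, mul_assoc _ f, hfa, hw3]
  have heb : e * (w * (e * y * f)) = w * (e * y * f) := by rw [← mul_assoc, hw1]
  have hbf : w * (e * y * f) * f = w * (e * y * f) := by rw [mul_assoc, mul_assoc _ f, hf.idem]
  set b := w * (e * y * f) with hb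
  refine ⟨s, a, b, has, hbs, hfa, hae, heb, hbf, hba, ?_⟩
  have h0 : a * b ≠ 0 := by
    intro h0
    apply he.ne_zero
    rw [← he.idem]
    nth_rewrite 1 [← hba]
    rw [← hba, mul_assoc, ← mul_assoc a, h0, zero_mul, mul_zero]
  obtain ⟨u, -, -, -, hu, -⟩ := hf.exists_inv 1 (a * b) (by simpa using h𝒜.mul_mem has hbs)
    (by rw [← mul_assoc f, hfa]) (by rw [mul_assoc, hbf]) h0
  calc a * b = f * (a * b) := by rw [← mul_assoc f, hfa]
    _ = u * (a * b * (a * b)) := by rw [← hu, mul_assoc]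
    _ = u * (a * b) := by rw [mul_assoc, ← mul_assoc b, hba, heb]
    _ = f := hu

theorem isPrimeRing_matrix {D ι : Type*} [Ring D] [Fintype ι] [DecidableEq ι] (hD : IsPrimeRing D) :
    IsPrimeRing (Matrix ι ι D) := by
  intro a b h
  by_contra! hcon
  obtain ⟨ha, hb⟩ := hcon
  obtain ⟨i, j, hij⟩ : ∃ i j, a i j ≠ 0 := by
    by_contra! h1; exact ha (Matrix.ext h1)
  obtain ⟨k, l, hkl⟩ : ∃ k l, b k l ≠ 0 := by
    by_contra! h1; exact hb (Matrix.ext h1)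
  rcases hD (a i j) (b k l) (fun d => by
    have h1 := congrFun (congrFun (h (Matrix.single j k d)) i) l
    rw [Matrix.mul_assoc, Matrix.mul_apply, Finset.sum_eq_single j] at h1
    · simpa [mul_assoc] using h1
    · intro m _ hm; simp [hm]
    · simp) with h1 | h1
  · exact hij h1
  · exact hkl h1

theorem isPrimeRing_field (F : Type*) [Field F] : IsPrimeRing F := fun a b h => by
  simpa using h 1

theorem isPrimeRing_of_equiv {S : Type*} [Ring S] (e : R ≃+* S) (hS : IsPrimeRing S) :
    IsPrimeRing R := by
  intro a b h
  have := hS (e a) (e b) (fun x => by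
    obtain ⟨x, rfl⟩ := e.surjective x
    rw [← map_mul, ← map_mul, h, map_zero])
  simpa using this

theorem iSupIndep_of_projections {M : Type*} [AddCommGroup M] [Module F M] {I : Type*}
    {ℬ : I → Submodule F M} (π : I → M →ₗ[F] M) (h1 : ∀ i x, x ∈ ℬ i → π i x = x)
    (h2 : ∀ i j x, x ∈ ℬ j → j ≠ i → π i x = 0) : iSupIndep ℬ := by
  intro i
  rw [Submodule.disjoint_def]
  intro x hx hx'
  have h3 : (⨆ j, ⨆ (_ : j ≠ i), ℬ j) ≤ (π i).ker :=
    iSup₂_le fun j hj x hx => h2 i j x hx hj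
  rw [← h1 i x hx]
  exact h3 hx'

end GradedDivision

/-! ### The grading refined by parity, and the diagonal idempotents of a presentation. -/

section SuperComp

variable {F : Type u} [Field F] {G : Type v} [CommGroup G]

/-- The components of a graded superalgebra, with respect to the degree and the parity. -/
def GradedSuperinvAlgebra.superComp (R : GradedSuperinvAlgebra.{u, w} F G)
    (h : G × Multiplicative (ZMod 2)) : Submodule F R.alg.carrier :=
  R.grading.comp h.1 ⊓ R.alg.part h.2.toAdd

theorem GradedSuperinvAlgebra.isAlgGrading (R : GradedSuperinvAlgebra.{u, w} F G) :
    IsAlgGrading R.superComp where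
  indep := by
    obtain ⟨π, -, π2, π3⟩ := exists_projections R.grading.indep R.grading.iSup_eq_top
    obtain ⟨ρ, -, ρ2, ρ3⟩ := exists_projections (iSupIndep_of_isCompl R.alg.isCompl_part)
      (iSup_eq_top_of_isCompl R.alg.isCompl_part)
    refine iSupIndep_of_projections (fun h => π h.1 ∘ₗ ρ h.2.toAdd) ?_ ?_
    · rintro h x ⟨hx1, hx2⟩
      rw [LinearMap.comp_apply, ρ2 _ _ hx2, π2 _ _ hx1]
    · rintro h k x ⟨hx1, hx2⟩ hne
      rw [LinearMap.comp_apply]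
      by_cases h2 : k.2.toAdd = h.2.toAdd
      · rw [ρ2 _ _ (h2 ▸ hx2)]
        refine π3 _ _ _ hx1 fun h1 => hne (Prod.ext h1 h2)
      · rw [ρ3 _ _ _ hx2 h2, map_zero]
  iSup_eq_top := by
    rw [eq_top_iff, ← R.grading.iSup_eq_top]
    refine iSup_le fun g x hx => ?_
    obtain ⟨a, ha, b, hb, rfl⟩ := R.grading.part_compat g x hx
    exact add_mem (Submodule.mem_iSup_of_mem (g, Multiplicative.ofAdd 0) ha)
      (Submodule.mem_iSup_of_mem (g, Multiplicative.ofAdd 1) hb)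
  mul_mem ha hb := ⟨R.grading.mul_mem ha.1 hb.1, R.alg.mul_mem_part ha.2 hb.2⟩

/-- Nondegeneracy embeds `T` in its character group. The two have the same order because `F`
contains `-1 ≠ 1` and `T` has exponent dividing 2. The lemma lets any character be removed by
conjugation with some `X_s`. -/
theorem BicharPair.exists_eq_β [NeZero (2 : F)] (E : BicharPair F G) (χ : E.T →* Fˣ) :
    ∃ s, ∀ t, χ t = E.β s t := by
  have h2 : HasEnoughRootsOfUnity F 2 :=
    { prim := ⟨-1, IsPrimitiveRoot.neg_one (ringChar F) (by
        intro h
        have : CharP F 2 := h ▸ ringChar.charP F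
        exact NeZero.ne (2 : F) (CharTwo.two_eq_zero))⟩
      cyc := inferInstance }
  have hexp : Monoid.exponent E.T ∣ 2 := by
    rw [Monoid.exponent_dvd_iff_forall_pow_eq_one]
    intro t
    rw [pow_two, E.mul_self]
  have : HasEnoughRootsOfUnity F (Monoid.exponent E.T) := HasEnoughRootsOfUnity.of_dvd F hexp
  have hinj : Function.Injective E.β := by
    rw [injective_iff_map_eq_one]
    intro t ht
    exact E.nondegenerate t fun s => by rw [ht]; rfl
  have hcard : Nat.card E.T = Nat.card (E.T →* Fˣ) :=
    (CommGroup.card_monoidHom_of_hasEnoughRootsOfUnity E.T F).symm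
  have : Finite (E.T →* Fˣ) := Nat.finite_of_card_ne_zero (hcard ▸ Nat.card_pos.ne')
  obtain ⟨s, hs⟩ := ((Nat.bijective_iff_injective_and_card E.β).2 ⟨hinj, hcard⟩).2 χ
  exact ⟨s, fun t => by rw [hs]⟩

variable {E : BicharPair F G}

theorem BicharPair.Choice.X_mul_comm (c : E.Choice) (s t : E.T) :
    c.X s * c.X t = ((E.β s t : Fˣ) : F) • (c.X t * c.X s) := by
  rw [X_mul_X, X_mul_X, smul_smul, mul_comm t s]
  congr 1
  conv_rhs => rw [← c.fstA_mul_sndB s, ← c.fstA_mul_sndB t]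
  have h1 := (c.eq_of_mul (c.fstA_mem s) (c.sndB_mem s) rfl)
  have h2 := (c.eq_of_mul (c.fstA_mem t) (c.sndB_mem t) rfl)
  rw [h1.1, h2.2]
  simp only [map_mul, MonoidHom.mul_apply, c.β_A _ (c.fstA_mem s) _ (c.fstA_mem t),
    c.β_B _ (c.sndB_mem s) _ (c.sndB_mem t), one_mul, mul_one]
  rw [← Units.val_mul, E.β_comm (c.fstA t)]
  congr 1
  rw [mul_assoc, E.β_mul_self, mul_one]

theorem BicharPair.Choice.isPrimeRing (c : E.Choice) : IsPrimeRing c.D :=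
  isPrimeRing_matrix (isPrimeRing_field F)

section

variable {c : E.Choice} {ι : Type*} [Fintype ι] [DecidableEq ι] {par : ι → ZMod 2} {γ : ι → G}
  {Φ : Matrix ι ι c.D} {R : GradedSuperinvAlgebra.{u, w} F G}
  {e : R.alg.carrier ≃ₐ[F] Matrix ι ι c.D}

theorem IsPresentation.isPrimeRing (_ : IsPresentation c par γ Φ e) : IsPrimeRing R.alg.carrier :=
  isPrimeRing_of_equiv e.toRingEquiv (isPrimeRing_matrix c.isPrimeRing)

theorem IsPresentation.single_mem (h : IsPresentation c par γ Φ e) {g : G} {d : c.D}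
    (hd : d ∈ c.comp g) (i j : ι) : e.symm (Matrix.single i j d) ∈
      R.superComp (γ i * g * (γ j)⁻¹, Multiplicative.ofAdd (par i + par j)) := by
  constructor
  · refine h.comp_iff.2 ?_
    rw [ AlgEquiv.apply_symm_apply]
    intro k l
    rw [Matrix.single_apply]
    split_ifs with hkl
    · obtain ⟨rfl, rfl⟩ := hkl
      convert hd using 2
      group
    · exact zero_mem _
  · refine h.part_iff.2 ?_
    rw [AlgEquiv.apply_symm_apply]
    intro k l hkl
    rw [Matrix.single_apply, if_neg]
    rintro ⟨rfl, rfl⟩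
    exact hkl rfl

theorem IsPresentation.single_mem_diag (h : IsPresentation c par γ Φ e) {g : G} {d : c.D}
    (hd : d ∈ c.comp g) (i : ι) : e.symm (Matrix.single i i d) ∈ R.superComp (g, 1) := by
  have h1 := h.single_mem hd i i
  rwa [CharTwo.add_self_eq_zero, mul_right_comm, mul_inv_cancel, one_mul] at h1

theorem IsPresentation.single_mul (_ : IsPresentation c par γ Φ e) (i j k : ι) (d d' : c.D) :
    e.symm (Matrix.single i j d) * e.symm (Matrix.single j k d') =
      e.symm (Matrix.single i k (d * d')) := by
  rw [← map_mul, Matrix.single_mul_single_same]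

theorem IsPresentation.exists_eq_single (h : IsPresentation c par γ Φ e) (i : ι)
    {k : G × Multiplicative (ZMod 2)} {x : R.alg.carrier} (hx : x ∈ R.superComp k)
    (h1 : e.symm (Matrix.single i i 1) * x = x) (h2 : x * e.symm (Matrix.single i i 1) = x) :
    ∃ d ∈ c.comp k.1, x = e.symm (Matrix.single i i d) := by
  refine ⟨e x i i, ?_, ?_⟩
  · simpa [mul_right_comm] using h.comp _ _ hx.1 i i
  · apply e.injective
    rw [AlgEquiv.apply_symm_apply]
    conv_lhs => rw [← h1, ← h2]
    rw [map_mul, map_mul, AlgEquiv.apply_symm_apply, ← Matrix.mul_assoc]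
    simp

/-- The corner of a diagonal matrix unit is a copy of `D`, concentrated in even parity. Its nonzero
homogeneous elements are multiples of the `X_t`, whose squares are nonzero scalars. -/
theorem IsPresentation.isGradedDivIdem (h : IsPresentation c par γ Φ e) (i : ι) :
    IsGradedDivIdem R.superComp (e.symm (Matrix.single i i 1)) where
  ne_zero := by
    intro h0
    have h1 := congrFun (congrFun (congrArg e h0) i) i
    rw [AlgEquiv.apply_symm_apply, map_zero, Matrix.single_apply_same] at h1
    exact one_ne_zero h1
  idem := by rw [h.single_mul, one_mul]
  mem := h.single_mem_diag c.isInvolutionGrading.one_mem i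
  exists_inv := by
    intro k x hx h1 h2 h0
    obtain ⟨d, hd, rfl⟩ := h.exists_eq_single i hx h1 h2
    have hd0 : d ≠ 0 := by
      rintro rfl
      simp at h0
    have hk2 : k.2 = 1 := by
      by_contra hk
      have h3 := h.part _ _ hx.2 i i (by
        rw [CharTwo.add_self_eq_zero]
        exact fun h => hk h.symm)
      rw [AlgEquiv.apply_symm_apply, Matrix.single_apply_same] at h3
      exact hd0 h3
    have hk1 : k.1 ∈ E.T := by
      by_contra hk
      exact hd0 (c.eq_zero_of_mem_comp hk hd)
    obtain ⟨a, rfl⟩ := (c.mem_comp_iff' hk1).1 hd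
    set t : E.T := ⟨k.1, hk1⟩ with ht
    have ha : a ≠ 0 := by rintro rfl; simp at hd0
    have hk : k⁻¹ = (k.1, 1) := by
      refine Prod.ext ?_ ?_
      · exact congrArg Subtype.val (E.inv_eq t)
      · rw [Prod.snd_inv, hk2, inv_one]
    have h4 : (a * c.η t)⁻¹ • (a • (c.X t * c.X t)) = 1 := by
      rw [c.X_mul_self, smul_smul, smul_smul, mul_assoc,
        inv_mul_cancel₀ (mul_ne_zero ha (c.η_ne_zero t)), one_smul]
    refine ⟨e.symm (Matrix.single i i ((a * c.η t)⁻¹ • c.X t)), ?_, ?_, ?_, ?_, ?_⟩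
    · rw [hk]
      exact h.single_mem_diag (Submodule.smul_mem _ _ (c.X_mem t rfl)) i
    · rw [h.single_mul, one_mul]
    · rw [h.single_mul, mul_one]
    · rw [h.single_mul, smul_mul_assoc, mul_smul_comm, h4]
    · rw [h.single_mul, smul_mul_assoc, mul_smul_comm, smul_comm, h4]

end

end SuperComp

/-! ### Comparison of two presentations -/

section Comparison

theorem IsLink.symm {F : Type*} [Field F] {R : Type*} [Ring R] [Algebra F R] {H : Type*}
    [CommGroup H] {𝒜 : H → Submodule F R} {e f a b : R} {s : H} (h : IsLink 𝒜 e f s a b) :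
    IsLink 𝒜 f e s⁻¹ b a :=
  ⟨h.mem', (inv_inv s).symm ▸ h.mem, h.left', h.right', h.left, h.right, h.mul', h.mul⟩

/-- Since `b a = e`, conjugation by a link is multiplicative on the corner of `e`. -/
theorem IsLink.conj_mul {F : Type*} [Field F] {R : Type*} [Ring R] [Algebra F R] {H : Type*}
    [CommGroup H] {𝒜 : H → Submodule F R} {e f a b : R} {s : H} (h : IsLink 𝒜 e f s a b)
    (x y : R) (hx : x * e = x) : a * x * b * (a * y * b) = a * (x * y) * b := by
  calc a * x * b * (a * y * b) = a * (x * (b * a) * y) * b := by simp only [mul_assoc]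
    _ = _ := by rw [h.mul, hx]

variable {F : Type u} [Field F] {G : Type v} [CommGroup G] {E₁ E₂ : BicharPair F G}
  {c₁ : E₁.Choice} {c₂ : E₂.Choice}
  {ι : Type*} [Fintype ι] [DecidableEq ι] {κ : Type*} [Fintype κ] [DecidableEq κ]
  {par : ι → ZMod 2} {γ : ι → G} {par' : κ → ZMod 2} {γ' : κ → G}
  {Φ₁ : Matrix ι ι c₁.D} {Φ₂ : Matrix κ κ c₂.D}
  {R : GradedSuperinvAlgebra.{u, w} F G} {e₁ : R.alg.carrier ≃ₐ[F] Matrix ι ι c₁.D}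
  {e₂ : R.alg.carrier ≃ₐ[F] Matrix κ κ c₂.D} {i₀ : ι} {k₀ : κ} {s : G × Multiplicative (ZMod 2)}
  {a b : R.alg.carrier}

/-- Conjugation by a link preserves degrees, as those of `a` and `b` cancel, and it is injective on
the corner. So the image of `X_t` spans the degree-`t` component of the other corner, which forces
`t` into its support. -/
theorem IsPresentation.link_X (h₁ : IsPresentation c₁ par γ Φ₁ e₁)
    (h₂ : IsPresentation c₂ par' γ' Φ₂ e₂)
    (L : IsLink R.superComp (e₁.symm (Matrix.single i₀ i₀ 1)) (e₂.symm (Matrix.single k₀ k₀ 1))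
      s a b) (t : E₁.T) : ∃ (ht : (t : G) ∈ E₂.T) (x : F), x ≠ 0 ∧
      a * e₁.symm (Matrix.single i₀ i₀ (c₁.X t)) * b =
        e₂.symm (Matrix.single k₀ k₀ (x • c₂.X ⟨t, ht⟩)) := by
  have hm : a * e₁.symm (Matrix.single i₀ i₀ (c₁.X t)) * b ∈ R.superComp ((t : G), 1) := by
    have := R.isAlgGrading.mul_mem (R.isAlgGrading.mul_mem L.mem
      (h₁.single_mem_diag (c₁.X_mem t rfl) i₀)) L.mem'
    rwa [mul_right_comm, mul_inv_cancel, one_mul] at this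
  obtain ⟨d, hd, hd'⟩ := h₂.exists_eq_single k₀ hm (by rw [← mul_assoc, ← mul_assoc, L.left])
    (by rw [mul_assoc, L.right'])
  have hd0 : d ≠ 0 := by
    rintro rfl
    have h3 := congrArg (fun z => b * z * a) hd'
    simp only [Matrix.single_zero, map_zero, mul_zero, zero_mul] at h3
    have h4 : b * (a * e₁.symm (Matrix.single i₀ i₀ (c₁.X t)) * b) * a =
        (b * a) * e₁.symm (Matrix.single i₀ i₀ (c₁.X t)) * (b * a) := by simp only [mul_assoc]
    rw [h4, L.mul, h₁.single_mul, h₁.single_mul, one_mul, mul_one] at h3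
    have h5 := congrFun (congrFun (congrArg e₁ h3) i₀) i₀
    rw [AlgEquiv.apply_symm_apply, map_zero, Matrix.single_apply_same] at h5
    exact c₁.X_ne_zero t h5
  have ht : (t : G) ∈ E₂.T := by
    by_contra ht
    exact hd0 (c₂.eq_zero_of_mem_comp ht hd)
  obtain ⟨x, rfl⟩ := (c₂.mem_comp_iff' ht).1 hd
  exact ⟨ht, x, fun h => hd0 (by rw [h, zero_smul]), hd'⟩

theorem IsPresentation.le_of_link (h₁ : IsPresentation c₁ par γ Φ₁ e₁)
    (h₂ : IsPresentation c₂ par' γ' Φ₂ e₂)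
    (L : IsLink R.superComp (e₁.symm (Matrix.single i₀ i₀ 1)) (e₂.symm (Matrix.single k₀ k₀ 1))
      s a b) : E₁.T ≤ E₂.T := fun t ht =>
  (h₁.link_X h₂ L ⟨t, ht⟩).1

/-- The unknown scalars occur symmetrically in both orders of a product, so they drop out of the
commutation relation. -/
theorem IsPresentation.β_eq_of_link (h₁ : IsPresentation c₁ par γ Φ₁ e₁)
    (h₂ : IsPresentation c₂ par' γ' Φ₂ e₂)
    (L : IsLink R.superComp (e₁.symm (Matrix.single i₀ i₀ 1)) (e₂.symm (Matrix.single k₀ k₀ 1))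
      s a b) (q r : G) (hq : q ∈ E₁.T) (hr : r ∈ E₁.T) (hq' : q ∈ E₂.T) (hr' : r ∈ E₂.T) :
    E₁.β ⟨q, hq⟩ ⟨r, hr⟩ = E₂.β ⟨q, hq'⟩ ⟨r, hr'⟩ := by
  obtain ⟨_, x, hx, h3⟩ := h₁.link_X h₂ L ⟨q, hq⟩
  obtain ⟨_, y, hy, h4⟩ := h₁.link_X h₂ L ⟨r, hr⟩
  have key : ∀ d d' : c₁.D, a * e₁.symm (Matrix.single i₀ i₀ d) * b *
      (a * e₁.symm (Matrix.single i₀ i₀ d') * b) =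
        a * e₁.symm (Matrix.single i₀ i₀ (d * d')) * b := by
    intro d d'
    rw [L.conj_mul _ _ (by rw [h₁.single_mul, mul_one]), h₁.single_mul]
  have h5 := key (c₁.X ⟨q, hq⟩) (c₁.X ⟨r, hr⟩)
  have h6 := key (c₁.X ⟨r, hr⟩) (c₁.X ⟨q, hq⟩)
  rw [c₁.X_mul_comm, ← Matrix.smul_single, map_smul, mul_smul_comm, smul_mul_assoc, ← h6, h3, h4,
    h₂.single_mul, h₂.single_mul, ← map_smul, Matrix.smul_single] at h5
  have h7 := congrFun (congrFun (e₂.symm.injective h5) k₀) k₀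
  rw [Matrix.single_apply_same, Matrix.single_apply_same, smul_mul_smul_comm, smul_mul_smul_comm,
    c₂.X_mul_comm, smul_smul, smul_smul] at h7
  have h8 : c₂.X ⟨r, hr'⟩ * c₂.X ⟨q, hq'⟩ ≠ 0 := ((c₂.isUnit_X _).mul (c₂.isUnit_X _)).ne_zero
  have h9 := smul_left_injective F h8 h7
  have h10 : x * y ≠ 0 := mul_ne_zero hx hy
  apply Units.ext
  apply mul_left_cancel₀ h10
  rw [h9]; ring

variable {E : BicharPair F G} {c : E.Choice} {Φ : Matrix ι ι c.D} {Φ' : Matrix κ κ c.D}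
  {e : R.alg.carrier ≃ₐ[F] Matrix ι ι c.D} {e' : R.alg.carrier ≃ₐ[F] Matrix κ κ c.D}

/-- The link between the two coordinate systems can be chosen to be the identity on `D`. -/
theorem IsPresentation.exists_link [NeZero (2 : F)] (h : IsPresentation c par γ Φ e)
    (h' : IsPresentation c par' γ' Φ' e') (i₀ : ι) (k₀ : κ) :
    ∃ s a b, IsLink R.superComp (e.symm (Matrix.single i₀ i₀ 1))
      (e'.symm (Matrix.single k₀ k₀ 1)) s a b ∧
      ∀ d, a * e.symm (Matrix.single i₀ i₀ d) * b = e'.symm (Matrix.single k₀ k₀ d) := by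
  obtain ⟨s, a, b, L⟩ := (h.isGradedDivIdem i₀).exists_link h.isPrimeRing R.isAlgGrading
    (h'.isGradedDivIdem k₀)
  choose ht x hx hX using fun t => h.link_X h' L t
  have hinj : ∀ d d', e'.symm (Matrix.single k₀ k₀ d) = e'.symm (Matrix.single k₀ k₀ d') →
      d = d' := by
    intro d d' hd
    have := congrFun (congrFun (e'.symm.injective hd) k₀) k₀
    rwa [Matrix.single_apply_same, Matrix.single_apply_same] at this
  -- Conjugation sends `X_t` to `x t • X_t`. Both corners have the same structure constants, so `x`
  -- is a character of `T`.
  have hmul : ∀ q r, x (q * r) = x q * x r := by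
    intro q r
    have h1 := L.conj_mul (e.symm (Matrix.single i₀ i₀ (c.X q)))
      (e.symm (Matrix.single i₀ i₀ (c.X r))) (by rw [h.single_mul, mul_one])
    rw [h.single_mul, c.X_mul_X, ← Matrix.smul_single, map_smul, mul_smul_comm, smul_mul_assoc,
      hX, hX, hX, h'.single_mul, ← map_smul, Matrix.smul_single] at h1
    have h2 := hinj _ _ h1
    rw [smul_mul_smul_comm, c.X_mul_X, smul_smul, smul_smul] at h2
    have h3 := smul_left_injective F (c.X_ne_zero (q * r)) h2
    have h4 : ((E.β (c.fstA r) (c.sndB q) : Fˣ) : F) ≠ 0 := Units.ne_zero _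
    apply mul_left_cancel₀ h4
    rw [← h3]; ring
  let χ' : E.T →* F :=
    { toFun := x
      map_one' := by
        have := hmul 1 1
        rw [mul_one] at this
        exact (mul_eq_left₀ (hx 1)).1 this.symm
      map_mul' := hmul }
  -- The character is `β(q, ·)`, which is also how conjugation by `X_q` acts. Multiplying the link
  -- by `X_q` cancels it, at the cost of changing its degree by `q`.
  obtain ⟨q, hq⟩ := E.exists_eq_β χ'.toHomUnits
  have hq' : ∀ t, x t = E.β q t := fun t => congrArg Units.val (hq t)
  set y := e'.symm (Matrix.single k₀ k₀ (c.X q)) with hy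
  set z := e'.symm (Matrix.single k₀ k₀ (c.η q • c.X q)) with hz
  have hyz : y * z = e'.symm (Matrix.single k₀ k₀ 1) := by
    rw [hy, hz, h'.single_mul, mul_smul_comm, c.X_mul_self, smul_smul, c.η_mul_self, one_smul]
  have hzy : z * y = e'.symm (Matrix.single k₀ k₀ 1) := by
    rw [hy, hz, h'.single_mul, smul_mul_assoc, c.X_mul_self, smul_smul, c.η_mul_self, one_smul]
  have hym : y ∈ R.superComp ((q : G), 1) := h'.single_mem_diag (c.X_mem q rfl) k₀
  have hzm : z ∈ R.superComp ((q : G), 1)⁻¹ := by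
    have hk : ((q : G), (1 : Multiplicative (ZMod 2)))⁻¹ = ((q : G), 1) := by
      refine Prod.ext ?_ ?_
      · exact congrArg Subtype.val (E.inv_eq q)
      · simp
    rw [hk]
    exact h'.single_mem_diag (Submodule.smul_mem _ _ (c.X_mem q rfl)) k₀
  refine ⟨((q : G), 1) * s, y * a, b * z, ⟨R.isAlgGrading.mul_mem hym L.mem, ?_, ?_, ?_, ?_, ?_, ?_,
    ?_⟩, ?_⟩
  · have := R.isAlgGrading.mul_mem L.mem' hzm
    rwa [mul_comm s⁻¹, ← mul_inv] at this
  · rw [hy, ← mul_assoc, h'.single_mul, one_mul]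
  · rw [mul_assoc, L.right]
  · rw [← mul_assoc, L.left']
  · rw [hz, mul_assoc, h'.single_mul, mul_one]
  · rw [mul_assoc, ← mul_assoc z, hzy, L.left, L.mul]
  · rw [mul_assoc, ← mul_assoc a, L.mul', hz, h'.single_mul, one_mul, hyz]
  · have key : ∀ t, y * a * e.symm (Matrix.single i₀ i₀ (c.X t)) * (b * z) =
        e'.symm (Matrix.single k₀ k₀ (c.X t)) := by
      intro t
      calc y * a * e.symm (Matrix.single i₀ i₀ (c.X t)) * (b * z)
          = y * (a * e.symm (Matrix.single i₀ i₀ (c.X t)) * b) * z := by simp only [mul_assoc]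
        _ = _ := by
          rw [hX, hy, hz, h'.single_mul, h'.single_mul]
          congr 2
          rw [mul_smul_comm (x t), c.X_mul_comm, smul_smul, hq', ← Units.val_mul, E.β_mul_self,
            Units.val_one, one_smul, mul_smul_comm, mul_assoc, c.X_mul_self, mul_smul_comm,
            smul_smul, c.η_mul_self, one_smul, mul_one]
    refine mem_iSup_induction c.isInvolutionGrading.iSup_eq_top ?_ (by simp) ?_
    · intro g d hd
      by_cases hg : g ∈ E.T
      · obtain ⟨r, rfl⟩ := (c.mem_comp_iff' hg).1 hd
        rw [← Matrix.smul_single, ← Matrix.smul_single, map_smul, map_smul, mul_smul_comm,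
          smul_mul_assoc, key]
      · rw [c.eq_zero_of_mem_comp hg hd]
        simp
    · intro d d' hd hd'
      rw [Matrix.single_add, Matrix.single_add, map_add, map_add, mul_add, add_mul, hd, hd']

/-- A graded version of the Skolem-Noether theorem. -/
theorem IsPresentation.exists_intertwiner [NeZero (2 : F)] [Nonempty ι] [Nonempty κ]
    (h : IsPresentation c par γ Φ e) (h' : IsPresentation c par' γ' Φ' e') :
    ∃ (W : Matrix κ ι c.D) (V : Matrix ι κ c.D) (s : G) (r : ZMod 2), W * V = 1 ∧ V * W = 1 ∧
      IsHomogMatrix c.comp γ' par' γ par s r W ∧ ∀ x, e' x * W = W * e x := by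
  obtain ⟨i₀⟩ := ‹Nonempty ι›
  obtain ⟨k₀⟩ := ‹Nonempty κ›
  obtain ⟨s, a, b, L, hL⟩ := h.exists_link h' i₀ k₀
  have hcol : ∀ x j k, k ≠ k₀ → e' (x * b) j k = 0 := by
    intro x j k hk
    rw [← L.right', ← mul_assoc, map_mul, AlgEquiv.apply_symm_apply]
    simp [hk]
  -- Right multiplication by `b` is an isomorphism of left `R`-modules from `R E_{i₀i₀}` to `R
  -- E'_{k₀k₀}`. The columns of `W` are the coordinates of the images of the basis elements `E_{i
  -- i₀}`, and `V` is built in the same way from `a`.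
  let W : Matrix κ ι c.D := Matrix.of fun j i => e' (e.symm (Matrix.single i i₀ 1) * b) j k₀
  let V : Matrix ι κ c.D := Matrix.of fun i j => e' (a * e.symm (Matrix.single i₀ i 1)) k₀ j
  refine ⟨W, V, (γ i₀)⁻¹ * s.1⁻¹ * γ' k₀, par i₀ + par' k₀ + s.2.toAdd, ?_, ?_, ?_, ?_⟩
  · have h1 : ∀ i, e' (e.symm (Matrix.single i i₀ 1) * b) * e' (a * e.symm (Matrix.single i₀ i 1)) =
        e' (e.symm (Matrix.single i i 1)) := by
      intro i
      rw [← map_mul, mul_assoc, ← mul_assoc b, L.mul, h.single_mul, h.single_mul, one_mul, one_mul]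
    have h2 : ∑ i, e.symm (Matrix.single i i 1) = 1 := by
      rw [← map_sum, ← map_one e.symm]
      congr 1
      exact Matrix.sum_single_one
    refine Matrix.ext fun j l => ?_
    rw [Matrix.mul_apply]
    have h3 := congrFun (congrFun (congrArg e' h2) j) l
    rw [map_one, map_sum, Matrix.sum_apply] at h3
    rw [← h3]
    refine Finset.sum_congr rfl fun i _ => ?_
    rw [← h1, Matrix.mul_apply, Finset.sum_eq_single k₀]
    · rfl
    · intro k _ hk; rw [hcol _ _ _ hk, zero_mul]
    · simp
  · refine Matrix.ext fun i l => ?_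
    have h1 : (V * W) i l = e' (a * e.symm (Matrix.single i₀ i 1) *
        (e.symm (Matrix.single l i₀ 1) * b)) k₀ k₀ := by
      rw [map_mul]
      rfl
    rw [h1]
    by_cases hil : i = l
    · subst hil
      rw [mul_assoc, ← mul_assoc (e.symm _), h.single_mul, mul_one, ← mul_assoc, hL,
        AlgEquiv.apply_symm_apply, Matrix.single_apply_same, Matrix.one_apply_eq]
    · rw [mul_assoc, ← mul_assoc (e.symm _), ← map_mul, Matrix.single_mul_single_of_ne _ _ _ _ hil,
        Matrix.one_apply_ne hil]
      simp
  · intro j i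
    have h1 := R.isAlgGrading.mul_mem (h.single_mem c.isInvolutionGrading.one_mem i i₀) L.mem'
    refine ⟨?_, fun hji => ?_⟩
    · change e' (e.symm (Matrix.single i i₀ 1) * b) j k₀ ∈ _
      convert h'.comp _ _ h1.1 j k₀ using 2
      change (γ' j)⁻¹ * ((γ i₀)⁻¹ * s.1⁻¹ * γ' k₀) * γ i =
        (γ' j)⁻¹ * (γ i * 1 * (γ i₀)⁻¹ * s.1⁻¹) * γ' k₀
      rw [mul_one]
      ac_rfl
    · refine h'.part _ _ h1.2 j k₀ fun h2 => hji ?_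
      simp only [Prod.snd_mul, Prod.snd_inv, toAdd_mul, toAdd_ofAdd, toAdd_inv, ZMod.neg_eq_self_mod_two] at h2
      generalize par' j = p1 at *
      generalize par' k₀ = p2 at *
      generalize par i = p3 at *
      generalize par i₀ = p4 at *
      generalize s.2.toAdd = p5 at *
      clear * - h2
      revert p1 p2 p3 p4 p5
      decide
  · intro x
    refine Matrix.ext fun j i => ?_
    have h1 : (e' x * W) j i = e' (x * (e.symm (Matrix.single i i₀ 1) * b)) j k₀ := by
      rw [map_mul]
      rfl
    have h2 : x * e.symm (Matrix.single i i₀ 1) = ∑ l, e.symm (Matrix.single l i₀ (e x l i)) := by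
      apply e.injective
      simp only [map_mul, map_sum, AlgEquiv.apply_symm_apply]
      refine Matrix.ext fun k m => ?_
      rw [Matrix.sum_apply]
      by_cases hm : m = i₀
      · subst hm
        simp [Matrix.single_apply]
      · have : ¬ i₀ = m := fun h => hm h.symm
        simp [hm, this]
    -- This is `D`-linearity of right multiplication by `b`; it depends on the link inducing the
    -- identity of `D`.
    have h3 : ∀ l, e.symm (Matrix.single l i₀ (e x l i)) * b =
        e.symm (Matrix.single l i₀ 1) * b * e'.symm (Matrix.single k₀ k₀ (e x l i)) := by
      intro l
      rw [← hL]
      calc e.symm (Matrix.single l i₀ (e x l i)) * b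
          = e.symm (Matrix.single l i₀ 1) * e.symm (Matrix.single i₀ i₀ 1) *
              e.symm (Matrix.single i₀ i₀ (e x l i)) * b := by
            rw [h.single_mul, h.single_mul, one_mul, one_mul]
        _ = _ := by rw [← L.mul]; simp only [mul_assoc]
    rw [h1, ← mul_assoc, h2, Finset.sum_mul, map_sum, Matrix.sum_apply, Matrix.mul_apply]
    refine Finset.sum_congr rfl fun l _ => ?_
    rw [h3, map_mul, AlgEquiv.apply_symm_apply]
    simp [W]

/-- The form is determined by a presentation up to a scalar. -/
theorem IsPresentation.form_unique {Φ₁ Φ₂ : Matrix ι ι c.D} (h₁ : IsPresentation c par γ Φ₁ e)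
    (h₂ : IsPresentation c par γ Φ₂ e) (hΦ₁ : IsUnit Φ₁) : ∃ x : F, Φ₂ = x • Φ₁ := by
  obtain ⟨⟨Φ₁, Ψ, h3, h4⟩, rfl⟩ := hΦ₁
  simp only at h₁ ⊢
  -- Both forms define the same superadjunction, so `Φ₁⁻¹ Φ₂` commutes with all of its values. These
  -- are all matrices, as the superadjunction is involutive.
  have hc : Ψ * Φ₂ ∈ Subalgebra.center F (Matrix ι ι c.D) := by
    rw [Subalgebra.mem_center_iff]
    intro Y
    obtain ⟨x, rfl⟩ := e.surjective Y
    obtain ⟨x, rfl⟩ : ∃ y, x = R.alg.inv y := ⟨R.alg.inv x, (R.alg.inv_inv x).symm⟩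
    calc e (R.alg.inv x) * (Ψ * Φ₂) = Ψ * (Φ₁ * e (R.alg.inv x)) * Ψ * Φ₂ := by
          rw [← mul_assoc Ψ Φ₁, h4, one_mul, mul_assoc]
      _ = Ψ * superTranspose c.transposition par (e x) * (Φ₁ * Ψ) * Φ₂ := by
          rw [h₁.inv]; simp only [mul_assoc]
      _ = Ψ * Φ₂ * e (R.alg.inv x) := by
          rw [h3, mul_one, mul_assoc, ← h₂.inv, mul_assoc]
  rw [Algebra.IsCentral.center_eq_bot, Algebra.mem_bot] at hc
  obtain ⟨x, hx⟩ := hc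
  refine ⟨x, ?_⟩
  rw [← one_mul Φ₂, ← h3, mul_assoc, ← hx, ← Algebra.commutes, ← Algebra.smul_def]

/-- Degree, parity and sign can each be read off from a single nonzero entry, and a nonzero scalar
factor affects none of them. -/
theorem IsHermitianForm.data_unique [NeZero (2 : F)] [Nonempty ι] {g₀ g₀' : G × ZMod 2} {d d' : F}
    {Φ₁ Φ₂ : Matrix ι ι c.D} (h₁ : IsHermitianForm c par γ g₀ d Φ₁)
    (h₂ : IsHermitianForm c par γ g₀' d' Φ₂) {x : F} (hx : Φ₂ = x • Φ₁) : g₀' = g₀ ∧ d' = d := by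
  have hne : Φ₂ ≠ 0 := h₂.isUnit.ne_zero
  obtain ⟨i, j, hij⟩ : ∃ i j, Φ₂ i j ≠ 0 := by
    by_contra! h1; exact hne (Matrix.ext h1)
  have hx0 : x ≠ 0 := by
    rintro rfl; rw [zero_smul] at hx; exact hne hx
  have hij' : Φ₁ i j ≠ 0 := by
    intro h0; apply hij; rw [hx, Matrix.smul_apply, h0, smul_zero]
  refine ⟨Prod.ext ?_ ?_, ?_⟩
  · have h3 := h₂.mem i j
    have h4 := Submodule.smul_mem _ x (h₁.mem i j)
    rw [← Matrix.smul_apply, ← hx] at h4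
    by_contra hne
    have h5 := c.isInvolutionGrading.indep.pairwiseDisjoint
      (show g₀'.1 * γ i * γ j ≠ g₀.1 * γ i * γ j by simpa using hne)
    exact hij ((Submodule.disjoint_def.1 h5) _ h3 h4)
  · have h3 : par i + par j = g₀'.2 := by
      by_contra h; exact hij ((h₂.homog i j).2 h)
    have h4 : par i + par j = g₀.2 := by
      by_contra h; exact hij' ((h₁.homog i j).2 h)
    rw [← h3, h4]
  · have h3 := h₂.herm i j
    have h4 := h₁.herm i j
    rw [hx, Matrix.smul_apply, Matrix.smul_apply, map_smul, smul_comm _ x] at h3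
    have h5 := smul_right_injective _ hx0 h3
    have h6 : c.transposition.map (Φ₁ j i) ≠ 0 := by
      intro h0; rw [h0, smul_zero] at h4; exact hij' h4
    have h7 := smul_left_injective F h6 (h5.symm.trans h4)
    exact mul_right_cancel₀ (zsign_ne_zero _) h7

/-- Two presentations have the same invariants up to a translation. -/
theorem IsPresentation.exists_translate [NeZero (2 : F)] [Nonempty ι] [Nonempty κ]
    {g₀ g₀' : G × ZMod 2} (h : IsPresentation c par γ Φ e) (h' : IsPresentation c par' γ' Φ' e')
    (hΦ : IsHermitianForm c par γ g₀ 1 Φ) (hΦ' : IsHermitianForm c par' γ' g₀' 1 Φ') :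
    ∃ g : G, (∀ (i : ZMod 2) (x : G), Nat.card {j // par' j = i ∧ (γ' j : G ⧸ E.T) = x} =
      Nat.card {j // par j = i ∧ (γ j : G ⧸ E.T) = ((g⁻¹ * x : G) : G ⧸ E.T)}) ∧
      g₀' = ((g ^ 2)⁻¹ * g₀.1, g₀.2) := by
  obtain ⟨W, V, s, r, hWV, hVW, hW, hWe⟩ := h.exists_intertwiner h'
  -- Parities and sign are kept general so that the statement also covers the parity-shifted
  -- presentation, for which an odd `W` becomes even. Shifting degrees by `s⁻¹` gives `W` trivial
  -- degree. The change of basis then yields two forms for the same presentation `e`, which are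
  -- proportional.
  have main : ∀ (p : κ → ZMod 2) (Ψ : Matrix κ κ c.D) (d : F), IsPresentation c p γ' Ψ e' →
      IsHermitianForm c p γ' g₀' d Ψ → IsHomogMatrix c.comp γ' p γ par s 0 W →
      d = 1 ∧ g₀' = ((s ^ 2)⁻¹ * g₀.1, g₀.2) := by
    intro p Ψ d hp hΨ hWp
    have hW1 : IsHomogMatrix c.comp (fun k => s⁻¹ * γ' k) p γ par 1 0 W := by
      refine fun k i => ⟨?_, (hWp k i).2⟩
      convert (hWp k i).1 using 2
      rw [mul_inv, inv_inv, mul_one, mul_comm s]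
    have h1 := (hp.shift s⁻¹).changeBasis hWV hVW hW1
    have h2 := (hΨ.shift s⁻¹).changeBasis hWV hVW hW1
    have he : e'.trans (rectConj W V hWV hVW) = e := by
      ext1 x
      rw [AlgEquiv.trans_apply, rectConj_apply, Matrix.mul_assoc, hWe, ← Matrix.mul_assoc, hVW,
        Matrix.one_mul]
    rw [he] at h1
    obtain ⟨x, hx⟩ := h.form_unique h1 hΦ.isUnit
    obtain ⟨h3, h4⟩ := hΦ.data_unique h2 hx
    refine ⟨h4, ?_⟩
    rw [← h3]
    refine Prod.ext ?_ rfl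
    simp
  -- If `W` were odd, the parity-shifted form, with sign `-1`, would be proportional to one with
  -- sign `1`.
  have hr : r = 0 := by
    by_contra hr
    obtain rfl := zmod_two_eq_one hr
    have h1 := (main _ _ _ h'.parityShift hΦ'.parityShift fun k i => ⟨(hW k i).1, fun hki =>
      (hW k i).2 fun h2 => hki (by
        rw [add_right_comm, h2, CharTwo.add_self_eq_zero])⟩).1
    apply NeZero.ne (2 : F)
    linear_combination -h1
  subst hr
  refine ⟨s, fun i x => ?_, (main _ _ _ h' hΦ' hW).2⟩
  refine le_antisymm ?_ ?_
  · have h1 := c.card_le_of_mul_eq_one hWV (hW.inverse c.isInvolutionGrading hVW hWV) i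
      (x : G ⧸ E.T)
    rwa [add_zero, ← QuotientGroup.mk_mul] at h1
  · have h1 := c.card_le_of_mul_eq_one hVW hW i ((s⁻¹ * x : G) : G ⧸ E.T)
    rwa [add_zero, ← QuotientGroup.mk_mul, mul_inv_cancel_left] at h1

end Comparison

/-! ### Isomorphic models have the same parameters up to translation. -/

section IsomorphismTheorem

variable {F : Type u} [Field F] {G : Type v} [CommGroup G]

theorem IsPresentation.comp_iso {E : BicharPair F G} {c : E.Choice} {ι : Type*} [Fintype ι]
    [DecidableEq ι] {par : ι → ZMod 2} {γ : ι → G} {Φ : Matrix ι ι c.D}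
    {R : GradedSuperinvAlgebra.{u, w} F G} {R' : GradedSuperinvAlgebra F G}
    {e' : R'.alg.carrier ≃ₐ[F] Matrix ι ι c.D} (h' : IsPresentation c par γ Φ e')
    (f : R.alg.carrier ≃ₐ[F] R'.alg.carrier) (hf1 : ∀ p, ∀ a ∈ R.alg.part p, f a ∈ R'.alg.part p)
    (hf2 : ∀ g, ∀ a ∈ R.grading.comp g, f a ∈ R'.grading.comp g)
    (hf3 : ∀ a, f (R.alg.inv a) = R'.alg.inv (f a)) : IsPresentation c par γ Φ (f.trans e') where
  part p x hx := h'.part p _ (hf1 p x hx)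
  comp g x hx := h'.comp g _ (hf2 g x hx)
  inv x := by
    rw [AlgEquiv.trans_apply, hf3, h'.inv]
    rfl

/-- Through the isomorphism both models present one algebra. A link between diagonal idempotents
identifies `T` and `β`, and only after that do the two presentations have entries in the same `D`,
so that they can be compared. The condition `κ ≠ 0` ensures that the index sets are nonempty. -/
theorem ModelParams.exists_translate_of_iso [NeZero (2 : F)] {c : ∀ E : BicharPair F G, E.Choice}
    (P P' : ModelParams F G c) (hiso : P.model.Iso P'.model) :
    ∃ hT : P.base.T = P'.base.T,
      (∀ (s t : G) (hs : s ∈ P.base.T) (ht : t ∈ P.base.T),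
        P.base.β ⟨s, hs⟩ ⟨t, ht⟩ = P'.base.β ⟨s, hT ▸ hs⟩ ⟨t, hT ▸ ht⟩) ∧
      ∃ g : G,
        (∀ (i : ZMod 2) (x : G),
          P'.κ i (x : G ⧸ P'.base.T) = P.κ i ((g⁻¹ * x : G) : G ⧸ P.base.T)) ∧
        P'.g₀ = ((g ^ 2)⁻¹ * P.g₀.1, P.g₀.2) := by
  obtain ⟨f, hf1, hf2, hf3⟩ := hiso
  obtain ⟨ι, _, _, par, γ, Φ, e, h, hΦ, hcard⟩ := P.exists_presentation
  obtain ⟨κ, _, _, par', γ', Φ', e', h', hΦ', hcard'⟩ := P'.exists_presentation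
  have h'' := h'.comp_iso f hf1 hf2 hf3
  have hne : ∀ (P : ModelParams F G c) {ι : Type v} [Fintype ι] (par : ι → ZMod 2) (γ : ι → G),
      (∀ a x, Nat.card {i // par i = a ∧ (γ i : G ⧸ P.base.T) = x} = P.κ a x) → Nonempty ι := by
    intro P ι _ par γ hc
    by_contra hemp
    rw [not_nonempty_iff] at hemp
    refine P.κ_ne_zero (funext fun a => Finsupp.ext fun x => ?_)
    rw [← hc, Nat.card_eq_zero.2 (Or.inl inferInstance)]
    rfl
  have := hne P par γ hcard
  have := hne P' par' γ' hcard'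
  obtain ⟨i₀⟩ := ‹Nonempty ι›
  obtain ⟨k₀⟩ := ‹Nonempty κ›
  obtain ⟨s, a, b, L⟩ := (h.isGradedDivIdem i₀).exists_link h.isPrimeRing P.model.isAlgGrading
    (h''.isGradedDivIdem k₀)
  have hT : P.base.T = P'.base.T := le_antisymm (h.le_of_link h'' L) (h''.le_of_link h L.symm)
  have hβ : ∀ (s t : G) (hs : s ∈ P.base.T) (ht : t ∈ P.base.T),
      P.base.β ⟨s, hs⟩ ⟨t, ht⟩ = P'.base.β ⟨s, hT ▸ hs⟩ ⟨t, hT ▸ ht⟩ :=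
    fun q r hq hr => h.β_eq_of_link h'' L q r hq hr _ _
  refine ⟨hT, hβ, ?_⟩
  have hbase := P.base_eq P' hT hβ
  clear L h'
  obtain ⟨E', κ', g₀', h0', hadm'⟩ := P'
  simp only at hbase
  subst hbase
  have : Nonempty ι := ⟨i₀⟩
  have : Nonempty κ := ⟨k₀⟩
  obtain ⟨g, hg, hg0⟩ := h.exists_translate h'' hΦ hΦ'
  refine ⟨g, fun i x => ?_, hg0⟩
  rw [← hcard, ← hg]
  exact (hcard' i _).symm

end IsomorphismTheorem

/-! ### Structure of graded prime algebras -/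

section GradedStructure

variable {F : Type*} [Field F] {R : Type*} [Ring R] [Algebra F R] {H : Type*} [CommGroup H]
  {𝒜 : H → Submodule F R}

/-- A left divisor of a homogeneous element by a homogeneous element can be chosen homogeneous. -/
theorem IsAlgGrading.exists_homogeneous_divisor (h𝒜 : IsAlgGrading 𝒜) {g h : H} {x z : R}
    (hx : x ∈ 𝒜 h) (hzx : z * x ∈ 𝒜 g) : ∃ y ∈ 𝒜 (g * h⁻¹), y * x = z * x := by
  obtain ⟨π, π1, π2, π3⟩ := exists_projections h𝒜.indep h𝒜.iSup_eq_top
  refine ⟨π (g * h⁻¹) z, π1 _ _, ?_⟩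
  rw [← projection_mul h𝒜.iSup_eq_top h𝒜.mul_mem π2 π3 hx z, inv_mul_cancel_right, π2 _ _ hzx]

/-- Choose a nonzero homogeneous `a` for which the left ideal `R a` has least dimension. For nonzero
homogeneous `b ∈ R a`, the inclusion `R b ⊆ R a` is then an equality, whence `a ∈ R b`. -/
theorem IsAlgGrading.exists_minimal [FiniteDimensional F R] [Nontrivial R] (h𝒜 : IsAlgGrading 𝒜) :
    ∃ h, ∃ a ∈ 𝒜 h, a ≠ 0 ∧ ∀ k, ∀ b ∈ 𝒜 k, b ≠ 0 → (∃ z, b = z * a) → ∃ y, a = y * b := by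
  classical
  let m : R → ℕ := fun a => Module.finrank F (LinearMap.mulRight F a).range
  have hex : ∃ n, ∃ h, ∃ a ∈ 𝒜 h, a ≠ 0 ∧ m a = n :=
    ⟨_, 1, 1, one_mem_of_grading h𝒜.indep h𝒜.iSup_eq_top h𝒜.mul_mem, one_ne_zero, rfl⟩
  obtain ⟨h, a, ha, ha0, hm⟩ := Nat.find_spec hex
  refine ⟨h, a, ha, ha0, ?_⟩
  rintro k b hb hb0 ⟨z, rfl⟩
  have hle : (LinearMap.mulRight F (z * a)).range ≤ (LinearMap.mulRight F a).range := by
    rintro _ ⟨x, rfl⟩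
    exact ⟨x * z, by simp [mul_assoc]⟩
  have heq := Submodule.eq_of_le_of_finrank_le hle
    (hm.le.trans (Nat.find_min' hex ⟨k, _, hb, hb0, rfl⟩))
  have ha' : a ∈ (LinearMap.mulRight F a).range := ⟨1, by simp⟩
  rw [← heq] at ha'
  obtain ⟨y, hy⟩ := ha'
  exact ⟨y, hy.symm⟩

/-- A graded version of Brauer's lemma. -/
theorem IsAlgGrading.exists_isGradedDivIdem [FiniteDimensional F R] [Nontrivial R]
    (h𝒜 : IsAlgGrading 𝒜) (hR : IsPrimeRing R) : ∃ e, IsGradedDivIdem 𝒜 e := by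
  obtain ⟨d, a, ha, ha0, hmin⟩ := h𝒜.exists_minimal
  -- Primeness gives `a y a ≠ 0`. With `c = y a ∈ R a`, minimality gives `a = z (a c)`, so `c = (y z
  -- a) c`, and a homogeneous replacement `z'` of `y z` makes `e = z' a` a left identity for `c`.
  obtain ⟨k, y, hy, hy0⟩ := hR.exists_homogeneous h𝒜.iSup_eq_top ha0 ha0
  have hc : y * a ∈ 𝒜 (k * d) := h𝒜.mul_mem hy ha
  have hac0 : a * (y * a) ≠ 0 := by rwa [← mul_assoc]
  have hac : a * (y * a) ∈ 𝒜 (d * (k * d)) := h𝒜.mul_mem ha hc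
  obtain ⟨z, hz⟩ := hmin _ _ hac hac0 ⟨a * y, by rw [mul_assoc]⟩
  set c := y * a with hcdef
  have hyz : y * z * (a * c) = c := by rw [mul_assoc, ← hz]
  obtain ⟨z', hz', hz'c⟩ := h𝒜.exists_homogeneous_divisor (z := y * z) (g := k * d) hac
    (by rw [hyz]; exact hc)
  rw [hyz] at hz'c
  have hdeg : k * d * (d * (k * d))⁻¹ = d⁻¹ := by rw [mul_inv, mul_comm d⁻¹, mul_inv_cancel_left]
  rw [hdeg] at hz'
  have he1 : z' * a ∈ 𝒜 1 := by simpa using h𝒜.mul_mem hz' ha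
  have hec : z' * a * c = c := by rw [mul_assoc, hz'c]
  have hc0 : c ≠ 0 := by rintro h; rw [h, mul_zero] at hac0; exact hac0 rfl
  -- If `e² - e` were nonzero, minimality would give `a ∈ R (e² - e)`. But `e² - e` annihilates `c`
  -- on the left, which contradicts `a c ≠ 0`.
  have hidem : z' * a * (z' * a) = z' * a := by
    by_contra hne
    have h1 : z' * a * (z' * a) - z' * a ∈ 𝒜 1 :=
      sub_mem (by simpa using h𝒜.mul_mem he1 he1) he1
    obtain ⟨y', hy'⟩ := hmin _ _ h1 (sub_ne_zero.2 hne) ⟨z' * a * z' - z', by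
      rw [sub_mul, mul_assoc (z' * a)]⟩
    apply hac0
    rw [hy', mul_assoc, sub_mul, mul_assoc, hec, hec, sub_self, mul_zero]
  set e := z' * a with he
  have he0 : e ≠ 0 := by rintro h; rw [h, zero_mul] at hec; exact hc0 hec.symm
  have hminz : ∀ h x, x ∈ 𝒜 h → x * e = x → x ≠ 0 → ∃ y, z' * y * x = e := by
    intro h x hx hxe hx0
    obtain ⟨y, hy⟩ := hmin _ _ hx hx0 ⟨x * z', by rw [mul_assoc, ← he, hxe]⟩
    exact ⟨y, by rw [mul_assoc, ← hy]⟩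
  clear_value e
  have hleft : ∀ h x, x ∈ 𝒜 h → e * x = x → x * e = x → x ≠ 0 →
      ∃ y ∈ 𝒜 h⁻¹, e * y = y ∧ y * e = y ∧ y * x = e := by
    intro h x hx hex hxe hx0
    obtain ⟨y, h1⟩ := hminz _ _ hx hxe hx0
    obtain ⟨y', hy', hy'x⟩ := h𝒜.exists_homogeneous_divisor (z := z' * y) (g := 1) hx
      (by rw [h1]; exact he1)
    rw [one_mul] at hy'
    rw [h1] at hy'x
    refine ⟨e * y' * e, by simpa using h𝒜.mul_mem (h𝒜.mul_mem he1 hy') he1, ?_, ?_, ?_⟩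
    · rw [mul_assoc, ← mul_assoc e e, hidem]
    · rw [mul_assoc _ e e, hidem]
    · rw [mul_assoc _ e x, hex, mul_assoc, hy'x, hidem]
  refine ⟨e, he0, hidem, he1, fun h x hx hex hxe hx0 => ?_⟩
  obtain ⟨y, hy, hey, hye, hyx⟩ := hleft h x hx hex hxe hx0
  have hy0 : y ≠ 0 := by rintro rfl; rw [zero_mul] at hyx; exact he0 hyx.symm
  -- A left inverse has a left inverse of its own, which must be `x`; so left inverses in the corner
  -- are two-sided.
  obtain ⟨w, -, -, hwe, hwy⟩ := hleft _ y hy hey hye hy0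
  refine ⟨y, hy, hey, hye, hyx, ?_⟩
  have hxw : x = w := by
    rw [← hex, ← hwy, mul_assoc, hyx, hwe]
  rw [hxw, hwy]

/-- The component of trivial degree of the graded-division algebra `e R e` is `F e`. -/
theorem IsGradedDivIdem.eq_smul [IsAlgClosed F] [FiniteDimensional F R] {e x : R}
    (he : IsGradedDivIdem 𝒜 e) (hx : x ∈ 𝒜 1) (hex : e * x = x) (hxe : x * e = x) :
    ∃ a : F, x = a • e := by
  let V : Submodule F R := (LinearMap.mulLeft F e).range
  have hV : ∀ v ∈ V, LinearMap.mulLeft F x v ∈ V := fun v _ =>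
    ⟨x * v, by simp [← mul_assoc, hex]⟩
  have hVe : ∀ v ∈ V, e * v = v := by
    rintro _ ⟨v, rfl⟩
    simp [← mul_assoc, he.idem]
  have : Nontrivial V := ⟨⟨⟨e, e, by simp [he.idem]⟩, 0, fun h => he.ne_zero (congrArg Subtype.val h)⟩⟩
  -- Left multiplication by `x` on `e R` has an eigenvalue `a`. Then `x - a e` annihilates a nonzero
  -- vector, so it is not invertible in the corner and must vanish.
  obtain ⟨a, ha⟩ := Module.End.exists_eigenvalue ((LinearMap.mulLeft F x).restrict hV)
  obtain ⟨v, hv⟩ := ha.exists_hasEigenvector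
  have h1 : x * (v : R) = a • (v : R) := congrArg Subtype.val hv.apply_eq_smul
  refine ⟨a, ?_⟩
  by_contra hne
  have h2 : (x - a • e) * (v : R) = 0 := by
    rw [sub_mul, h1, smul_mul_assoc, hVe v v.2, sub_self]
  obtain ⟨y, -, -, -, hy, -⟩ := he.exists_inv 1 (x - a • e) (sub_mem hx (Submodule.smul_mem _ _ he.mem))
    (by rw [mul_sub, hex, mul_smul_comm, he.idem]) (by rw [sub_mul, hxe, smul_mul_assoc, he.idem])
    (sub_ne_zero.2 hne)
  apply hv.2
  apply Subtype.ext
  rw [← hVe v v.2, ← hy, mul_assoc, h2, mul_zero]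
  rfl

theorem IsGradedDivIdem.eq_smul_of_mem [IsAlgClosed F] [FiniteDimensional F R]
    (h𝒜 : IsAlgGrading 𝒜) {e : R} (he : IsGradedDivIdem 𝒜 e) {h : H} {x y : R} (hx : x ∈ 𝒜 h)
    (hex : e * x = x) (hxe : x * e = x) (hy : y ∈ 𝒜 h) (hey : e * y = y) (hye : y * e = y)
    (hy0 : y ≠ 0) : ∃ a : F, x = a • y := by
  obtain ⟨z, hz, hez, hze, hzy, hyz⟩ := he.exists_inv h y hy hey hye hy0
  obtain ⟨a, ha⟩ := he.eq_smul (x := x * z) (by simpa using h𝒜.mul_mem hx hz)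
    (by rw [← mul_assoc, hex]) (by rw [mul_assoc, hze])
  refine ⟨a, ?_⟩
  rw [← hxe, ← hzy, ← mul_assoc, ha, smul_mul_assoc, hey]

theorem IsLink.eq_smul [IsAlgClosed F] [FiniteDimensional F R] (h𝒜 : IsAlgGrading 𝒜) {e f a b : R}
    {s : H} (L : IsLink 𝒜 e f s a b) (he : IsGradedDivIdem 𝒜 e) {x : R} (hx : x ∈ 𝒜 s)
    (hfx : f * x = x) (hxe : x * e = x) : ∃ c : F, x = c • a := by
  obtain ⟨c, hc⟩ := he.eq_smul (x := b * x) (by simpa using h𝒜.mul_mem L.mem' hx)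
    (by rw [← mul_assoc, L.left']) (by rw [mul_assoc, hxe])
  refine ⟨c, ?_⟩
  rw [← hfx, ← L.mul', mul_assoc, hc, mul_smul_comm, L.right]

/-- Homogeneous elements of `R e` and `e R` which are the first steps in a matrix decomposition. -/
structure IsPartialBasis (𝒜 : H → Submodule F R) (e : R) {n : ℕ} (g : Fin n → H)
    (b b' : Fin n → R) : Prop where
  mem : ∀ i, b i ∈ 𝒜 (g i)
  mem' : ∀ i, b' i ∈ 𝒜 (g i)⁻¹
  right : ∀ i, b i * e = b i
  left : ∀ i, e * b' i = b' i
  mul : ∀ i j, b' i * b j = if i = j then e else 0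

theorem IsPartialBasis.le_finrank [FiniteDimensional F R] {e : R} (he : e ≠ 0) {n : ℕ}
    {g : Fin n → H} {b b' : Fin n → R} (h : IsPartialBasis 𝒜 e g b b') :
    n ≤ Module.finrank F R := by
  have hli : LinearIndependent F b := by
    rw [Fintype.linearIndependent_iff]
    intro c hc i
    have h1 := congrArg (fun z => b' i * z) hc
    simp only [Finset.mul_sum, mul_smul_comm, h.mul, mul_zero] at h1
    simpa [he] using h1
  simpa using hli.fintype_card_le_finrank

/-- The complementary idempotent `f = 1 - ∑ b i * b' i` has trivial degree and is orthogonal to all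
`b j` and `b' j`. Primeness yields `e y f x e ≠ 0`, which is invertible in the corner. The new pair
is `f x e` and the corresponding multiple of `e y f`. -/
theorem IsPartialBasis.extend {e : R} (h𝒜 : IsAlgGrading 𝒜) (hR : IsPrimeRing R)
    (he : IsGradedDivIdem 𝒜 e) {n : ℕ} {g : Fin n → H} {b b' : Fin n → R}
    (h : IsPartialBasis 𝒜 e g b b') (hne : ∑ i, b i * b' i ≠ 1) :
    ∃ (g₁ : Fin (n + 1) → H) (b₁ b₁' : Fin (n + 1) → R), IsPartialBasis 𝒜 e g₁ b₁ b₁' := by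
  set f := 1 - ∑ i, b i * b' i with hf
  have hf0 : f ≠ 0 := sub_ne_zero.2 hne.symm
  have hf1 : f ∈ 𝒜 1 := by
    refine sub_mem (one_mem_of_grading h𝒜.indep h𝒜.iSup_eq_top h𝒜.mul_mem) (sum_mem fun i _ => ?_)
    simpa using h𝒜.mul_mem (h.mem i) (h.mem' i)
  have hfb : ∀ j, f * b j = 0 := by
    intro j
    rw [hf, sub_mul, one_mul, Finset.sum_mul, Finset.sum_eq_single j, mul_assoc, h.mul, if_pos rfl,
      h.right, sub_self]
    · intro i _ hi; rw [mul_assoc, h.mul, if_neg hi, mul_zero]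
    · simp
  have hbf : ∀ j, b' j * f = 0 := by
    intro j
    rw [hf, mul_sub, mul_one, Finset.mul_sum, Finset.sum_eq_single j, ← mul_assoc, h.mul,
      if_pos rfl, h.left, sub_self]
    · intro i _ hi; rw [← mul_assoc, h.mul, if_neg (Ne.symm hi), zero_mul]
    · simp
  have hff : f * f = f := by
    nth_rewrite 2 [hf]
    rw [mul_sub, mul_one, Finset.mul_sum]
    simp [← mul_assoc, hfb]
  obtain ⟨s, x, hx, hx0⟩ := hR.exists_homogeneous h𝒜.iSup_eq_top hf0 he.ne_zero
  set a := f * x * e with ha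
  have has : a ∈ 𝒜 s := by simpa using h𝒜.mul_mem (h𝒜.mul_mem hf1 hx) he.mem
  have hae : a * e = a := by rw [ha, mul_assoc, he.idem]
  have hfa : f * a = a := by rw [ha, ← mul_assoc, ← mul_assoc, hff]
  obtain ⟨k, y, hy, hy0⟩ := hR.exists_homogeneous h𝒜.iSup_eq_top he.ne_zero hx0
  obtain ⟨z, hz, hez, hze, hzy, -⟩ := he.exists_inv (k * s) (e * y * a)
    (by simpa using h𝒜.mul_mem (h𝒜.mul_mem he.mem hy) has)
    (by rw [mul_assoc, ← mul_assoc e e, he.idem]) (by rw [mul_assoc, hae]) hy0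
  refine ⟨Fin.cons s g, Fin.cons a b, Fin.cons (z * (e * y * f)) b', ?_⟩
  constructor
  · exact Fin.cases has h.mem
  · refine Fin.cases ?_ h.mem'
    have h1 := h𝒜.mul_mem hz (h𝒜.mul_mem (h𝒜.mul_mem he.mem hy) hf1)
    simpa using h1
  · exact Fin.cases hae h.right
  · refine Fin.cases ?_ h.left
    rw [Fin.cons_zero, ← mul_assoc, hez]
  · refine Fin.cases (Fin.cases ?_ fun j => ?_) fun i => Fin.cases ?_ fun j => ?_
    · rw [Fin.cons_zero, Fin.cons_zero, if_pos rfl, mul_assoc, mul_assoc _ f, hfa, hzy]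
    · rw [Fin.cons_zero, Fin.cons_succ, if_neg (Fin.succ_ne_zero j).symm, mul_assoc, mul_assoc _ f,
        hfb, mul_zero, mul_zero]
    · rw [Fin.cons_zero, Fin.cons_succ, if_neg (Fin.succ_ne_zero i), ← hfa, ← mul_assoc, hbf,
        zero_mul]
    · rw [Fin.cons_succ, Fin.cons_succ, h.mul]
      simp

/-- The `b i` are linearly independent, so in finite dimension the extension process has to stop,
and it stops only when the sum is `1`. -/
theorem IsGradedDivIdem.exists_basis [FiniteDimensional F R] (h𝒜 : IsAlgGrading 𝒜)
    (hR : IsPrimeRing R) {e : R} (he : IsGradedDivIdem 𝒜 e) :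
    ∃ (n : ℕ) (g : Fin n → H) (b b' : Fin n → R), IsPartialBasis 𝒜 e g b b' ∧
      ∑ i, b i * b' i = 1 := by
  by_contra! hcon
  have key : ∀ n : ℕ, ∃ (g : Fin n → H) (b b' : Fin n → R), IsPartialBasis 𝒜 e g b b' := by
    intro n
    induction n with
    | zero => exact ⟨Fin.elim0, Fin.elim0, Fin.elim0, ⟨fun i => i.elim0, fun i => i.elim0,
        fun i => i.elim0, fun i => i.elim0, fun i => i.elim0⟩⟩
    | succ n ih =>
      obtain ⟨g, b, b', h⟩ := ih
      exact h.extend h𝒜 hR he (hcon n g b b' h)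
  obtain ⟨g, b, b', h⟩ := key (Module.finrank F R + 1)
  have := h.le_finrank he.ne_zero
  omega

/-- The center of `e R e`. -/
theorem IsPartialBasis.eq_smul_of_commute {e : R} {n : ℕ} {g : Fin n → H}
    {b b' : Fin n → R} (h : IsPartialBasis 𝒜 e g b b') (hn : Nonempty (Fin n))
    (hsum : ∑ i, b i * b' i = 1)
    (hR : ∀ z : R, (∀ y, z * y = y * z) → ∃ a : F, z = a • 1) {x : R} (hex : e * x = x)
    (hxe : x * e = x) (hx : ∀ y, x * (e * y * e) = e * y * e * x) : ∃ a : F, x = a • e := by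
  have hv : ∀ i j y, x * (b' i * y * b j) = b' i * y * b j * x := by
    intro i j y
    have h1 : b' i * y * b j = e * (b' i * y * b j) * e := by
      rw [mul_assoc e, mul_assoc _ (b j), h.right, ← mul_assoc e, ← mul_assoc e, h.left]
    rw [h1, hx]
  -- This element is the diagonal matrix with `x` in all places; it is central in `R` because `x` is
  -- central in the corner.
  obtain ⟨a, ha⟩ := hR (∑ i, b i * x * b' i) (by
    intro y
    calc (∑ i, b i * x * b' i) * y = (∑ i, b i * x * b' i) * y * ∑ j, b j * b' j := by
          rw [hsum, mul_one]
      _ = ∑ i, ∑ j, b i * (x * (b' i * y * b j)) * b' j := by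
          rw [Finset.sum_mul, Finset.sum_mul]
          refine Finset.sum_congr rfl fun i _ => ?_
          rw [Finset.mul_sum]
          refine Finset.sum_congr rfl fun j _ => ?_
          simp only [mul_assoc]
      _ = ∑ j, ∑ i, b i * b' i * y * (b j * x * b' j) := by
          rw [Finset.sum_comm]
          refine Finset.sum_congr rfl fun i _ => Finset.sum_congr rfl fun j _ => ?_
          rw [hv]
          simp only [mul_assoc]
      _ = y * ∑ j, b j * x * b' j := by
          rw [Finset.mul_sum]
          refine Finset.sum_congr rfl fun j _ => ?_
          rw [← Finset.sum_mul, ← Finset.sum_mul, hsum, one_mul])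
  obtain ⟨i⟩ := hn
  refine ⟨a, ?_⟩
  have h1 : b' i * (∑ j, b j * x * b' j) * b i = x := by
    rw [Finset.mul_sum, Finset.sum_mul, Finset.sum_eq_single i]
    · calc b' i * (b i * x * b' i) * b i = (b' i * b i) * x * (b' i * b i) := by
            simp only [mul_assoc]
        _ = x := by rw [h.mul, if_pos rfl, hex, hxe]
    · intro j _ hj
      calc b' i * (b j * x * b' j) * b i = (b' i * b j) * x * (b' j * b i) := by
            simp only [mul_assoc]
        _ = 0 := by rw [h.mul, if_neg (Ne.symm hj), zero_mul, zero_mul]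
    · simp
  rw [← h1, ha, mul_smul_comm, mul_one, smul_mul_assoc, h.mul, if_pos rfl]

end GradedStructure

/-! ### The graded-division algebra of a graded superalgebra with superinvolution -/

section Corner

variable {F : Type*} [Field F] {R : Type*} [Ring R] [Algebra F R] {H : Type*} [CommGroup H]

/-- The component of degree `h` of `e R e`. -/
def gradedCorner (𝒜 : H → Submodule F R) (e : R) (h : H) : Submodule F R where
  carrier := {x | x ∈ 𝒜 h ∧ e * x = x ∧ x * e = x}
  add_mem' hx hy := ⟨add_mem hx.1 hy.1, by rw [mul_add, hx.2.1, hy.2.1],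
    by rw [add_mul, hx.2.2, hy.2.2]⟩
  zero_mem' := ⟨zero_mem _, mul_zero _, zero_mul _⟩
  smul_mem' a _ hx := ⟨Submodule.smul_mem _ a hx.1, by rw [mul_smul_comm, hx.2.1],
    by rw [smul_mul_assoc, hx.2.2]⟩

variable {𝒜 : H → Submodule F R} {e : R}

theorem IsAlgGrading.corner_mul_mem (h𝒜 : IsAlgGrading 𝒜) {h k : H} {x y : R}
    (hx : x ∈ gradedCorner 𝒜 e h) (hy : y ∈ gradedCorner 𝒜 e k) :
    x * y ∈ gradedCorner 𝒜 e (h * k) :=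
  ⟨h𝒜.mul_mem hx.1 hy.1, by rw [← mul_assoc, hx.2.1], by rw [mul_assoc, hy.2.2]⟩

theorem IsAlgGrading.eq_of_mem_of_mem (h𝒜 : IsAlgGrading 𝒜) {h k : H} {x : R} (hx : x ∈ 𝒜 h)
    (hx' : x ∈ 𝒜 k) (hx0 : x ≠ 0) : h = k := by
  obtain ⟨π, -, π2, π3⟩ := exists_projections h𝒜.indep h𝒜.iSup_eq_top
  by_contra hne
  exact hx0 ((π2 h x hx).symm.trans (π3 _ _ _ hx' (Ne.symm hne)))

theorem IsGradedDivIdem.mem_corner (he : IsGradedDivIdem 𝒜 e) : e ∈ gradedCorner 𝒜 e 1 :=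
  ⟨he.mem, he.idem, he.idem⟩

theorem IsGradedDivIdem.mul_ne_zero (he : IsGradedDivIdem 𝒜 e) {h k : H} {x y : R}
    (hx : x ∈ gradedCorner 𝒜 e h) (hx0 : x ≠ 0) (hy : y ∈ gradedCorner 𝒜 e k) (hy0 : y ≠ 0) :
    x * y ≠ 0 := by
  intro h0
  obtain ⟨z, -, -, -, hz, -⟩ := he.exists_inv h x hx.1 hx.2.1 hx.2.2 hx0
  apply hy0
  rw [← hy.2.1, ← hz, mul_assoc, h0, mul_zero]

theorem IsGradedDivIdem.exists_smul_eq [IsAlgClosed F] [FiniteDimensional F R]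
    (h𝒜 : IsAlgGrading 𝒜) (he : IsGradedDivIdem 𝒜 e) {h : H} {x y : R}
    (hx : x ∈ gradedCorner 𝒜 e h) (hy : y ∈ gradedCorner 𝒜 e h) (hy0 : y ≠ 0) :
    ∃ a : F, x = a • y :=
  he.eq_smul_of_mem h𝒜 hx.1 hx.2.1 hx.2.2 hy.1 hy.2.1 hy.2.2 hy0

/-- The homogeneous central elements of `e R e` are scalar. -/
theorem IsGradedDivIdem.eq_smul_of_commute [FiniteDimensional F R] (h𝒜 : IsAlgGrading 𝒜)
    (hR : IsPrimeRing R) (hcent : ∀ z : R, (∀ y, z * y = y * z) → ∃ a : F, z = a • 1)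
    (he : IsGradedDivIdem 𝒜 e) {h : H} {x : R} (hx : x ∈ gradedCorner 𝒜 e h)
    (hcomm : ∀ k, ∀ y ∈ gradedCorner 𝒜 e k, x * y = y * x) : ∃ a : F, x = a • e := by
  obtain ⟨n, g, b, b', hb, hsum⟩ := he.exists_basis h𝒜 hR
  have hn : Nonempty (Fin n) := by
    by_contra hn
    rw [not_nonempty_iff] at hn
    rw [Finset.univ_eq_empty, Finset.sum_empty] at hsum
    apply he.ne_zero
    rw [← one_mul e, ← hsum, zero_mul]
  refine hb.eq_smul_of_commute hn hsum hcent hx.2.1 hx.2.2 ?_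
  refine mem_iSup_induction h𝒜.iSup_eq_top (fun k y hy => hcomm k _ ⟨?_, ?_, ?_⟩) (by simp) ?_
  · simpa using h𝒜.mul_mem (h𝒜.mul_mem he.mem hy) he.mem
  · rw [← mul_assoc, ← mul_assoc, he.idem]
  · rw [mul_assoc, he.idem]
  · intro y z hy hz
    rw [mul_add, add_mul, mul_add, hy, hz, add_mul]

theorem IsLink.mul_left_cancel {f a b : R} {s : H}
    (L : IsLink 𝒜 e f s a b) {x y : R} (hx : e * x = x) (hy : e * y = y) (h : a * x = a * y) : x = y := by
  rw [← hx, ← hy, ← L.mul, mul_assoc, mul_assoc, h]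

end Corner

/-! ### The superinvolution and the corner of a graded-division idempotent. -/

section CornerInv

variable {F : Type u} [Field F] {G : Type v} [CommGroup G] {R : GradedSuperinvAlgebra.{u, w} F G}
  {e : R.alg.carrier}

theorem SuperinvAlgebra.inv_ne_zero (R : SuperinvAlgebra.{u, w} F) {x : R.carrier} (hx : x ≠ 0) :
    R.inv x ≠ 0 := fun h => hx (by rw [← R.inv_inv x, h, map_zero])

theorem SuperinvAlgebra.part_induction (R : SuperinvAlgebra.{u, w} F) {P : R.carrier → Prop}
    (hP : ∀ p x, x ∈ R.part p → P x) (hadd : ∀ x y, P x → P y → P (x + y)) (x : R.carrier) : P x :=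
  mem_iSup_induction (iSup_eq_top_of_isCompl R.isCompl_part) hP (hP 0 0 (zero_mem _)) hadd x

theorem SuperinvAlgebra.inv_mul_left (R : SuperinvAlgebra.{u, w} F) {x : R.carrier}
    (hx : x ∈ R.part 0) : ∀ y, R.inv (x * y) = R.inv y * R.inv x := by
  refine R.part_induction (fun p y hy => ?_) fun y z hy hz => ?_
  · rw [R.inv_mul hx hy, zero_mul, zsign, if_pos rfl, one_smul]
  · rw [mul_add, map_add, map_add, add_mul, hy, hz]

theorem SuperinvAlgebra.inv_mul_right (R : SuperinvAlgebra.{u, w} F) {x : R.carrier}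
    (hx : x ∈ R.part 0) : ∀ y, R.inv (y * x) = R.inv x * R.inv y := by
  refine R.part_induction (fun p y hy => ?_) fun y z hy hz => ?_
  · rw [R.inv_mul hy hx, mul_zero, zsign, if_pos rfl, one_smul]
  · rw [add_mul, map_add, map_add, mul_add, hy, hz]

theorem GradedSuperinvAlgebra.inv_mem {h : G × Multiplicative (ZMod 2)} {x : R.alg.carrier}
    (hx : x ∈ R.superComp h) : R.alg.inv x ∈ R.superComp h :=
  ⟨R.grading.inv_mem hx.1, R.alg.inv_mem_part hx.2⟩

/-- The superinvolution exchanges the corners of `e` and `φ(e)`, reversing products up to sign; the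
sign is absorbed in the inverse. -/
theorem IsGradedDivIdem.inv (he : IsGradedDivIdem R.superComp e) :
    IsGradedDivIdem R.superComp (R.alg.inv e) where
  ne_zero := R.alg.inv_ne_zero he.ne_zero
  idem := by rw [← R.alg.inv_mul_left he.mem.2, he.idem]
  mem := R.inv_mem he.mem
  exists_inv := by
    intro h x hx hex hxe hx0
    have he0 : R.alg.inv e ∈ R.alg.part 0 := R.alg.inv_mem_part he.mem.2
    obtain ⟨y, hy, hey, hye, hyx, hxy⟩ := he.exists_inv h (R.alg.inv x) (R.inv_mem hx)
      (by conv_rhs => rw [← hxe, R.alg.inv_mul_right he0, R.alg.inv_inv])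
      (by conv_rhs => rw [← hex, R.alg.inv_mul_left he0, R.alg.inv_inv])
      (R.alg.inv_ne_zero hx0)
    have h1 := congrArg R.alg.inv hyx
    have h2 := congrArg R.alg.inv hxy
    rw [R.alg.inv_mul hy.2 (R.inv_mem hx).2, R.alg.inv_inv] at h1
    rw [R.alg.inv_mul (R.inv_mem hx).2 hy.2, R.alg.inv_inv, mul_comm (h.2.toAdd)] at h2
    refine ⟨zsign F (h⁻¹.2.toAdd * h.2.toAdd) • R.alg.inv y,
      Submodule.smul_mem _ _ (R.inv_mem hy), ?_, ?_, ?_, ?_⟩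
    · rw [mul_smul_comm, ← R.alg.inv_mul_right he.mem.2, hye]
    · rw [smul_mul_assoc, ← R.alg.inv_mul_left he.mem.2, hey]
    · rw [smul_mul_assoc, h2]
    · rw [mul_smul_comm, h1]

variable [IsAlgClosed F] [FiniteDimensional F R.alg.carrier] {s : G × Multiplicative (ZMod 2)}
  {a b : R.alg.carrier}

/-- The map `x ↦ b φ(x) a` sends the corner to itself and preserves degrees. On one-dimensional
components it can only be a scalar. -/
theorem IsLink.exists_inv_mul_eq (he : IsGradedDivIdem R.superComp e)
    (L : IsLink R.superComp e (R.alg.inv e) s a b) {h : G × Multiplicative (ZMod 2)}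
    {x : R.alg.carrier} (hx : x ∈ gradedCorner R.superComp e h) (hx0 : x ≠ 0) :
    ∃ η : F, R.alg.inv x * a = η • (a * x) := by
  have h1 : b * R.alg.inv x * a ∈ gradedCorner R.superComp e h := by
    refine ⟨?_, by rw [← mul_assoc, ← mul_assoc, L.left'], by rw [mul_assoc, L.right]⟩
    have := R.isAlgGrading.mul_mem (R.isAlgGrading.mul_mem L.mem' (R.inv_mem hx.1)) L.mem
    rwa [mul_right_comm, inv_mul_cancel, one_mul] at this
  obtain ⟨η, hη⟩ := he.exists_smul_eq R.isAlgGrading h1 hx hx0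
  refine ⟨η, ?_⟩
  rw [← mul_smul_comm, ← hη, ← mul_assoc, ← mul_assoc, L.mul', ← R.alg.inv_mul_right he.mem.2,
    hx.2.2]

/-- `φ(a)` lies in the same one-dimensional space `φ(e) R_s e` as `a`, and `φ² = 1`. The sign `d`
becomes the symmetry sign of the form. -/
theorem IsLink.inv_eq_smul (he : IsGradedDivIdem R.superComp e)
    (L : IsLink R.superComp e (R.alg.inv e) s a b) :
    ∃ d : F, R.alg.inv a = d • a ∧ d * d = 1 := by
  have he0 : R.alg.inv e ∈ R.alg.part 0 := R.alg.inv_mem_part he.mem.2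
  have ha : a ≠ 0 := by
    rintro rfl
    exact he.ne_zero (by rw [← L.mul, mul_zero])
  obtain ⟨d, hd⟩ := L.eq_smul R.isAlgGrading he (R.inv_mem L.mem)
    (by rw [← R.alg.inv_mul_right he.mem.2, L.right])
    (by conv_rhs => rw [← L.left, R.alg.inv_mul_left he0, R.alg.inv_inv])
  refine ⟨d, hd, ?_⟩
  have h1 := R.alg.inv_inv a
  rw [hd, map_smul, hd, smul_smul] at h1
  have h2 : (d * d) • a = (1 : F) • a := by rw [h1, one_smul]
  exact smul_left_injective F ha h2

/-- The homogeneous elements of `e R e` commute up to a sign. -/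
theorem IsLink.exists_sign (he : IsGradedDivIdem R.superComp e)
    (L : IsLink R.superComp e (R.alg.inv e) s a b) {h k : G × Multiplicative (ZMod 2)}
    {x y : R.alg.carrier} (hx : x ∈ gradedCorner R.superComp e h) (hx0 : x ≠ 0)
    (hy : y ∈ gradedCorner R.superComp e k) (hy0 : y ≠ 0) :
    ∃ d : F, x * y = d • (y * x) ∧ d * d = 1 := by
  have hxy := R.isAlgGrading.corner_mul_mem hx hy
  have hyx := R.isAlgGrading.corner_mul_mem hy hx
  have hxy0 := he.mul_ne_zero hx hx0 hy hy0
  have hyx0 := he.mul_ne_zero hy hy0 hx hx0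
  obtain ⟨p, hp⟩ := L.exists_inv_mul_eq he hx hx0
  obtain ⟨q, hq⟩ := L.exists_inv_mul_eq he hy hy0
  obtain ⟨r, hr⟩ := L.exists_inv_mul_eq he hxy hxy0
  obtain ⟨d, hd⟩ := he.exists_smul_eq R.isAlgGrading (mul_comm k h ▸ hyx) hxy hxy0
  have hd0 : d ≠ 0 := by rintro rfl; exact hyx0 (by rw [hd, zero_smul])
  have hr' : R.alg.inv (y * x) * a = r • (a * (y * x)) := by
    rw [hd, map_smul, smul_mul_assoc, hr, mul_smul_comm, smul_comm]
  set σ := zsign F (h.2.toAdd * k.2.toAdd) with hσ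
  -- Apply `z ↦ b φ(z) a` to `x y`, and below to `y x`. The latter is proportional to `x y`, so it
  -- has the same eigenvalue `r`. The two relations are mirror images, which forces the commutation
  -- factor to have square 1.
  have h1 : r • (x * y) = (σ * (p * q)) • (y * x) := by
    apply L.mul_left_cancel (by rw [mul_smul_comm, hxy.2.1]) (by rw [mul_smul_comm, hyx.2.1])
    rw [mul_smul_comm, ← hr, R.alg.inv_mul hx.1.2 hy.1.2, smul_mul_assoc, mul_assoc, hp,
      mul_smul_comm, ← mul_assoc, hq, smul_mul_assoc, smul_smul, smul_smul, mul_assoc, mul_smul_comm,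
      mul_assoc]
  have h2 : r • (y * x) = (σ * (p * q)) • (x * y) := by
    apply L.mul_left_cancel (by rw [mul_smul_comm, hyx.2.1]) (by rw [mul_smul_comm, hxy.2.1])
    rw [mul_smul_comm, ← hr', R.alg.inv_mul hy.1.2 hx.1.2, smul_mul_assoc, mul_assoc, hq,
      mul_smul_comm, ← mul_assoc, hp, smul_mul_assoc, smul_smul, smul_smul, mul_assoc, mul_smul_comm,
      mul_comm k.2.toAdd, ← hσ, mul_comm q, mul_assoc]
  rw [hd, smul_smul] at h1 h2
  have h3 := smul_left_injective F hxy0 h1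
  have h4 := smul_left_injective F hxy0 h2
  have hr0 : r ≠ 0 := by
    rintro rfl
    rw [zero_smul] at hr
    have h5 : R.alg.inv (x * y) = 0 := by
      rw [← hxy.2.1, R.alg.inv_mul_left he.mem.2, ← L.mul', ← mul_assoc, hr, zero_mul]
    exact R.alg.inv_ne_zero hxy0 h5
  refine ⟨d, ?_, ?_⟩
  all_goals
    have h6 : d * d = 1 := by
      apply mul_left_cancel₀ hr0
      rw [mul_one]
      linear_combination h3.symm + d * h4
  · rw [hd, smul_smul, h6, one_smul]
  · exact h6

/-- The nonzero homogeneous elements of `e R e` are even and their squares are scalar. -/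
theorem IsLink.mul_self_eq [NeZero (2 : F)] (hR : IsPrimeRing R.alg.carrier)
    (hcent : ∀ z : R.alg.carrier, (∀ y, z * y = y * z) → ∃ a : F, z = a • 1)
    (he : IsGradedDivIdem R.superComp e)
    (L : IsLink R.superComp e (R.alg.inv e) s a b) {h : G × Multiplicative (ZMod 2)}
    {x : R.alg.carrier} (hx : x ∈ gradedCorner R.superComp e h) (hx0 : x ≠ 0) :
    h.1 * h.1 = 1 ∧ h.2 = 1 := by
  have hxx := R.isAlgGrading.corner_mul_mem hx hx
  have hxx0 := he.mul_ne_zero hx hx0 hx hx0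
  -- Moving `x²` past a homogeneous element multiplies by the square of a sign, so `x²` is central
  -- in the corner, hence a scalar.
  obtain ⟨d, hd⟩ := he.eq_smul_of_commute R.isAlgGrading hR hcent hxx (by
    intro k y hy
    by_cases hy0 : y = 0
    · rw [hy0, mul_zero, zero_mul]
    obtain ⟨c, hc, hcc⟩ := L.exists_sign he hx hx0 hy hy0
    rw [mul_assoc, hc, mul_smul_comm, ← mul_assoc, hc, smul_mul_assoc, smul_smul, hcc, one_smul,
      mul_assoc])
  have hd0 : d ≠ 0 := by rintro rfl; exact hxx0 (by rw [hd, zero_smul])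
  have hh : h * h = 1 := R.isAlgGrading.eq_of_mem_of_mem hxx.1
    (by rw [hd]; exact Submodule.smul_mem _ _ he.mem) hxx0
  refine ⟨congrArg Prod.fst hh, ?_⟩
  obtain ⟨η, hη⟩ := L.exists_inv_mul_eq he hx hx0
  obtain ⟨l, hl, hll⟩ := L.inv_eq_smul he
  have hax0 : a * x ≠ 0 := fun h0 => hx0 (L.mul_left_cancel hx.2.1 (mul_zero e)
    (by rw [h0, mul_zero]))
  have hae0 : a ≠ 0 := by
    rintro rfl
    exact hax0 (zero_mul x)
  -- Apply the superinvolution to `x² = d e`: for odd `x` the sign rule would require `η² = -1`.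
  have h1 : zsign F (h.2.toAdd * h.2.toAdd) * (η * η) = 1 := by
    have h2 := R.alg.inv_mul hx.1.2 hx.1.2
    have h3 := congrArg (fun z => z * a) h2
    rw [hd, map_smul, smul_mul_assoc, L.left, smul_mul_assoc, mul_assoc, hη, mul_smul_comm,
      ← mul_assoc, hη, smul_mul_assoc, mul_assoc, hd, mul_smul_comm, L.right, smul_smul, smul_smul,
      smul_smul] at h3
    have h4 := smul_left_injective F hae0 h3
    apply mul_right_cancel₀ hd0
    rw [one_mul]
    linear_combination h4.symm
  -- Applying the superinvolution to `φ(x) a = η a x`, and using `φ(a) = l a`, gives `η² = 1`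
  -- regardless of parities. So `x` cannot be odd.
  have h5 : η * η = 1 := by
    have h2 := congrArg R.alg.inv hη
    rw [map_smul, R.alg.inv_mul (R.inv_mem hx.1).2 L.mem.2, R.alg.inv_mul L.mem.2 hx.1.2,
      R.alg.inv_inv, hl, mul_smul_comm, smul_mul_assoc, hη, mul_comm s.2.toAdd] at h2
    simp only [smul_smul] at h2
    have h4 := smul_left_injective F hax0 h2
    have h6 : zsign F (h.2.toAdd * s.2.toAdd) * l ≠ 0 := by
      refine mul_ne_zero (zsign_ne_zero _) ?_
      rintro rfl
      simp at hll
    apply mul_left_cancel₀ h6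
    rw [mul_one]
    linear_combination -h4
  rw [h5, mul_one] at h1
  have h6 : h.2.toAdd * h.2.toAdd = 0 := zsign_injective (F := F) (by rw [h1]; simp [zsign])
  have key : ∀ p : ZMod 2, p * p = 0 → p = 0 := by decide
  exact Multiplicative.toAdd.injective (key _ h6)

end CornerInv

/-! ### The support of the graded-division algebra -/

section Support

variable {F : Type u} [Field F] {G : Type v} [CommGroup G] {R : GradedSuperinvAlgebra.{u, w} F G}
  {e : R.alg.carrier}

/-- The elements `Y t` span the components of `e R e`, and commute as prescribed by `E`. -/
structure IsCornerFrame (R : GradedSuperinvAlgebra.{u, w} F G) (e : R.alg.carrier)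
    (E : BicharPair F G) (Y : E.T → R.alg.carrier) : Prop where
  mem : ∀ t : E.T, Y t ∈ gradedCorner R.superComp e ((t : G), 1)
  ne_zero : ∀ t, Y t ≠ 0
  comm : ∀ s t, Y s * Y t = ((E.β s t : Fˣ) : F) • (Y t * Y s)
  support : ∀ h x, x ∈ gradedCorner R.superComp e h → x ≠ 0 → h.1 ∈ E.T ∧ h.2 = 1

theorem GradedSuperinvAlgebra.corner_mul_mem {g h : G} {x y : R.alg.carrier}
    (hx : x ∈ gradedCorner R.superComp e (g, 1)) (hy : y ∈ gradedCorner R.superComp e (h, 1)) :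
    x * y ∈ gradedCorner R.superComp e (g * h, 1) := by
  have h1 := R.isAlgGrading.corner_mul_mem hx hy
  rwa [Prod.mk_mul_mk, mul_one] at h1

/-- The support of `e R e`. -/
def cornerSupport (he : IsGradedDivIdem R.superComp e) : Subgroup G where
  carrier := {g | ∃ x ∈ gradedCorner R.superComp e (g, 1), x ≠ 0}
  mul_mem' := by
    rintro g h ⟨x, hx, hx0⟩ ⟨y, hy, hy0⟩
    exact ⟨x * y, R.corner_mul_mem hx hy, he.mul_ne_zero hx hx0 hy hy0⟩
  one_mem' := ⟨e, he.mem_corner, he.ne_zero⟩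
  inv_mem' := by
    rintro g ⟨x, hx, hx0⟩
    obtain ⟨y, hy, hey, hye, hyx, -⟩ := he.exists_inv _ x hx.1 hx.2.1 hx.2.2 hx0
    refine ⟨y, ⟨?_, hey, hye⟩, ?_⟩
    · rwa [Prod.inv_mk, inv_one] at hy
    · rintro rfl
      exact he.ne_zero (by rw [← hyx, zero_mul])

theorem linearIndependent_of_corner {ι : Type*} {g : ι → G} (hg : Function.Injective g)
    {Y : ι → R.alg.carrier} (hY : ∀ i, Y i ∈ gradedCorner R.superComp e (g i, 1))
    (hY0 : ∀ i, Y i ≠ 0) : LinearIndependent F Y := by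
  have hinj : Function.Injective fun i => (g i, (1 : Multiplicative (ZMod 2))) :=
    fun i j hij => hg (congrArg Prod.fst hij)
  exact (R.isAlgGrading.indep.comp hinj).linearIndependent _ (fun i => (hY i).1) hY0

variable [IsAlgClosed F] [FiniteDimensional F R.alg.carrier] [NeZero (2 : F)]
  {s : G × Multiplicative (ZMod 2)} {a b : R.alg.carrier}

/-- `β` records the commutation signs of the one-dimensional components. An element in its radical
is central in the corner, hence a scalar multiple of `e`, hence of trivial degree; this is
nondegeneracy. -/
theorem IsLink.exists_cornerFrame (hR : IsPrimeRing R.alg.carrier)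
    (hcent : ∀ z : R.alg.carrier, (∀ y, z * y = y * z) → ∃ a : F, z = a • 1)
    (he : IsGradedDivIdem R.superComp e) (L : IsLink R.superComp e (R.alg.inv e) s a b) :
    ∃ (E : BicharPair F G) (Y : E.T → R.alg.carrier), IsCornerFrame R e E Y := by
  set T := cornerSupport he with hT
  choose Y hY hY0 using fun t : T => t.2
  have hfin : Finite T :=
    (linearIndependent_of_corner Subtype.val_injective hY hY0).finite
  choose β hβ hββ using fun s t : T => L.exists_sign he (hY s) (hY0 s) (hY t) (hY0 t)
  have hβ0 : ∀ s t, β s t ≠ 0 := by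
    intro s t h
    have := hββ s t
    simp [h] at this
  have hβ' : ∀ {s t : T} {x y : R.alg.carrier}, x ∈ gradedCorner R.superComp e ((s : G), 1) →
      y ∈ gradedCorner R.superComp e ((t : G), 1) → x * y = β s t • (y * x) := by
    intro s t x y hx hy
    obtain ⟨p, rfl⟩ := he.exists_smul_eq R.isAlgGrading hx (hY s) (hY0 s)
    obtain ⟨q, rfl⟩ := he.exists_smul_eq R.isAlgGrading hy (hY t) (hY0 t)
    rw [smul_mul_smul_comm, smul_mul_smul_comm, hβ, smul_comm, mul_comm p]
  have hmul_left : ∀ s s' t, β (s * s') t = β s t * β s' t := by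
    intro s s' t
    have h1 := he.mul_ne_zero (hY t) (hY0 t) (R.corner_mul_mem (hY s) (hY s'))
      (he.mul_ne_zero (hY s) (hY0 s) (hY s') (hY0 s'))
    apply smul_left_injective F h1
    have h2 := hβ' (s := s * s') (R.corner_mul_mem (hY s) (hY s')) (hY t)
    simp only
    rw [← h2, mul_assoc, hβ s', mul_smul_comm, ← mul_assoc, hβ s t, smul_mul_assoc, smul_smul,
      mul_comm (β s' t), mul_assoc]
  have hmul_right : ∀ t s s', β t (s * s') = β t s * β t s' := by
    intro t s s'
    have h1 := he.mul_ne_zero (R.corner_mul_mem (hY s) (hY s'))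
      (he.mul_ne_zero (hY s) (hY0 s) (hY s') (hY0 s')) (hY t) (hY0 t)
    apply smul_left_injective F h1
    have h2 := hβ' (t := s * s') (hY t) (R.corner_mul_mem (hY s) (hY s'))
    simp only
    rw [← h2, ← mul_assoc, hβ t s, smul_mul_assoc, mul_assoc, hβ t s', mul_smul_comm, smul_smul,
      mul_assoc]
  let E : BicharPair F G :=
    { T := T
      finite := hfin
      mul_self := fun t => Subtype.ext (L.mul_self_eq hR hcent he (hY t) (hY0 t)).1
      β := MonoidHom.mk' (fun s => MonoidHom.mk' (fun t => Units.mk0 (β s t) (hβ0 s t))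
        fun t t' => Units.ext (hmul_right s t t')) fun s s' =>
          MonoidHom.ext fun t => Units.ext (hmul_left s s' t)
      alternating := by
        intro t
        apply Units.ext
        change β t t = 1
        have h1 := hβ t t
        have h2 : β t t • (Y t * Y t) = (1 : F) • (Y t * Y t) := by rw [← h1, one_smul]
        exact smul_left_injective F (he.mul_ne_zero (hY t) (hY0 t) (hY t) (hY0 t)) h2
      nondegenerate := by
        intro t ht
        obtain ⟨d, hd⟩ := he.eq_smul_of_commute R.isAlgGrading hR hcent (hY t) (by
          intro k y hy
          by_cases hy0 : y = 0
          · rw [hy0, mul_zero, zero_mul]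
          have hk : k = (k.1, 1) := Prod.ext rfl (L.mul_self_eq hR hcent he hy hy0).2
          rw [hk] at hy
          have h1 : β t ⟨k.1, y, hy, hy0⟩ = 1 := congrArg Units.val (ht ⟨k.1, y, hy, hy0⟩)
          rw [hβ' (s := t) (t := ⟨k.1, y, hy, hy0⟩) (hY t) hy, h1, one_smul])
        have h1 := R.isAlgGrading.eq_of_mem_of_mem (hY t).1
          (by rw [hd]; exact Submodule.smul_mem _ d he.mem) (hY0 t)
        exact Subtype.ext (congrArg Prod.fst h1) }
  refine ⟨E, Y, hY, hY0, hβ, fun h x hx hx0 => ?_⟩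
  have h2 := (L.mul_self_eq hR hcent he hx hx0).2
  refine ⟨⟨x, ?_, hx0⟩, h2⟩
  have hk : h = (h.1, 1) := Prod.ext rfl h2
  rwa [← hk]

end Support

/-! ### Coordinates on the graded-division algebra -/

section Coordinates

/-- Commuting operators have a common eigenvector. -/
theorem exists_common_eigenvector {F V : Type*} [Field F] [IsAlgClosed F] [AddCommGroup V]
    [Module F V] [FiniteDimensional F V] {ι : Type*} (f : ι → Module.End F V)
    (hf : ∀ i j v, f i (f j v) = f j (f i v)) (S : Submodule F V) (hS : S ≠ ⊥)
    (hfS : ∀ i, ∀ v ∈ S, f i v ∈ S) : ∃ v ∈ S, v ≠ 0 ∧ ∀ i, ∃ μ : F, f i v = μ • v := by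
  -- In a minimal nonzero invariant subspace, each eigenspace of each operator is invariant by
  -- commutativity, hence is everything. Any nonzero vector will do.
  obtain ⟨W, ⟨hW0, hWS, hfW⟩, hmin⟩ := (wellFounded_lt (α := Submodule F V)).has_min
    {W | W ≠ ⊥ ∧ W ≤ S ∧ ∀ i, ∀ v ∈ W, f i v ∈ W} ⟨S, hS, le_rfl, hfS⟩
  obtain ⟨v, hv, hv0⟩ := W.ne_bot_iff.1 hW0
  refine ⟨v, hWS hv, hv0, fun i => ?_⟩
  have : Nontrivial W := ⟨⟨⟨v, hv⟩, 0, fun h => hv0 (congrArg Subtype.val h)⟩⟩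
  obtain ⟨μ, hμ⟩ := Module.End.exists_eigenvalue ((f i).restrict (hfW i))
  obtain ⟨u, hu⟩ := hμ.exists_hasEigenvector
  have h1 : f i (u : V) = μ • (u : V) := congrArg Subtype.val hu.apply_eq_smul
  refine ⟨μ, ?_⟩
  let W' : Submodule F V := W ⊓ (f i - algebraMap F (Module.End F V) μ).ker
  have hmem : ∀ x, x ∈ W' ↔ x ∈ W ∧ f i x = μ • x := by
    intro x
    simp [W', sub_eq_zero, Module.algebraMap_end_apply]
  have hle : W' ≤ W := inf_le_left
  have hW' : W' = W := by
    by_contra hne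
    refine hmin W' ⟨?_, hle.trans hWS, fun j x hx => ?_⟩ (lt_of_le_of_ne hle hne)
    · refine (Submodule.ne_bot_iff _).2 ⟨u, (hmem _).2 ⟨u.2, h1⟩, fun h => hu.2 (Subtype.ext h)⟩
    · obtain ⟨hx1, hx2⟩ := (hmem x).1 hx
      exact (hmem _).2 ⟨hfW j x hx1, by rw [hf, hx2, map_smul]⟩
  rw [← hW'] at hv
  exact ((hmem v).1 hv).2

variable {F : Type u} [Field F] {G : Type v} [CommGroup G] {R : GradedSuperinvAlgebra.{u, w} F G}
  {e : R.alg.carrier} {E : BicharPair F G}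

/-- Coordinates on `e R e`. -/
structure IsCornerCoord (R : GradedSuperinvAlgebra.{u, w} F G) (e : R.alg.carrier) (c : E.Choice)
    (ψ : c.D →ₗ[F] R.alg.carrier) : Prop where
  map_mul : ∀ x y, ψ (x * y) = ψ x * ψ y
  map_one : ψ 1 = e
  mem : ∀ g x, x ∈ c.comp g → ψ x ∈ R.superComp (g, 1)
  injective : Function.Injective ψ
  exists_eq : ∀ x, ∃ d, ψ d = e * x * e

variable [IsAlgClosed F] [FiniteDimensional F R.alg.carrier]

/-- On an isotropic subgroup, the frame can be chosen to be multiplicative. -/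
theorem IsCornerFrame.exists_normalized {Y : E.T → R.alg.carrier} (hY : IsCornerFrame R e E Y)
    (he : IsGradedDivIdem R.superComp e) (S : Subgroup E.T)
    (hS : ∀ s ∈ S, ∀ t ∈ S, E.β s t = 1) :
    ∃ μ : S → F, (∀ t, μ t ≠ 0) ∧
      ∀ s t : S, (μ s • Y s) * (μ t • Y t) = μ (s * t) • Y (s * t : S) := by
  -- The `Y t` with `t ∈ S` commute, so they have a common eigenvector in `e R`. Rescaling each of
  -- them to fix `v` makes all structure constants 1, as these can be read off from the action on
  -- `v`.
  obtain ⟨v, hv, hv0, hev⟩ := exists_common_eigenvector (fun t : S => LinearMap.mulLeft F (Y t))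
    (by
      intro s t x
      have h1 := hY.comm s t
      rw [hS s s.2 t t.2, Units.val_one, one_smul] at h1
      simp only [LinearMap.mulLeft_apply, ← mul_assoc, h1])
    (LinearMap.mulLeft F e).range
    (by
      intro h
      have h1 : e ∈ (LinearMap.mulLeft F e).range := ⟨e, he.idem⟩
      rw [h, Submodule.mem_bot] at h1
      exact he.ne_zero h1)
    (by
      rintro t _ ⟨x, rfl⟩
      exact ⟨Y t * x, by simp [← mul_assoc, (hY.mem t).2.1, (hY.mem t).2.2]⟩)
  have hv' : e * v = v := by
    obtain ⟨x, rfl⟩ := hv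
    simp [← mul_assoc, he.idem]
  choose ν hν using hev
  have hν0 : ∀ t, ν t ≠ 0 := by
    intro t h0
    obtain ⟨z, -, -, -, hz, -⟩ := he.exists_inv _ (Y t) (hY.mem t).1 (hY.mem t).2.1 (hY.mem t).2.2
      (hY.ne_zero t)
    apply hv0
    have h1 : Y t * v = 0 := by simpa [h0] using hν t
    rw [← hv', ← hz, mul_assoc, h1, mul_zero]
  refine ⟨fun t => (ν t)⁻¹, fun t => inv_ne_zero (hν0 t), fun s t => ?_⟩
  have hone : ∀ t : S, ((ν t)⁻¹ • Y t) * v = v := by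
    intro t
    have h1 : Y t * v = ν t • v := hν t
    rw [smul_mul_assoc, h1, smul_smul, inv_mul_cancel₀ (hν0 t), one_smul]
  have hm : ((ν s)⁻¹ • Y s) * ((ν t)⁻¹ • Y t) ∈ gradedCorner R.superComp e
      ((((s * t : S) : E.T) : G), 1) :=
    R.corner_mul_mem (Submodule.smul_mem _ _ (hY.mem s))
      (Submodule.smul_mem _ _ (hY.mem t))
  obtain ⟨d, hd⟩ := he.exists_smul_eq R.isAlgGrading hm (Submodule.smul_mem _ (ν (s * t))⁻¹
    (hY.mem (s * t : S))) (smul_ne_zero (inv_ne_zero (hν0 _)) (hY.ne_zero _))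
  have h2 := congrArg (fun z => z * v) hd
  rw [mul_assoc, hone, hone, smul_mul_assoc, hone] at h2
  have h3 : (1 : F) • v = d • v := by rw [one_smul]; exact h2
  have h4 := smul_left_injective F hv0 h3
  rw [hd, ← h4, one_smul]

/-- Normalized frames `P` on `A` and `Q` on `B` are multiplicative, and they commute with each other
according to `β`. So the products `Z t = P a * Q b` have exactly the structure constants of the
`X_t`. -/
theorem IsCornerFrame.exists_coord {Y : E.T → R.alg.carrier} (hY : IsCornerFrame R e E Y)
    (he : IsGradedDivIdem R.superComp e) (c : E.Choice) :
    ∃ ψ : c.D →ₗ[F] R.alg.carrier, IsCornerCoord R e c ψ := by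
  have : Fintype E.T := Fintype.ofFinite _
  obtain ⟨μ, hμ0, hμ⟩ := hY.exists_normalized he c.A c.β_A
  obtain ⟨ν, hν0, hν⟩ := hY.exists_normalized he c.B c.β_B
  let P : c.A → R.alg.carrier := fun t => μ t • Y t
  let Q : c.B → R.alg.carrier := fun t => ν t • Y t
  have hP : ∀ t : c.A, P t ∈ gradedCorner R.superComp e (((t : E.T) : G), 1) := fun t =>
    Submodule.smul_mem _ _ (hY.mem t)
  have hQ : ∀ t : c.B, Q t ∈ gradedCorner R.superComp e (((t : E.T) : G), 1) := fun t =>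
    Submodule.smul_mem _ _ (hY.mem t)
  have hP0 : ∀ t, P t ≠ 0 := fun t => smul_ne_zero (hμ0 t) (hY.ne_zero _)
  have hQ0 : ∀ t, Q t ≠ 0 := fun t => smul_ne_zero (hν0 t) (hY.ne_zero _)
  have hPP : ∀ s t, P s * P t = P (s * t) := hμ
  have hQQ : ∀ s t, Q s * Q t = Q (s * t) := hν
  have hQP : ∀ s t, Q s * P t = ((E.β t s : Fˣ) : F) • (P t * Q s) := by
    intro s t
    simp only [P, Q]
    rw [smul_mul_smul_comm, hY.comm, smul_mul_smul_comm, smul_comm, mul_comm (μ t), E.β_comm]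
  clear_value P Q
  let pA : E.T → c.A := fun t => ⟨c.fstA t, c.fstA_mem t⟩
  let pB : E.T → c.B := fun t => ⟨c.sndB t, c.sndB_mem t⟩
  have hpA : ∀ s t, pA (s * t) = pA s * pA t := fun s t => Subtype.ext (c.fstA_mul s t).1
  have hpB : ∀ s t, pB (s * t) = pB s * pB t := fun s t => Subtype.ext (c.fstA_mul s t).2
  let Z : E.T → R.alg.carrier := fun t => P (pA t) * Q (pB t)
  have hZ : ∀ t : E.T, Z t ∈ gradedCorner R.superComp e ((t : G), 1) := by
    intro t
    have h1 := R.corner_mul_mem (hP (pA t)) (hQ (pB t))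
    have h2 : ((pA t : E.T) : G) * ((pB t : E.T) : G) = t :=
      congrArg Subtype.val (c.fstA_mul_sndB t)
    rwa [h2] at h1
  have hZ0 : ∀ t, Z t ≠ 0 := fun t => he.mul_ne_zero (hP _)
    (hP0 _) (hQ _) (hQ0 _)
  have hZZ : ∀ s t, Z s * Z t = ((E.β (c.fstA t) (c.sndB s) : Fˣ) : F) • Z (s * t) := by
    intro s t
    calc Z s * Z t = P (pA s) * (Q (pB s) * P (pA t)) * Q (pB t) := by
          simp only [Z, mul_assoc]
      _ = ((E.β (c.fstA t) (c.sndB s) : Fˣ) : F) •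
          ((P (pA s) * P (pA t)) * (Q (pB s) * Q (pB t))) := by
          rw [hQP, mul_smul_comm, smul_mul_assoc]
          simp only [mul_assoc]
          rfl
      _ = _ := by
          rw [hPP, hQQ, ← hpA, ← hpB]
  have hspan : ⊤ ≤ Submodule.span F (Set.range c.X) := by
    rw [← c.isInvolutionGrading.iSup_eq_top]
    refine iSup_le fun g => Submodule.span_mono ?_
    rintro _ ⟨t, -, rfl⟩
    exact ⟨t, rfl⟩
  let Bs := Module.Basis.mk c.linearIndependent_X hspan
  let ψ : c.D →ₗ[F] R.alg.carrier := Bs.constr F Z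
  have hψX : ∀ t, ψ (c.X t) = Z t := by
    intro t
    have := Bs.constr_basis F Z t
    rwa [Module.Basis.mk_apply] at this
  have hψmul : ∀ x y, ψ (x * y) = ψ x * ψ y := by
    have h1 : (LinearMap.mul F c.D).compr₂ ψ =
        (LinearMap.mul F R.alg.carrier).compl₁₂ ψ ψ := by
      refine Bs.ext fun s => Bs.ext fun t => ?_
      simp only [Bs, Module.Basis.mk_apply, LinearMap.compr₂_apply, LinearMap.mul_apply',
        LinearMap.compl₁₂_apply, hψX, hZZ, c.X_mul_X, map_smul]
    exact fun x y => LinearMap.congr_fun (LinearMap.congr_fun h1 x) y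
  have hψ1 : ψ 1 = e := by
    obtain ⟨d, hd⟩ := he.exists_smul_eq R.isAlgGrading (x := Z 1) (hZ 1) he.mem_corner he.ne_zero
    have h1 := hψmul 1 1
    rw [mul_one, ← c.X_one, hψX, hd, smul_mul_smul_comm, he.idem] at h1
    have h2 := smul_left_injective F he.ne_zero h1
    have hd0 : d ≠ 0 := by rintro rfl; exact hZ0 1 (by rw [hd, zero_smul])
    have h3 : d = 1 := (mul_eq_left₀ hd0).1 h2.symm
    rw [← c.X_one, hψX, hd, h3, one_smul]
  refine ⟨ψ, hψmul, hψ1, fun g x hx => ?_, ?_, ?_⟩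
  · by_cases hg : g ∈ E.T
    · obtain ⟨d, rfl⟩ := (c.mem_comp_iff' hg).1 hx
      rw [map_smul, hψX]
      exact Submodule.smul_mem _ _ (hZ ⟨g, hg⟩).1
    · rw [c.eq_zero_of_mem_comp hg hx, map_zero]
      exact zero_mem _
  · rw [injective_iff_map_eq_zero]
    intro x hx
    rw [Module.Basis.constr_apply_fintype] at hx
    have h1 := Fintype.linearIndependent_iff.1
      (linearIndependent_of_corner Subtype.val_injective hZ hZ0) _ hx
    exact Bs.equivFun.map_eq_zero_iff.1 (funext h1)
  · refine mem_iSup_induction R.isAlgGrading.iSup_eq_top (fun h x hx => ?_)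
      ⟨0, by simp⟩ ?_
    · by_cases hx0 : e * x * e = 0
      · exact ⟨0, by rw [hx0, map_zero]⟩
      have hx' : e * x * e ∈ gradedCorner R.superComp e h := by
        refine ⟨?_, by rw [← mul_assoc, ← mul_assoc, he.idem], by rw [mul_assoc, he.idem]⟩
        simpa using R.isAlgGrading.mul_mem (R.isAlgGrading.mul_mem he.mem hx) he.mem
      obtain ⟨h1, h2⟩ := hY.support h _ hx' hx0
      have hh : h = (h.1, 1) := Prod.ext rfl h2
      rw [hh] at hx'
      obtain ⟨d, hd⟩ := he.exists_smul_eq R.isAlgGrading hx' (hZ ⟨h.1, h1⟩) (hZ0 _)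
      exact ⟨d • c.X ⟨h.1, h1⟩, by rw [map_smul, hψX, hd]⟩
    · rintro x y ⟨d, hd⟩ ⟨d', hd'⟩
      exact ⟨d + d', by rw [map_add, hd, hd', mul_add, add_mul]⟩

end Coordinates

/-! ### Presentations of graded superalgebras with superinvolution -/

section CoordLink

variable {F : Type u} [Field F] {G : Type v} [CommGroup G] {R : GradedSuperinvAlgebra.{u, w} F G}
  {e : R.alg.carrier} {E : BicharPair F G} {c : E.Choice} {ψ : c.D →ₗ[F] R.alg.carrier}

theorem IsCornerCoord.left (hψ : IsCornerCoord R e c ψ) (d : c.D) : e * ψ d = ψ d := by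
  rw [← hψ.map_one, ← hψ.map_mul, one_mul]

theorem IsCornerCoord.right (hψ : IsCornerCoord R e c ψ) (d : c.D) : ψ d * e = ψ d := by
  rw [← hψ.map_one, ← hψ.map_mul, mul_one]

theorem IsCornerCoord.mem_corner (hψ : IsCornerCoord R e c ψ) (t : E.T) :
    ψ (c.X t) ∈ gradedCorner R.superComp e ((t : G), 1) :=
  ⟨hψ.mem _ _ (c.X_mem t rfl), hψ.left _, hψ.right _⟩

theorem IsCornerCoord.ne_zero (hψ : IsCornerCoord R e c ψ) (t : E.T) : ψ (c.X t) ≠ 0 :=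
  (map_ne_zero_iff ψ hψ.injective).2 (c.X_ne_zero t)

theorem IsCornerCoord.even (hψ : IsCornerCoord R e c ψ) : ∀ d, ψ d ∈ R.alg.part 0 :=
  mem_iSup_induction c.isInvolutionGrading.iSup_eq_top (fun g d hd => (hψ.mem g d hd).2)
    (by rw [map_zero]; exact zero_mem _)
    fun x y hx hy => by rw [map_add]; exact add_mem hx hy

/-- Transposing the product rule for `X_s X_t` shows that `η` is a quadratic function with
polarization `β`. Any two such functions differ by a character. -/
theorem BicharPair.Choice.η_mul (c : E.Choice) (s t : E.T) :
    c.η (s * t) * ((E.β (c.fstA t) (c.sndB s) : Fˣ) : F) =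
      c.η s * c.η t * ((E.β (c.fstA s) (c.sndB t) : Fˣ) : F) := by
  have h1 := (congrArg c.transposition.map (c.X_mul_X s t)).symm
  rw [c.transposition.map_mul, map_smul, c.transposition_X, c.transposition_X, c.transposition_X,
    smul_mul_smul_comm, c.X_mul_X, smul_smul, smul_smul, mul_comm t s] at h1
  have h2 := smul_left_injective F (c.X_ne_zero (s * t)) h1
  linear_combination h2

/-- The link between `e` and its image under the superinvolution can be chosen so that the
superinvolution induces the transposition. -/
theorem IsCornerCoord.exists_link [IsAlgClosed F] [FiniteDimensional F R.alg.carrier]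
    [NeZero (2 : F)] (hψ : IsCornerCoord R e c ψ) (he : IsGradedDivIdem R.superComp e)
    (hR : IsPrimeRing R.alg.carrier) :
    ∃ s a b, IsLink R.superComp e (R.alg.inv e) s a b ∧
      ∀ d, R.alg.inv (ψ d) * a = a * ψ (c.transposition.map d) := by
  obtain ⟨s, a, b, L⟩ := he.exists_link hR R.isAlgGrading he.inv
  choose η hη using fun t => L.exists_inv_mul_eq he (hψ.mem_corner t) (hψ.ne_zero t)
  have ha0 : ∀ t, a * ψ (c.X t) ≠ 0 := fun t h0 => hψ.ne_zero t
    (L.mul_left_cancel (hψ.left _) (mul_zero e) (by rw [h0, mul_zero]))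
  -- The local `η` describes the involution induced by the superinvolution and `c.η` the
  -- transposition. Both are quadratic with the same polarization, so their product is a character.
  have hmul : ∀ q r, η (q * r) * c.η (q * r) = η q * c.η q * (η r * c.η r) := by
    intro q r
    have h1 : R.alg.inv (ψ (c.X q * c.X r)) * a = (η q * η r) • (a * ψ (c.X r * c.X q)) := by
      rw [hψ.map_mul, R.alg.inv_mul_left (hψ.even _), mul_assoc, hη, mul_smul_comm, ← mul_assoc, hη,
        smul_mul_assoc, smul_smul, mul_assoc, ← hψ.map_mul]
    rw [c.X_mul_X, c.X_mul_X, map_smul, map_smul, map_smul, smul_mul_assoc, hη, mul_smul_comm,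
      smul_smul, smul_smul, mul_comm r q] at h1
    have h2 := smul_left_injective F (ha0 (q * r)) h1
    have h3 := c.η_mul q r
    have h4 : ((E.β (c.fstA r) (c.sndB q) : Fˣ) : F) * (E.β (c.fstA r) (c.sndB q) : Fˣ) = 1 := by
      rw [← Units.val_mul, E.β_mul_self, Units.val_one]
    have h5 : ((E.β (c.fstA q) (c.sndB r) : Fˣ) : F) * (E.β (c.fstA q) (c.sndB r) : Fˣ) = 1 := by
      rw [← Units.val_mul, E.β_mul_self, Units.val_one]
    set x := ((E.β (c.fstA r) (c.sndB q) : Fˣ) : F)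
    set y := ((E.β (c.fstA q) (c.sndB r) : Fˣ) : F)
    calc η (q * r) * c.η (q * r) = (x * η (q * r)) * (c.η (q * r) * x) := by
          linear_combination -η (q * r) * c.η (q * r) * h4
      _ = (η q * η r * y) * (c.η q * c.η r * y) := by rw [h2, h3]
      _ = _ := by linear_combination η q * η r * c.η q * c.η r * h5
  have hη0 : ∀ t, η t * c.η t ≠ 0 := by
    intro t h0
    rcases mul_eq_zero.1 h0 with h1 | h1
    · have h2 := hη t
      rw [h1, zero_smul] at h2
      refine R.alg.inv_ne_zero (hψ.ne_zero t) ?_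
      rw [← hψ.left, R.alg.inv_mul_left he.mem.2, ← L.mul', ← mul_assoc, h2, zero_mul]
    · exact c.η_ne_zero t h1
  let χ : E.T →* F :=
    { toFun := fun t => η t * c.η t
      map_one' := by
        have := hmul 1 1
        rw [mul_one] at this
        exact (mul_eq_left₀ (hη0 1)).1 this.symm
      map_mul' := hmul }
  -- Replacing `a` by `a X_q` twists the induced involution by `β(q, ·)`, which cancels this
  -- character.
  obtain ⟨q, hq⟩ := E.exists_eq_β χ.toHomUnits
  have hq' : ∀ t, η t * c.η t = E.β q t := fun t => congrArg Units.val (hq t)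
  have hqX : ψ (c.X q) * ψ (c.X q) = c.η q • e := by
    rw [← hψ.map_mul, c.X_mul_self, map_smul, hψ.map_one]
  have hqinv : (((q : G), 1) : G × Multiplicative (ZMod 2))⁻¹ = ((q : G), 1) :=
    Prod.ext (congrArg Subtype.val (E.inv_eq q)) inv_one
  refine ⟨s * ((q : G), 1), a * ψ (c.X q), (c.η q • ψ (c.X q)) * b, ⟨?_, ?_, ?_, ?_, ?_, ?_, ?_, ?_⟩,
    ?_⟩
  · exact R.isAlgGrading.mul_mem L.mem (hψ.mem_corner q).1
  · rw [mul_inv, mul_comm, hqinv]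
    exact R.isAlgGrading.mul_mem (Submodule.smul_mem _ _ (hψ.mem_corner q).1) L.mem'
  · rw [← mul_assoc, L.left]
  · rw [mul_assoc, hψ.right]
  · rw [← mul_assoc, mul_smul_comm, hψ.left]
  · rw [mul_assoc, L.right']
  · rw [mul_assoc, ← mul_assoc b, L.mul, hψ.left, smul_mul_assoc, hqX, smul_smul, c.η_mul_self,
      one_smul]
  · rw [mul_assoc, ← mul_assoc (ψ _), mul_smul_comm, hqX, smul_smul, c.η_mul_self, one_smul, L.left',
      L.mul']
  · have hX : ∀ t, R.alg.inv (ψ (c.X t)) * (a * ψ (c.X q)) =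
        a * ψ (c.X q) * ψ (c.transposition.map (c.X t)) := by
      intro t
      have h1 : η t * ((E.β t q : Fˣ) : F) = c.η t := by
        rw [E.β_comm, ← hq']
        have h2 : (η t * c.η t) * (η t * c.η t) = 1 := by
          rw [hq', ← Units.val_mul, E.β_mul_self, Units.val_one]
        have h3 := c.η_mul_self t
        linear_combination c.η t * h2 - c.η t * η t * η t * h3
      rw [← mul_assoc, hη, smul_mul_assoc, mul_assoc, mul_assoc, ← hψ.map_mul, ← hψ.map_mul,
        c.X_mul_comm, map_smul, mul_smul_comm, smul_smul, h1, c.transposition_X, mul_smul_comm,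
        map_smul, mul_smul_comm]
    refine mem_iSup_induction c.isInvolutionGrading.iSup_eq_top (fun g d hd => ?_) (by simp) ?_
    · by_cases hg : g ∈ E.T
      · obtain ⟨x, rfl⟩ := (c.mem_comp_iff' hg).1 hd
        rw [map_smul, map_smul, map_smul, map_smul, smul_mul_assoc, hX, mul_smul_comm]
      · rw [c.eq_zero_of_mem_comp hg hd]
        simp
    · intro x y hx hy
      simp only [map_add, add_mul, mul_add, hx, hy]

end CoordLink

/-! ### Matrices of the elements of `R` and of the form on `R e`. -/

section CoordPresentation

variable {F : Type u} [Field F] {G : Type v} [CommGroup G] {R : GradedSuperinvAlgebra.{u, w} F G}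
  {e : R.alg.carrier} {E : BicharPair F G} {c : E.Choice} {ψ : c.D →ₗ[F] R.alg.carrier}
  {n : ℕ} {g : Fin n → G × Multiplicative (ZMod 2)} {u u' : Fin n → R.alg.carrier}

/-- The matrices of the elements of `R`, with respect to a homogeneous basis of the right
`e R e`-module `R e`. -/
theorem IsCornerCoord.exists_algEquiv (hψ : IsCornerCoord R e c ψ)
    (hu : IsPartialBasis R.superComp e g u u') (hsum : ∑ i, u i * u' i = 1) :
    ∃ f : R.alg.carrier ≃ₐ[F] Matrix (Fin n) (Fin n) c.D,
      ∀ x i j, ψ (f x i j) = u' i * x * u j := by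
  have hex : ∀ x i j, ∃ d, ψ d = u' i * x * u j := by
    intro x i j
    obtain ⟨d, hd⟩ := hψ.exists_eq (u' i * x * u j)
    refine ⟨d, hd.trans ?_⟩
    rw [mul_assoc, mul_assoc _ (u j), hu.right, ← mul_assoc, ← mul_assoc, hu.left]
  choose f hf using hex
  have hsum' : ∀ x y, x * y = ∑ k, x * u k * (u' k * y) := by
    intro x y
    calc x * y = x * (∑ k, u k * u' k) * y := by rw [hsum, mul_one]
      _ = _ := by
        rw [Finset.mul_sum, Finset.sum_mul]
        simp only [mul_assoc]
  have hfM : ∀ M : Matrix (Fin n) (Fin n) c.D, Matrix.of (f (∑ k, ∑ l, u k * ψ (M k l) * u' l)) = M := by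
    intro M
    ext1 i j
    apply hψ.injective
    rw [Matrix.of_apply, hf, Finset.mul_sum, Finset.sum_mul, Finset.sum_eq_single i,
      Finset.mul_sum, Finset.sum_mul, Finset.sum_eq_single j]
    · calc u' i * (u i * ψ (M i j) * u' j) * u j = (u' i * u i) * ψ (M i j) * (u' j * u j) := by
            simp only [mul_assoc]
        _ = _ := by rw [hu.mul, hu.mul, if_pos rfl, if_pos rfl, hψ.left, hψ.right]
    · intro l _ hl
      calc u' i * (u i * ψ (M i l) * u' l) * u j = (u' i * u i) * ψ (M i l) * (u' l * u j) := by
            simp only [mul_assoc]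
        _ = _ := by rw [hu.mul l j, if_neg hl, mul_zero]
    · simp
    · intro k _ hk
      rw [Finset.mul_sum, Finset.sum_mul]
      refine Finset.sum_eq_zero fun l _ => ?_
      calc u' i * (u k * ψ (M k l) * u' l) * u j = (u' i * u k) * ψ (M k l) * (u' l * u j) := by
            simp only [mul_assoc]
        _ = _ := by rw [hu.mul i k, if_neg (Ne.symm hk), zero_mul, zero_mul]
    · simp
  refine ⟨
    { toFun := fun x => Matrix.of (f x)
      invFun := fun M => ∑ k, ∑ l, u k * ψ (M k l) * u' l
      left_inv := fun x => ?_
      right_inv := hfM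
      map_mul' := fun x y => ?_
      map_add' := fun x y => ?_
      commutes' := fun r => ?_ }, hf⟩
  · simp only [Matrix.of_apply, hf]
    conv_rhs => rw [← one_mul x, ← hsum, Finset.sum_mul]
    refine Finset.sum_congr rfl fun k _ => ?_
    conv_rhs => rw [← mul_one (u k * u' k * x), ← hsum, Finset.mul_sum]
    simp only [mul_assoc]
  · ext1 i j
    apply hψ.injective
    rw [Matrix.mul_apply, map_sum]
    simp only [Matrix.of_apply, hψ.map_mul, hf]
    rw [← mul_assoc, mul_assoc (u' i * x), hsum']
    simp only [mul_assoc]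
  · ext1 i j
    apply hψ.injective
    rw [Matrix.add_apply, map_add]
    simp only [Matrix.of_apply, hf, mul_add, add_mul]
  · ext1 i j
    apply hψ.injective
    rw [Matrix.of_apply, hf, Matrix.algebraMap_matrix_apply, Algebra.algebraMap_eq_smul_one,
      mul_smul_comm, mul_one, smul_mul_assoc, hu.mul]
    split_ifs
    · rw [Algebra.algebraMap_eq_smul_one, map_smul, hψ.map_one]
    · rw [smul_zero, map_zero]

variable {s : G × Multiplicative (ZMod 2)} {a b : R.alg.carrier}

/-- The form on `U = R e` is `B(u, v) = b φ(u) v`. Equivalently `a B(u, v) = φ(u) v`, because `a b =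
φ(e)` acts as the identity on `φ(u)`. -/
theorem IsLink.exists_formMatrix (L : IsLink R.superComp e (R.alg.inv e) s a b)
    (he : IsGradedDivIdem R.superComp e) (hψ : IsCornerCoord R e c ψ)
    (hu : IsPartialBasis R.superComp e g u u') :
    ∃ Φ : Matrix (Fin n) (Fin n) c.D, ∀ i j, a * ψ (Φ i j) = R.alg.inv (u i) * u j := by
  have hex : ∀ i j, ∃ d, a * ψ d = R.alg.inv (u i) * u j := by
    intro i j
    obtain ⟨d, hd⟩ := hψ.exists_eq (b * R.alg.inv (u i) * u j)
    refine ⟨d, ?_⟩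
    rw [hd, mul_assoc, mul_assoc _ (u j), hu.right, ← mul_assoc, L.right, ← mul_assoc, ← mul_assoc,
      L.mul', ← R.alg.inv_mul_right he.mem.2, hu.right]
  choose Φ hΦ using hex
  exact ⟨Matrix.of Φ, hΦ⟩

variable {Φ : Matrix (Fin n) (Fin n) c.D} {f : R.alg.carrier ≃ₐ[F] Matrix (Fin n) (Fin n) c.D}

/-- The degree `s⁻¹` of the form is that of `b`. Its symmetry comes from applying `φ` to `a B(u, v)
= φ(u) v`, with `φ(a) = d a`. It is nondegenerate because a vector killed by all `φ(u i)` is killed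
by `φ(1) = 1`, which is a sum of terms `± φ(u' i) φ(u i)`. -/
theorem IsCornerCoord.isHermitianForm (hψ : IsCornerCoord R e c ψ)
    (L : IsLink R.superComp e (R.alg.inv e) s a b)
    (hL : ∀ d, R.alg.inv (ψ d) * a = a * ψ (c.transposition.map d))
    (hu : IsPartialBasis R.superComp e g u u') (hsum : ∑ i, u i * u' i = 1)
    (hΦ : ∀ i j, a * ψ (Φ i j) = R.alg.inv (u i) * u j) {d : F} (hd : R.alg.inv a = d • a) :
    IsHermitianForm c (fun i => (g i).2.toAdd) (fun i => (g i).1) (s.1⁻¹, s.2⁻¹.toAdd) d Φ where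
  homog i j := by
    have h0 : ψ (Φ i j) = b * (R.alg.inv (u i) * u j) := by
      rw [← hΦ, ← mul_assoc, L.mul, hψ.left]
    have h1 : ψ (Φ i j) ∈ R.superComp (s⁻¹ * (g i * g j)) := by
      rw [h0]
      exact R.isAlgGrading.mul_mem L.mem' (R.isAlgGrading.mul_mem (R.inv_mem (hu.mem i)) (hu.mem j))
    constructor
    · refine mem_of_map_mem c.isInvolutionGrading.indep c.isInvolutionGrading.iSup_eq_top
        R.grading.indep R.grading.iSup_eq_top ψ hψ.injective (fun h x hx => (hψ.mem h x hx).1) ?_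
      have h2 : ((g i).1)⁻¹⁻¹ * s.1⁻¹ * (g j).1 = s.1⁻¹ * ((g i).1 * (g j).1) := by
        rw [inv_inv, mul_comm (g i).1, mul_assoc]
      exact (congrArg (fun z => ψ (Φ i j) ∈ R.grading.comp z) h2).mpr h1.1
    · intro hij
      by_contra hne
      apply hij
      have h2 := (map_ne_zero_iff ψ hψ.injective).2 hne
      have h3 : s⁻¹.2 * ((g i).2 * (g j).2) = 1 := by
        have h4 : ψ (Φ i j) ∈ R.superComp ((s⁻¹ * (g i * g j)).1, 1) := ⟨h1.1, hψ.even _⟩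
        exact congrArg Prod.snd (R.isAlgGrading.eq_of_mem_of_mem h1 h4 h2)
      have h5 := congrArg Multiplicative.toAdd h3
      have key : ∀ p q r : ZMod 2, p + (q + r) = 0 → q + r = p := by decide
      exact key _ _ _ h5
  herm i j := by
    apply hψ.injective
    apply L.mul_left_cancel (hψ.left _) (hψ.left _)
    have h1 : R.alg.inv (R.alg.inv (u j) * u i) =
        zsign F ((g j).2.toAdd * (g i).2.toAdd) • (R.alg.inv (u i) * u j) := by
      rw [R.alg.inv_mul (R.inv_mem (hu.mem j)).2 (hu.mem i).2, R.alg.inv_inv]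
    rw [← hΦ, R.alg.inv_mul_right (hψ.even _), hd, mul_smul_comm, hL] at h1
    rw [hΦ, map_smul, mul_smul_comm, mul_comm d, mul_smul, h1, smul_smul, mul_comm (g i).2.toAdd,
      zsign_mul_self, one_smul]
  isUnit := by
    have hinj : ∀ M : Matrix (Fin n) (Fin n) c.D, Φ * M = 0 → M = 0 := by
      intro M hM
      ext1 k j
      have h1 : ∀ i, R.alg.inv (u i) * ∑ k, u k * ψ (M k j) = 0 := by
        intro i
        have h2 := congrFun (congrFun hM i) j
        rw [Matrix.mul_apply, Matrix.zero_apply] at h2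
        have h3 := congrArg (fun z => a * ψ z) h2
        simp only [map_sum, hψ.map_mul, Finset.mul_sum, map_zero, mul_zero] at h3
        rw [Finset.mul_sum, ← h3]
        refine Finset.sum_congr rfl fun l _ => ?_
        rw [← mul_assoc, ← hΦ, mul_assoc]
      have h2 : ∑ k, u k * ψ (M k j) = 0 := by
        have h3 : R.alg.inv 1 = 1 := by
          have h4 := R.alg.inv_mul_left (x := (1 : R.alg.carrier))
            (one_mem_of_grading R.isAlgGrading.indep R.isAlgGrading.iSup_eq_top
              R.isAlgGrading.mul_mem).2 (R.alg.inv 1)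
          rw [one_mul, R.alg.inv_inv, one_mul] at h4
          exact h4.symm
        rw [← one_mul (∑ k, u k * ψ (M k j)), ← h3, ← hsum, map_sum, Finset.sum_mul]
        refine Finset.sum_eq_zero fun i _ => ?_
        rw [R.alg.inv_mul (hu.mem i).2 (hu.mem' i).2, smul_mul_assoc, mul_assoc, h1, mul_zero,
          smul_zero]
      apply hψ.injective
      have h3 := congrArg (fun z => u' k * z) h2
      simp only [Finset.mul_sum, mul_zero] at h3
      rw [Finset.sum_eq_single k] at h3
      · rwa [← mul_assoc, hu.mul, if_pos rfl, hψ.left, ← map_zero ψ] at h3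
      · intro l _ hl
        rw [← mul_assoc, hu.mul, if_neg (Ne.symm hl), zero_mul]
      · simp
    have hi : Function.Injective (LinearMap.mulLeft F Φ) := by
      rw [injective_iff_map_eq_zero]
      exact hinj
    obtain ⟨N, hN⟩ := (LinearMap.injective_iff_surjective.1 hi) 1
    have hN' : Φ * N = 1 := hN
    refine ⟨⟨Φ, N, hN', ?_⟩, rfl⟩
    have : Φ * (N * Φ - 1) = 0 := by rw [mul_sub, ← mul_assoc, hN']; simp
    exact sub_eq_zero.1 (hinj _ this)

/-- An entry of the wrong parity would be an odd element of the even algebra `D`, hence zero. The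
adjunction formula is `φ(x u) = ± φ(u) φ(x)` expanded by means of `∑ u k * u' k = 1`. -/
theorem IsCornerCoord.isPresentation (hψ : IsCornerCoord R e c ψ)
    (L : IsLink R.superComp e (R.alg.inv e) s a b)
    (hL : ∀ d, R.alg.inv (ψ d) * a = a * ψ (c.transposition.map d))
    (hu : IsPartialBasis R.superComp e g u u') (hsum : ∑ i, u i * u' i = 1)
    (hΦ : ∀ i j, a * ψ (Φ i j) = R.alg.inv (u i) * u j)
    (hf : ∀ x i j, ψ (f x i j) = u' i * x * u j) :
    IsPresentation c (fun i => (g i).2.toAdd) (fun i => (g i).1) Φ f := by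
  have hpart : ∀ p x, x ∈ R.alg.part p → f x ∈ matrixPart F (fun i => (g i).2.toAdd) p := by
    intro p x hx i j hij
    have h1 : ψ (f x i j) ∈ R.alg.part (-(g i).2.toAdd + p + (g j).2.toAdd) := by
      rw [hf]
      exact R.alg.mul_mem_part (R.alg.mul_mem_part (hu.mem' i).2 hx) (hu.mem j).2
    have key : ∀ q p r : ZMod 2, q + r ≠ p → -q + p + r = 1 := by decide
    rw [key _ _ _ hij] at h1
    apply hψ.injective
    rw [map_zero]
    exact (Submodule.disjoint_def.1 R.alg.isCompl_part.disjoint) _ (hψ.even _) h1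
  refine ⟨hpart, fun k x hx i j => ?_, ?_⟩
  · refine mem_of_map_mem c.isInvolutionGrading.indep c.isInvolutionGrading.iSup_eq_top
      R.grading.indep R.grading.iSup_eq_top ψ hψ.injective (fun h x hx => (hψ.mem h x hx).1) ?_
    rw [hf]
    exact R.grading.mul_mem (R.grading.mul_mem (hu.mem' i).1 hx) (hu.mem j).1
  refine R.alg.part_induction (fun p x hx => ?_) fun x y hx hy => by
    simp only [map_add, mul_add, add_mul, hx, hy]
  ext1 i j
  apply hψ.injective
  apply L.mul_left_cancel (hψ.left _) (hψ.left _)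
  have h1 : a * ψ ((Φ * f (R.alg.inv x)) i j) = R.alg.inv (u i) * R.alg.inv x * u j := by
    rw [Matrix.mul_apply, map_sum, Finset.mul_sum]
    simp only [hψ.map_mul, ← mul_assoc, hΦ, hf]
    calc ∑ k, R.alg.inv (u i) * u k * u' k * R.alg.inv x * u j =
        R.alg.inv (u i) * (∑ k, u k * u' k) * R.alg.inv x * u j := by
          simp only [Finset.mul_sum, Finset.sum_mul, mul_assoc]
      _ = _ := by rw [hsum, mul_one]
  have h2 : ∀ k, a * ψ (superTranspose c.transposition (fun i => (g i).2.toAdd) (f x) i k * Φ k j) =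
      zsign F (p * (g i).2.toAdd) • (R.alg.inv (u k * u' k * x * u i) * u j) := by
    intro k
    simp only [superTranspose, LinearMap.coe_mk, AddHom.coe_mk, Matrix.of_apply]
    rw [smul_mul_assoc, map_smul, mul_smul_comm, hψ.map_mul, ← mul_assoc, ← hL, mul_assoc, hΦ,
      ← mul_assoc, ← R.alg.inv_mul_right (hψ.even _), hf, ← mul_assoc, ← mul_assoc]
    by_cases hk : (g k).2.toAdd + (g i).2.toAdd = p
    · rw [add_comm (g i).2.toAdd, hk]
    · have h3 := hf x k i
      rw [hpart p x hx k i hk, map_zero] at h3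
      have h4 : u k * u' k * x * u i = 0 := by
        rw [mul_assoc, mul_assoc, ← mul_assoc (u' k), ← h3, mul_zero]
      rw [h4, map_zero, zero_mul, smul_zero, smul_zero]
  rw [h1, Matrix.mul_apply, map_sum, Finset.mul_sum]
  simp only [h2]
  rw [← Finset.smul_sum, ← Finset.sum_mul, ← map_sum, ← Finset.sum_mul, ← Finset.sum_mul, hsum,
    one_mul, R.alg.inv_mul hx (hu.mem i).2, smul_mul_assoc, smul_smul, zsign_mul_self, one_smul]

end CoordPresentation

/-! ### Existence of presentations. -/

section Structure

variable {F : Type u} [Field F] {G : Type v} [CommGroup G] [IsAlgClosed F] [NeZero (2 : F)]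

/-- Graded central simple superalgebras with superinvolution have presentations. -/
theorem GradedSuperinvAlgebra.exists_presentation (R : GradedSuperinvAlgebra.{u, w} F G)
    [FiniteDimensional F R.alg.carrier] [Nontrivial R.alg.carrier] (hR : IsPrimeRing R.alg.carrier)
    (hcent : ∀ z : R.alg.carrier, (∀ y, z * y = y * z) → ∃ a : F, z = a • 1) :
    ∃ E : BicharPair F G, ∀ c : E.Choice, ∃ (n : ℕ) (par : Fin n → ZMod 2) (γ : Fin n → G)
      (g₀ : G × ZMod 2) (Φ : Matrix (Fin n) (Fin n) c.D)
      (f : R.alg.carrier ≃ₐ[F] Matrix (Fin n) (Fin n) c.D),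
      IsPresentation c par γ Φ f ∧ IsHermitianForm c par γ g₀ 1 Φ := by
  obtain ⟨e, he⟩ := R.isAlgGrading.exists_isGradedDivIdem hR
  obtain ⟨s₀, a₀, b₀, L₀⟩ := he.exists_link hR R.isAlgGrading he.inv
  obtain ⟨E, Y, hY⟩ := L₀.exists_cornerFrame hR hcent he
  refine ⟨E, fun c => ?_⟩
  obtain ⟨ψ, hψ⟩ := hY.exists_coord he c
  obtain ⟨s, a, b, L, hL⟩ := hψ.exists_link he hR
  obtain ⟨n, g, u, u', hu, hsum⟩ := he.exists_basis R.isAlgGrading hR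
  obtain ⟨f, hf⟩ := hψ.exists_algEquiv hu hsum
  obtain ⟨Φ, hΦ⟩ := L.exists_formMatrix he hψ hu
  obtain ⟨d, hd, hdd⟩ := L.inv_eq_smul he
  have h1 := hψ.isPresentation L hL hu hsum hΦ hf
  have h2 := hψ.isHermitianForm L hL hu hsum hΦ hd
  rcases mul_self_eq_one_iff.1 hdd with rfl | rfl
  · exact ⟨n, _, _, _, Φ, f, h1, h2⟩
  -- For `d = -1` the parities of the basis are exchanged, which makes the form Hermitian without
  -- changing the algebra.
  · have h3 := h2.parityShift
    rw [neg_neg] at h3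
    exact ⟨n, _, _, _, _, f, h1.parityShift, h3⟩

end Structure

/-! ### The parity of the form -/

section FormParity

variable {F : Type u} [Field F]

/-- The parity of the form is determined by the action of the superinvolution on the element
which induces the parity automorphism. -/
def SuperinvAlgebra.HasFormParity (R : SuperinvAlgebra.{u, w} F) (p₀ : ZMod 2) : Prop :=
  ∃ S : R.carrier, S * S = 1 ∧ (∀ p, ∀ x ∈ R.part p, S * x = zsign F p • (x * S)) ∧
    R.inv S = zsign F p₀ • S

/-- Two elements inducing the parity automorphism differ by a central factor, that is, by a scalar.
So the superinvolution acts on both with the same sign. -/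
theorem SuperinvAlgebra.HasFormParity.unique [NeZero (2 : F)] {R : SuperinvAlgebra.{u, w} F}
    [Nontrivial R.carrier]
    (hcent : ∀ z : R.carrier, (∀ y, z * y = y * z) → ∃ a : F, z = a • 1) {p q : ZMod 2}
    (hp : R.HasFormParity p) (hq : R.HasFormParity q) : p = q := by
  obtain ⟨S, hS, hSx, hSi⟩ := hp
  obtain ⟨S', hS', hSx', hSi'⟩ := hq
  obtain ⟨a, ha⟩ := hcent (S * S') (R.part_induction (fun p x hx => by
    rw [mul_assoc, hSx' p x hx, mul_smul_comm, ← mul_assoc, hSx p x hx, smul_mul_assoc, smul_smul,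
      zsign_mul_self, one_smul, mul_assoc]) fun x y hx hy => by rw [mul_add, add_mul, hx, hy])
  have h1 : S = a • S' := by
    rw [← mul_one S, ← hS', ← mul_assoc, ha, smul_mul_assoc, one_mul]
  have hS0 : S ≠ 0 := by
    rintro rfl
    rw [mul_zero] at hS
    exact zero_ne_one hS
  have h2 : zsign F p • S = zsign F q • S := by
    rw [← hSi, h1, map_smul, hSi', smul_comm]
  exact zsign_injective (smul_left_injective F hS0 h2)

variable {D : Type v} [Ring D] [Algebra F D] {ι : Type*} [Fintype ι] [DecidableEq ι]
  {φ₀ : AlgInvolution F D} {par : ι → ZMod 2} {p₀ : ZMod 2} {Φ : Matrix ι ι D}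

theorem superTranspose_signDiag (φ₀ : AlgInvolution F D) (par : ι → ZMod 2) :
    superTranspose φ₀ par (signDiag F D par) = signDiag F D par := by
  ext i j
  simp only [superTranspose, signDiag, LinearMap.coe_mk, AddHom.coe_mk, Matrix.of_apply]
  by_cases h : i = j
  · subst h
    rw [Matrix.diagonal_apply_eq, CharTwo.add_self_eq_zero, zero_mul, zsign, if_pos rfl, one_smul,
      Algebra.algebraMap_eq_smul_one, map_smul, φ₀.map_one]
  · rw [Matrix.diagonal_apply_ne _ h, Matrix.diagonal_apply_ne _ (Ne.symm h), map_zero, smul_zero]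

/-- The diagonal of signs is fixed by the supertranspose, and a matrix of parity `p₀` commutes with
it up to `(-1)^p₀`. -/
theorem eq_smul_signDiag (hΦ : Φ ∈ matrixPart F par p₀) (hu : IsUnit Φ) {X : Matrix ι ι D}
    (hX : Φ * X = superTranspose φ₀ par (signDiag F D par) * Φ) :
    X = zsign F p₀ • signDiag F D par := by
  apply hu.mul_left_cancel
  rw [hX, superTranspose_signDiag, mul_smul_comm]
  exact signDiag_mul par hΦ

theorem matrixSuperinv_hasFormParity [NeZero (2 : F)] (h : IsSuperHermitian φ₀ par p₀ Φ) :
    (matrixSuperinv h).HasFormParity p₀ :=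
  ⟨signDiag F D par, signDiag_mul_self par, fun _ _ hx => signDiag_mul par hx,
    eq_smul_signDiag h.mem h.nondeg (mul_superAdj φ₀ par h.nondeg _)⟩

variable {G : Type v} [CommGroup G] {E : BicharPair F G} {c : E.Choice}

theorem IsPresentation.hasFormParity {γ : ι → G} {g₀ : G × ZMod 2} {d : F} {Φ : Matrix ι ι c.D}
    {R : GradedSuperinvAlgebra.{u, w} F G} {e : R.alg.carrier ≃ₐ[F] Matrix ι ι c.D}
    (h : IsPresentation c par γ Φ e) (hΦ : IsHermitianForm c par γ g₀ d Φ) :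
    R.alg.HasFormParity g₀.2 := by
  refine ⟨e.symm (signDiag F c.D par), ?_, fun p x hx => ?_, ?_⟩
  · rw [← map_mul]
    exact (congrArg e.symm (signDiag_mul_self par)).trans (map_one _)
  · apply e.injective
    rw [map_mul, map_smul, map_mul, AlgEquiv.apply_symm_apply]
    exact signDiag_mul par (h.part p x hx)
  · apply e.injective
    rw [map_smul, AlgEquiv.apply_symm_apply]
    refine eq_smul_signDiag (φ₀ := c.transposition) (fun i j hij => (hΦ.homog i j).2 hij) hΦ.isUnit ?_
    rw [h.inv, AlgEquiv.apply_symm_apply]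

end FormParity

theorem exists_smul_one_of_commute {F ι : Type*} [Field F] [Fintype ι] [DecidableEq ι]
    (z : Matrix ι ι F) (hz : ∀ y, z * y = y * z) : ∃ a : F, z = a • 1 := by
  have h1 : z ∈ Subalgebra.center F (Matrix ι ι F) :=
    Subalgebra.mem_center_iff.2 fun y => (hz y).symm
  rw [Algebra.IsCentral.center_eq_bot, Algebra.mem_bot] at h1
  obtain ⟨a, rfl⟩ := h1
  exact ⟨a, Algebra.algebraMap_eq_smul_one a⟩

/-- A graded superalgebra `M*(m, n, p₀)` is isomorphic to a model. -/
theorem MStar.exists_iso_model {F : Type u} [Field F] [IsAlgClosed F] [NeZero (2 : F)] {G : Type v}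
    [CommGroup G] (c : ∀ E : BicharPair F G, E.Choice) {m n : ℕ} {p₀ : ZMod 2}
    {Φ : Matrix (Fin m ⊕ Fin n) (Fin m ⊕ Fin n) F}
    (h : IsSuperHermitian (AlgInvolution.id F) (Sum.elim (fun _ => 0) (fun _ => 1)) p₀ Φ)
    (hmn : m + n ≠ 0) (Γ : (MStar m n p₀ Φ h).Grading G) :
    ∃ P : ModelParams F G c, P.g₀.2 = p₀ ∧
      GradedSuperinvAlgebra.Iso ⟨MStar m n p₀ Φ h, Γ⟩ P.model := by
  let R : GradedSuperinvAlgebra.{u, u} F G := ⟨MStar m n p₀ Φ h, Γ⟩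
  have hne : Nonempty (Fin m ⊕ Fin n) := by
    rw [← Fintype.card_pos_iff, Fintype.card_sum, Fintype.card_fin, Fintype.card_fin]
    omega
  have : FiniteDimensional F R.alg.carrier :=
    inferInstanceAs (FiniteDimensional F (Matrix (Fin m ⊕ Fin n) (Fin m ⊕ Fin n) F))
  have : Nontrivial R.alg.carrier :=
    inferInstanceAs (Nontrivial (Matrix (Fin m ⊕ Fin n) (Fin m ⊕ Fin n) F))
  have hcent : ∀ z : R.alg.carrier, (∀ y, z * y = y * z) → ∃ a : F, z = a • 1 :=
    exists_smul_one_of_commute (ι := Fin m ⊕ Fin n)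
  obtain ⟨E, hE⟩ := R.exists_presentation
    (isPrimeRing_matrix (ι := Fin m ⊕ Fin n) (isPrimeRing_field F)) hcent
  obtain ⟨k, par, γ, g₀, Ψ, f, hf, hΨ⟩ := hE (c E)
  have hk : Nonempty (Fin k) := by
    by_contra hk
    rw [not_nonempty_iff] at hk
    have : Nontrivial (Matrix (Fin k) (Fin k) (c E).D) := f.injective.nontrivial
    exact false_of_nontrivial_of_subsingleton (Matrix (Fin k) (Fin k) (c E).D)
  obtain ⟨κ, hκ0, hκ, hcard⟩ := hΨ.exists_admissible
  -- The form found in the presentation has parity `p₀` because its parity is an invariant of the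
  -- ungraded superalgebra with superinvolution.
  exact ⟨⟨E, κ, g₀, hκ0, hκ⟩,
    (hf.hasFormParity hΨ).unique hcent (matrixSuperinv_hasFormParity h),
    hf.iso_model ⟨E, κ, g₀, hκ0, hκ⟩ hΨ hcard⟩

theorem mainTheorem7 {F : Type*} [Field F] [IsAlgClosed F] [NeZero (2 : F)]
    {G : Type*} [CommGroup G] (c : ∀ E : BicharPair F G, E.Choice) :
    (∀ (m n : ℕ) (p₀ : ZMod 2) (Φ : Matrix (Fin m ⊕ Fin n) (Fin m ⊕ Fin n) F)
      (h : IsSuperHermitian (AlgInvolution.id F) (Sum.elim (fun _ => 0) (fun _ => 1)) p₀ Φ)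
      (_ : m + n ≠ 0) (Γ : (MStar m n p₀ Φ h).Grading G),
      ∃ P : ModelParams F G c, P.g₀.2 = p₀ ∧
        GradedSuperinvAlgebra.Iso ⟨MStar m n p₀ Φ h, Γ⟩ P.model) ∧
    (∀ P P' : ModelParams F G c, P.model.Iso P'.model ↔
      ∃ hT : P.base.T = P'.base.T,
        (∀ (s t : G) (hs : s ∈ P.base.T) (ht : t ∈ P.base.T),
          P.base.β ⟨s, hs⟩ ⟨t, ht⟩ = P'.base.β ⟨s, hT ▸ hs⟩ ⟨t, hT ▸ ht⟩) ∧
        ∃ g : G,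
          (∀ (i : ZMod 2) (x : G),
            P'.κ i (x : G ⧸ P'.base.T) = P.κ i ((g⁻¹ * x : G) : G ⧸ P.base.T)) ∧
          P'.g₀ = ((g ^ 2)⁻¹ * P.g₀.1, P.g₀.2)) :=
  ⟨fun _ _ _ _ h hmn Γ => MStar.exists_iso_model c h hmn Γ, fun P P' =>
    ⟨fun h => P.exists_translate_of_iso P' h, fun ⟨hT, hβ, g, hκ, hg⟩ =>
      P.iso_of_translate P' hT hβ g hκ hg⟩⟩
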